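/- Work in the word RAM model with words of $w$ bits, unit-cost arithmetic (including multiplication and division), bitwise, shift, comparison and memory operations, where $w \ge \kappa\,(1+\log n)$ for a constant $\kappa$ depending only on $c$. The space of a data structure is the number of words that it occupies. Let $c$ be a fixed constant with $0<c<1$; all constants hidden in the $O$-notation, and the query programs, depend only on $c$. (1) For every set $P$ of at most $n$ points of the grid $\{1,\dots,n\}\times\{1,\dots,n\}$ there is a data structure using $O(n)$ space that, for every query point $q=(q_x,q_y)$ of the grid, returns in $O(\log\log n)$ time an integer $k'\ge 0$ with $|k'-k|\le k^{c}$, where $k=|\{(x,y)\in P : x\ge q_x,\ y\ge q_y\}|$ is the number of points of $P$ that dominate $q$. (2) For every set $P$ of at most $n$ points of the grid $\{1,\dots,n\}\times\{1,\dots,n\}$ there is a data structure using $O(n\log^2 n)$ space that, for every query rectangle $Q=[a_x,b_x]\times[a_y,b_y]$ with corners on the grid, returns in $O(\log\log n)$ time an integer $k'\ge 0$ with $|k'-k|\le k^{c}$, where $k=|P\cap Q|$. (For the finitely many small $n$ where $\log n$ or $\log\log n$ is less than $1$, they are to be read as $1$.) -/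

import Mathlib

/-! ### The word RAM

Words are bit vectors of length `w`. A program is a structured program over finitely many
word-sized registers and a memory of `S` words. Every arithmetic, memory and test instruction
costs one step. -/

namespace WordRAM

/-- An operand of an instruction: the content of a register, or a constant of the program. -/
inductive Operand where
  | reg (r : ℕ)
  | imm (k : ℕ)

/-- The arithmetic, bitwise and shift instructions on words. -/
inductive BinOp where
  | add | sub | mul | div | and | or | xor | shl | shr

/-- The result of an instruction on words (arithmetic is modulo `2 ^ w`, and unsigned). -/
def BinOp.apply {w : ℕ} : BinOp → BitVec w → BitVec w → BitVec w
  | .add, x, y => x + y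
  | .sub, x, y => x - y
  | .mul, x, y => x * y
  | .div, x, y => x / y
  | .and, x, y => x &&& y
  | .or, x, y => x ||| y
  | .xor, x, y => x ^^^ y
  | .shl, x, y => x <<< y.toNat
  | .shr, x, y => x >>> y.toNat

/-- The comparisons of (unsigned) words. -/
inductive Cmp where
  | eq | lt | le

/-- The truth value of a comparison. -/
def Cmp.Holds {w : ℕ} : Cmp → BitVec w → BitVec w → Prop
  | .eq, x, y => x = y
  | .lt, x, y => x.toNat < y.toNat
  | .le, x, y => x.toNat ≤ y.toNat

/-- Programs. A program does not depend on the word length or on the size of the memory. -/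
inductive Prog where
  /-- do nothing -/
  | skip
  /-- `dst := a o b` -/
  | op (dst : ℕ) (o : BinOp) (a b : Operand)
  /-- `dst := memory[a]` -/
  | load (dst : ℕ) (a : Operand)
  /-- `memory[a] := b` -/
  | store (a b : Operand)
  /-- first `p`, then `q` -/
  | seq (p q : Prog)
  /-- if `a t b` then `p` else `q` -/
  | branch (t : Cmp) (a b : Operand) (p q : Prog)
  /-- while `a t b` do `p` -/
  | loop (t : Cmp) (a b : Operand) (p : Prog)

/-- A configuration of a machine with words of `w` bits and a memory of `S` words. -/
structure State (w S : ℕ) where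
  regs : ℕ → BitVec w
  mem : Fin S → BitVec w

/-- The value of an operand. -/
def State.val {w S : ℕ} (s : State w S) : Operand → BitVec w
  | .reg r => s.regs r
  | .imm k => BitVec.ofNat w k

/-- Writing a register. -/
def State.setReg {w S : ℕ} (s : State w S) (r : ℕ) (x : BitVec w) : State w S :=
  { s with regs := Function.update s.regs r x }

/-- Writing a memory cell. -/
def State.setMem {w S : ℕ} (s : State w S) (i : Fin S) (x : BitVec w) : State w S :=
  { s with mem := Function.update s.mem i x }

/-- `Exec p s t s'`: started in `s`, the program `p` halts in `s'` after exactly `t` steps.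
A program that accesses a cell outside the memory does not halt. -/
inductive Exec {w S : ℕ} : Prog → State w S → ℕ → State w S → Prop where
  | skip (s : State w S) : Exec .skip s 1 s
  | op (s : State w S) (dst : ℕ) (o : BinOp) (a b : Operand) :
      Exec (.op dst o a b) s 1 (s.setReg dst (o.apply (s.val a) (s.val b)))
  | load (s : State w S) (dst : ℕ) (a : Operand) (h : (s.val a).toNat < S) :
      Exec (.load dst a) s 1 (s.setReg dst (s.mem ⟨(s.val a).toNat, h⟩))
  | store (s : State w S) (a b : Operand) (h : (s.val a).toNat < S) :
      Exec (.store a b) s 1 (s.setMem ⟨(s.val a).toNat, h⟩ (s.val b))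
  | seq {p q : Prog} {s s' s'' : State w S} {t t' : ℕ} :
      Exec p s t s' → Exec q s' t' s'' → Exec (.seq p q) s (t + t') s''
  | branch_true {c : Cmp} {a b : Operand} {p q : Prog} {s s' : State w S} {t : ℕ} :
      c.Holds (s.val a) (s.val b) → Exec p s t s' → Exec (.branch c a b p q) s (t + 1) s'
  | branch_false {c : Cmp} {a b : Operand} {p q : Prog} {s s' : State w S} {t : ℕ} :
      ¬ c.Holds (s.val a) (s.val b) → Exec q s t s' → Exec (.branch c a b p q) s (t + 1) s'
  | loop_true {c : Cmp} {a b : Operand} {p : Prog} {s s' s'' : State w S} {t t' : ℕ} :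
      c.Holds (s.val a) (s.val b) → Exec p s t s' → Exec (.loop c a b p) s' t' s'' →
        Exec (.loop c a b p) s (t + t' + 1) s''
  | loop_false {c : Cmp} {a b : Operand} {p : Prog} {s : State w S} :
      ¬ c.Holds (s.val a) (s.val b) → Exec (.loop c a b p) s 1 s

/-- The start configuration of a query: the memory holds the data structure `D`, the registers
`0, 1, …` hold the arguments of the query, all other registers hold `0`. -/
def start {w S : ℕ} (D : Fin S → BitVec w) (args : List ℕ) : State w S where
  regs r := BitVec.ofNat w (args.getD r 0)
  mem := D

/-- On the data structure `D` and the query `args`, the program `p` halts after at most `T` steps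
with the answer `out` in register `0`, and leaves the data structure as it was. -/
def Answers {w S : ℕ} (p : Prog) (D : Fin S → BitVec w) (args : List ℕ) (T out : ℕ) : Prop :=
  ∃ (t : ℕ) (s : State w S), t ≤ T ∧ Exec p (start D args) t s ∧
    s.mem = D ∧ (s.regs 0).toNat = out

end WordRAM

/-! ### Points and ranges on a grid -/

/-- The `n × n` grid `{1, …, n} × {1, …, n}`. -/
def grid (n : ℕ) : Finset (ℕ × ℕ) := Finset.Icc 1 n ×ˢ Finset.Icc 1 n

/-- The number of points of `P` that dominate `q`. -/
def dominanceCount (P : Finset (ℕ × ℕ)) (q : ℕ × ℕ) : ℕ :=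
  (P.filter fun p => q.1 ≤ p.1 ∧ q.2 ≤ p.2).card

/-- The number of points of `P` in the rectangle `[a.1, b.1] × [a.2, b.2]`. -/
def rangeCount (P : Finset (ℕ × ℕ)) (a b : ℕ × ℕ) : ℕ :=
  (P.filter fun p => (a.1 ≤ p.1 ∧ p.1 ≤ b.1) ∧ (a.2 ≤ p.2 ∧ p.2 ≤ b.2)).card

/-! Ranks. For a set `A` and `L`-bit queries, keep the sorted sequence of `A` and, in a two-level
hash table (`exists_perfect`), all binary prefixes of every `L`-th element. Binary search over the
prefix lengths finds the longest prefix of a query that is stored. It determines the rank of the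
query among the sampled elements, hence its rank in `A` up to `L` (`nonempty_rankData`), and a
second binary search in that window finishes. This takes time `O(log L)` and space `O(#A + L)`
(`wp_rank`, `exists_rankBlock`).

Dominance. In rank space the points form the graph of an injection `π` of `[0, m)` into itself, and
a query asks for the number `k` of `x ≥ r` with `π x ≥ s`. Fix a constant `g` and a scale `f`, and
cut `[r, m)` at the right ends of the slabs of widths `2^(2f), 2^(3f), …, 2^(gf)` that contain `r`.
The piece that begins at the end of the slab of width `2^(fd)` depends only on that slab and has at
most `2^(fd+f)` points; for the last piece, which is unbounded to the right, this is enforced by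
dropping the points below the stair, the least height above which at most `2^(fg)` points are left.
Of every piece only each `2^(2f)`-th height from above is kept. A level `d ≥ 2` then costs at most
`m / 2^f` heights, so all the scales `f₀ * 2^i` together cost `O(g m)` (`card_domKeys_le`). The
error is at most `2^(2f)` for each piece and for the skipped start, together `g * 2^(2f)`
(`approx_le`).

A query takes the first scale whose stair is not above `s`. If the preceding scale `f/2` was
rejected, then `k > 2^(fg/2)`, and `g * c ≥ 6` makes the error smaller than `k^c`
(`exists_approx_params`). If the first scale is accepted, the error is a constant; counts below a
constant `K` are answered exactly from the `K` highest points to the right of each `r`, and for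
larger counts `k^c` exceeds that constant. Scales double and those beyond `log m` are always
accepted, so `O(log log n)` of them are tried (`wp_scan`). All pieces are stored in one set with
tags, and counting in a piece is a difference of two ranks (`rk_domKeys`).

Ranges. Many point sets ("classes") share two rank structures that translate a query into the rank
space of its class (`wp_familyQuery`). For ranges there is a class for each dyadic rectangle, so a
point is in `O(log² n)` of them. At the level where the ends of an interval separate in the binary
trie, the interval is a suffix of one dyadic block and a prefix of the next; with prefixes
reflected, a rectangle becomes four dominance queries (`sum_classCount_rectFamily`). -/

namespace WordRAM

/-! ### Program logic: executing expressions, assignments, branches and loops on numbers -/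

variable {w S : ℕ}

/-- The content of a memory cell as a natural number (`0` outside the memory). -/
def cell (D : Fin S → BitVec w) (a : ℕ) : ℕ := if h : a < S then (D ⟨a, h⟩).toNat else 0

/-- The state `s` has memory `D`, and its registers below `1000` hold the numbers `ρ`. -/
def Rep (D : Fin S → BitVec w) (ρ : ℕ → ℕ) (s : State w S) : Prop :=
  s.mem = D ∧ ∀ r < 1000, s.regs r = BitVec.ofNat w (ρ r)

/-- Started with registers `ρ` on the memory `D`, the program `p` halts, leaves the memory
unchanged, and the number of steps and the final registers satisfy `Q`. -/
def WP (D : Fin S → BitVec w) (p : Prog) (ρ : ℕ → ℕ) (Q : ℕ → (ℕ → ℕ) → Prop) : Prop :=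
  ∀ s, Rep D ρ s → ∃ t s' ρ', Exec p s t s' ∧ Rep D ρ' s' ∧ Q t ρ'

/-- Expressions over registers and memory. -/
inductive Expr where
  | var (i : ℕ)
  | lit (k : ℕ)
  | bin (o : BinOp) (a b : Expr)
  | ld (a : Expr)

/-- The operations on natural numbers that the instructions implement. -/
def BinOp.nat : BinOp → ℕ → ℕ → ℕ
  | .add, x, y => x + y
  | .sub, x, y => x - y
  | .mul, x, y => x * y
  | .div, x, y => x / y
  | .and, x, y => x &&& y
  | .or, x, y => x ||| y
  | .xor, x, y => x ^^^ y
  | .shl, x, y => x * 2 ^ y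
  | .shr, x, y => x / 2 ^ y

/-- Sufficient conditions for an instruction to agree with the operation on numbers. -/
def BinOp.Ok (w : ℕ) : BinOp → ℕ → ℕ → Prop
  | .add, _, _ => True
  | .sub, x, y => y ≤ x
  | .mul, _, _ => True
  | .shl, _, y => y < 2 ^ w
  | _, x, y => x < 2 ^ w ∧ y < 2 ^ w

namespace Expr

/-- The value of an expression. -/
def eval (D : Fin S → BitVec w) (ρ : ℕ → ℕ) : Expr → ℕ
  | var i => ρ i
  | lit k => k
  | bin o a b => o.nat (a.eval D ρ) (b.eval D ρ)
  | ld a => cell D (a.eval D ρ)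

/-- The expression can be evaluated without overflow. -/
def Ok (D : Fin S → BitVec w) (ρ : ℕ → ℕ) : Expr → Prop
  | var i => i < 1000
  | lit _ => True
  | bin o a b => a.Ok D ρ ∧ b.Ok D ρ ∧ o.Ok w (a.eval D ρ) (b.eval D ρ)
  | ld a => a.Ok D ρ ∧ a.eval D ρ < S ∧ S ≤ 2 ^ w

/-- Evaluation of an expression into register `t`, with the registers above `t` as scratch. -/
def compile : Expr → ℕ → Prog
  | var i, t => .op t .add (.reg i) (.imm 0)
  | lit k, t => .op t .add (.imm k) (.imm 0)
  | bin o a b, t =>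
      .seq (a.compile t) (.seq (b.compile (t + 1)) (.op t o (.reg t) (.reg (t + 1))))
  | ld a, t => .seq (a.compile t) (.load t (.reg t))

/-- The number of steps of the evaluation. -/
def cost : Expr → ℕ
  | var _ => 1
  | lit _ => 1
  | bin _ a b => a.cost + (b.cost + 1)
  | ld a => a.cost + 1

end Expr

/-- Reduction modulo `2 ^ w` commutes with sums, products, nonnegative differences and left shifts
by a representable amount, so there the operands may be large. Division, right shifts and the
bitwise operations need the true values of both operands. -/
theorem BinOp.apply_ofNat (o : BinOp) {x y : ℕ} (h : o.Ok w x y) :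
    o.apply (BitVec.ofNat w x) (BitVec.ofNat w y) = BitVec.ofNat w (o.nat x y) := by
  cases o <;> simp only [BinOp.Ok] at h <;> simp only [BinOp.apply, BinOp.nat]
  · rw [BitVec.ofNat_add]
  · apply BitVec.eq_of_toNat_eq
    have h2 : BitVec.ofNat w (x - y) + BitVec.ofNat w y = BitVec.ofNat w x := by
      rw [← BitVec.ofNat_add, Nat.sub_add_cancel h]
    rw [← h2, BitVec.add_sub_cancel]
  · rw [BitVec.ofNat_mul]
  · apply BitVec.eq_of_toNat_eq
    simp only [BitVec.toNat_udiv, BitVec.toNat_ofNat, Nat.mod_eq_of_lt h.1, Nat.mod_eq_of_lt h.2]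
    rw [Nat.mod_eq_of_lt (lt_of_le_of_lt (Nat.div_le_self _ _) h.1)]
  · apply BitVec.eq_of_toNat_eq
    simp only [BitVec.toNat_and, BitVec.toNat_ofNat, Nat.mod_eq_of_lt h.1, Nat.mod_eq_of_lt h.2]
    rw [Nat.mod_eq_of_lt (Nat.and_lt_two_pow _ h.2)]
  · apply BitVec.eq_of_toNat_eq
    simp only [BitVec.toNat_or, BitVec.toNat_ofNat, Nat.mod_eq_of_lt h.1, Nat.mod_eq_of_lt h.2]
    rw [Nat.mod_eq_of_lt (Nat.or_lt_two_pow h.1 h.2)]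
  · apply BitVec.eq_of_toNat_eq
    simp only [BitVec.toNat_xor, BitVec.toNat_ofNat, Nat.mod_eq_of_lt h.1, Nat.mod_eq_of_lt h.2]
    rw [Nat.mod_eq_of_lt (Nat.xor_lt_two_pow h.1 h.2)]
  · apply BitVec.eq_of_toNat_eq
    simp only [BitVec.toNat_shiftLeft, BitVec.toNat_ofNat, Nat.mod_eq_of_lt h, Nat.shiftLeft_eq]
    rw [Nat.mod_mul_mod]
  · apply BitVec.eq_of_toNat_eq
    simp only [BitVec.toNat_ushiftRight, BitVec.toNat_ofNat, Nat.mod_eq_of_lt h.1,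
      Nat.mod_eq_of_lt h.2, Nat.shiftRight_eq_div_pow]
    rw [Nat.mod_eq_of_lt (lt_of_le_of_lt (Nat.div_le_self _ _) h.1)]

/-- The registers from `1000` on, of which `Rep` says nothing, serve as an evaluation stack. Code
compiled at `t` leaves everything below `t` alone, so a left operand in `t` survives the evaluation
of the right operand at `t + 1`. -/
theorem Expr.compile_spec (D : Fin S → BitVec w) (ρ : ℕ → ℕ) (e : Expr) :
    ∀ (t : ℕ) (s : State w S), 1000 ≤ t → Rep D ρ s → e.Ok D ρ →
      ∃ s' : State w S, Exec (e.compile t) s e.cost s' ∧ Rep D ρ s' ∧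
        s'.regs t = BitVec.ofNat w (e.eval D ρ) ∧ ∀ r < t, s'.regs r = s.regs r := by
  have key : ∀ (t : ℕ) (s : State w S) (x : BitVec w), 1000 ≤ t → Rep D ρ s →
      Rep D ρ (s.setReg t x) ∧ (s.setReg t x).regs t = x ∧
        ∀ r < t, (s.setReg t x).regs r = s.regs r := by
    intro t s x ht hs
    refine ⟨⟨hs.1, fun r hr => ?_⟩, by simp [State.setReg], fun r hr => ?_⟩
    · simp only [State.setReg]
      rw [Function.update_of_ne (by omega)]
      exact hs.2 r hr
    · simp only [State.setReg]
      rw [Function.update_of_ne (by omega)]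
  induction e with
  | var i =>
    intro t s ht hs ho
    obtain ⟨h1, h2, h3⟩ := key t s (s.regs i) ht hs
    refine ⟨s.setReg t (s.regs i), ?_, h1, ?_, h3⟩
    · have := Exec.op s t .add (.reg i) (.imm 0)
      simpa [BinOp.apply, State.val, Expr.compile, Expr.cost] using this
    · rw [h2, hs.2 i ho]; rfl
  | lit k =>
    intro t s ht hs ho
    obtain ⟨h1, h2, h3⟩ := key t s (BitVec.ofNat w k) ht hs
    refine ⟨s.setReg t (BitVec.ofNat w k), ?_, h1, ?_, h3⟩
    · have := Exec.op s t .add (.imm k) (.imm 0)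
      simpa [BinOp.apply, State.val, Expr.compile, Expr.cost] using this
    · rw [h2]; rfl
  | bin o a b iha ihb =>
    intro t s ht hs ho
    obtain ⟨s1, e1, r1, v1, f1⟩ := iha t s ht hs ho.1
    obtain ⟨s2, e2, r2, v2, f2⟩ := ihb (t + 1) s1 (by omega) r1 ho.2.1
    have e3 := Exec.op s2 t o (.reg t) (.reg (t + 1))
    obtain ⟨h1, h2, h3⟩ := key t s2 (o.apply (s2.regs t) (s2.regs (t + 1))) ht r2
    refine ⟨_, Exec.seq e1 (Exec.seq e2 e3), h1, ?_, fun r hr => ?_⟩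
    · refine h2.trans ?_
      rw [f2 t (by omega), v1, v2, BinOp.apply_ofNat o ho.2.2]; rfl
    · exact (h3 r hr).trans ((f2 r (by omega)).trans (f1 r hr))
  | ld a iha =>
    intro t s ht hs ho
    obtain ⟨s1, e1, r1, v1, f1⟩ := iha t s ht hs ho.1
    have hv : (s1.val (.reg t)).toNat = a.eval D ρ := by
      simp only [State.val, v1, BitVec.toNat_ofNat]
      exact Nat.mod_eq_of_lt (lt_of_lt_of_le ho.2.1 ho.2.2)
    have hlt : (s1.val (.reg t)).toNat < S := by rw [hv]; exact ho.2.1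
    have e3 := Exec.load s1 t (.reg t) hlt
    obtain ⟨h1, h2, h3⟩ := key t s1 (s1.mem ⟨_, hlt⟩) ht r1
    refine ⟨_, Exec.seq e1 e3, h1, ?_, fun r hr => (h3 r hr).trans (f1 r hr)⟩
    refine h2.trans ?_
    apply BitVec.eq_of_toNat_eq
    have : s1.mem ⟨_, hlt⟩ = D ⟨a.eval D ρ, ho.2.1⟩ := by
      rw [r1.1]; congr 1; exact Fin.ext hv
    rw [this]
    simp [Expr.eval, cell, ho.2.1]

/-- Assignment of the value of an expression to a register. -/
def asg (x : ℕ) (e : Expr) : Prog := .seq (e.compile 1000) (.op x .add (.reg 1000) (.imm 0))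

/-- A sequence of assignments. -/
def asgs : List (ℕ × Expr) → Prog
  | [] => .skip
  | (x, e) :: l => .seq (asg x e) (asgs l)

/-- The effect of a sequence of assignments. -/
@[simp] def runAsgs (D : Fin S → BitVec w) : List (ℕ × Expr) → (ℕ → ℕ) → (ℕ → ℕ)
  | [], ρ => ρ
  | (x, e) :: l, ρ => runAsgs D l (Function.update ρ x (e.eval D ρ))

/-- A sequence of assignments can be executed without overflow. -/
@[simp] def OkAsgs (D : Fin S → BitVec w) : List (ℕ × Expr) → (ℕ → ℕ) → Prop
  | [], _ => True
  | (x, e) :: l, ρ => x < 1000 ∧ e.Ok D ρ ∧ OkAsgs D l (Function.update ρ x (e.eval D ρ))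

/-- The number of steps of a sequence of assignments. -/
@[simp] def costAsgs : List (ℕ × Expr) → ℕ
  | [] => 1
  | (_, e) :: l => e.cost + 1 + costAsgs l

section Rules

variable {D : Fin S → BitVec w} {ρ : ℕ → ℕ} {Q Q' : ℕ → (ℕ → ℕ) → Prop}

theorem WP.mono {p : Prog} (h : WP D p ρ Q) (hQ : ∀ t ρ', Q t ρ' → Q' t ρ') : WP D p ρ Q' := by
  intro s hs
  obtain ⟨t, s', ρ', h1, h2, h3⟩ := h s hs
  exact ⟨t, s', ρ', h1, h2, hQ _ _ h3⟩

theorem WP.seq {p q : Prog} (h : WP D p ρ fun t ρ' => WP D q ρ' fun t' => Q (t + t')) :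
    WP D (.seq p q) ρ Q := by
  intro s hs
  obtain ⟨t, s', ρ', h1, h2, h3⟩ := h s hs
  obtain ⟨t', s'', ρ'', h4, h5, h6⟩ := h3 s' h2
  exact ⟨_, _, _, Exec.seq h1 h4, h5, h6⟩

theorem WP.skip (h : Q 1 ρ) : WP D .skip ρ Q := fun s hs => ⟨1, s, ρ, Exec.skip s, hs, h⟩

theorem WP.asg {x : ℕ} {e : Expr} (hx : x < 1000) (he : e.Ok D ρ)
    (h : Q (e.cost + 1) (Function.update ρ x (e.eval D ρ))) : WP D (asg x e) ρ Q := by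
  intro s hs
  obtain ⟨s1, e1, r1, v1, -⟩ := e.compile_spec D ρ 1000 s le_rfl hs he
  refine ⟨_, _, _, Exec.seq e1 (Exec.op s1 x .add (.reg 1000) (.imm 0)), ⟨r1.1, ?_⟩, h⟩
  intro r hr
  simp only [State.setReg, State.val, BinOp.apply, v1, BitVec.add_zero]
  by_cases hrx : r = x
  · subst hrx; simp
  · rw [Function.update_of_ne hrx, Function.update_of_ne hrx]; exact r1.2 r hr

theorem WP.asgs {l : List (ℕ × Expr)} (hl : OkAsgs D l ρ)
    (h : Q (costAsgs l) (runAsgs D l ρ)) : WP D (asgs l) ρ Q := by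
  induction l generalizing ρ Q with
  | nil => exact WP.skip h
  | cons a l ih =>
    obtain ⟨x, e⟩ := a
    exact WP.seq (WP.asg hl.1 hl.2.1 (ih hl.2.2 h))

/-- A frame rule. The side condition is Boolean so that `rfl` settles it for a concrete list of
assignments. -/
theorem runAsgs_of_le (N : ℕ) {l : List (ℕ × Expr)} (hl : (l.map Prod.fst).all (· < N) = true)
    {r : ℕ} (hr : N ≤ r) : runAsgs D l ρ r = ρ r := by
  induction l generalizing ρ with
  | nil => rfl
  | cons a l ih =>
    simp only [List.map_cons, List.all_cons, Bool.and_eq_true, decide_eq_true_eq] at hl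
    rw [runAsgs, ih hl.2, Function.update_of_ne (by omega)]

/-- The property `P` names the facts to be remembered; the nested updates of `ρ` are then forgotten.
-/
theorem WP.asgs_of {l : List (ℕ × Expr)} (P : (ℕ → ℕ) → Prop) (hl : OkAsgs D l ρ)
    (hP : P (runAsgs D l ρ)) (h : ∀ ρ', P ρ' → Q (costAsgs l) ρ') :
    WP D (WordRAM.asgs l) ρ Q :=
  WP.asgs hl (h _ hP)

/-- The value of an operand as a number. -/
def Operand.nat (ρ : ℕ → ℕ) : Operand → ℕ
  | .reg r => ρ r
  | .imm k => k

/-- The operand is a small register or constant. -/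
def Operand.Ok (w : ℕ) (ρ : ℕ → ℕ) (a : Operand) : Prop :=
  (match a with
    | .reg r => r < 1000
    | .imm _ => True) ∧ a.nat ρ < 2 ^ w

/-- The comparisons of numbers. -/
def Cmp.nat : Cmp → ℕ → ℕ → Prop
  | .eq, x, y => x = y
  | .lt, x, y => x < y
  | .le, x, y => x ≤ y

theorem Operand.val_toNat {s : State w S} {a : Operand} (hs : Rep D ρ s) (ha : a.Ok w ρ) :
    (s.val a).toNat = a.nat ρ := by
  cases a with
  | reg r =>
    simp only [State.val, Operand.nat, hs.2 r ha.1, BitVec.toNat_ofNat]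
    exact Nat.mod_eq_of_lt ha.2
  | imm k =>
    simp only [State.val, Operand.nat, BitVec.toNat_ofNat]
    exact Nat.mod_eq_of_lt ha.2

theorem Cmp.holds_iff {c : Cmp} {s : State w S} {a b : Operand} (hs : Rep D ρ s)
    (ha : a.Ok w ρ) (hb : b.Ok w ρ) :
    c.Holds (s.val a) (s.val b) ↔ c.nat (a.nat ρ) (b.nat ρ) := by
  rw [← Operand.val_toNat hs ha, ← Operand.val_toNat hs hb]
  cases c
  · exact BitVec.toNat_inj.symm
  · exact Iff.rfl
  · exact Iff.rfl

theorem WP.branch {c : Cmp} {a b : Operand} {p q : Prog} (ha : a.Ok w ρ) (hb : b.Ok w ρ)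
    (h1 : c.nat (a.nat ρ) (b.nat ρ) → WP D p ρ fun t => Q (t + 1))
    (h2 : ¬ c.nat (a.nat ρ) (b.nat ρ) → WP D q ρ fun t => Q (t + 1)) :
    WP D (.branch c a b p q) ρ Q := by
  intro s hs
  by_cases hc : c.nat (a.nat ρ) (b.nat ρ)
  · obtain ⟨t, s', ρ', e1, e2, e3⟩ := h1 hc s hs
    exact ⟨_, _, _, Exec.branch_true ((Cmp.holds_iff hs ha hb).2 hc) e1, e2, e3⟩
  · obtain ⟨t, s', ρ', e1, e2, e3⟩ := h2 hc s hs
    exact ⟨_, _, _, Exec.branch_false (fun hh => hc ((Cmp.holds_iff hs ha hb).1 hh)) e1, e2, e3⟩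

/-- The index of the invariant is also the variant: each round lowers it, so its initial value
bounds the number of rounds. -/
theorem WP.loop {c : Cmp} {a b : Operand} {p : Prog} (T : ℕ) (I : ℕ → (ℕ → ℕ) → Prop)
    (hok : ∀ k ρ, I k ρ → a.Ok w ρ ∧ b.Ok w ρ)
    (hstep : ∀ k ρ, I k ρ → c.nat (a.nat ρ) (b.nat ρ) →
      WP D p ρ fun t ρ' => t ≤ T ∧ ∃ k' < k, I k' ρ') (k : ℕ) (ρ : ℕ → ℕ) (hI : I k ρ) :
    WP D (.loop c a b p) ρ fun t ρ' => t ≤ k * (T + 1) + 1 ∧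
      ∃ k', I k' ρ' ∧ ¬ c.nat (a.nat ρ') (b.nat ρ') := by
  induction k using Nat.strong_induction_on generalizing ρ with
  | _ k ih =>
    intro s hs
    have ho := hok k ρ hI
    by_cases hc : c.nat (a.nat ρ) (b.nat ρ)
    · obtain ⟨t, s', ρ', e1, e2, ht, k', hk, hI'⟩ := hstep k ρ hI hc s hs
      obtain ⟨t', s'', ρ'', e4, e5, ht', h6⟩ := ih k' hk ρ' hI' s' e2
      refine ⟨_, _, _, Exec.loop_true ((Cmp.holds_iff hs ho.1 ho.2).2 hc) e1 e4, e5, ?_, h6⟩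
      have : (k' + 1) * (T + 1) ≤ k * (T + 1) := Nat.mul_le_mul_right _ hk
      rw [Nat.add_mul] at this
      omega
    · exact ⟨_, _, _, Exec.loop_false (fun hh => hc ((Cmp.holds_iff hs ho.1 ho.2).1 hh)), hs,
        by omega, k, hI, hc⟩

end Rules

/-! ### Lists laid out in memory -/

/-- The list `l` is stored in the memory from address `b` on. -/
def Stored (D : Fin S → BitVec w) (b : ℕ) (l : List ℕ) : Prop :=
  b + l.length ≤ S ∧ ∀ i < l.length, cell D (b + i) = l.getD i 0

theorem stored_append {D : Fin S → BitVec w} {b : ℕ} {l l' : List ℕ} :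
    Stored D b (l ++ l') ↔ Stored D b l ∧ Stored D (b + l.length) l' := by
  simp only [Stored, List.length_append]
  constructor
  · rintro ⟨h1, h2⟩
    refine ⟨⟨by omega, fun i hi => ?_⟩, by omega, fun i hi => ?_⟩
    · rw [h2 i (by omega), List.getD_append _ _ _ _ hi]
    · have := h2 (l.length + i) (by omega)
      rw [← Nat.add_assoc] at this
      rw [this, List.getD_append_right _ _ _ _ (by omega)]
      congr 1; omega
  · rintro ⟨⟨h1, h2⟩, h3, h4⟩
    refine ⟨by omega, fun i hi => ?_⟩
    by_cases hl : i < l.length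
    · rw [h2 i hl, List.getD_append _ _ _ _ hl]
    · have := h4 (i - l.length) (by omega)
      rw [List.getD_append_right _ _ _ _ (by omega), ← this]
      congr 1; omega

/-- The list of the first `n` values of a function. -/
def tab (n : ℕ) (f : ℕ → ℕ) : List ℕ := (List.range n).map f

@[simp] theorem length_tab (n : ℕ) (f : ℕ → ℕ) : (tab n f).length = n := by simp [tab]

theorem mem_tab {n : ℕ} {f : ℕ → ℕ} {x : ℕ} : x ∈ tab n f ↔ ∃ i < n, f i = x := by simp [tab]

theorem Stored.tab {D : Fin S → BitVec w} {b n : ℕ} {f : ℕ → ℕ} (h : Stored D b (tab n f))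
    {i : ℕ} (hi : i < n) : b + i < S ∧ cell D (b + i) = f i := by
  have h1 := h.1
  have h2 := h.2 i (by simpa using hi)
  rw [length_tab] at h1
  refine ⟨by omega, ?_⟩
  rw [h2]
  simp [WordRAM.tab, List.getD_eq_getElem?_getD, hi]

theorem cell_lt {D : Fin S → BitVec w} (a : ℕ) : cell D a < 2 ^ w := by
  unfold cell
  split
  · exact (D _).isLt
  · positivity

end WordRAM

/-! ### Two-level perfect hashing modulo a prime -/

namespace Hashing

open Finset

/-- The hash function `x ↦ (a x mod p) mod m`. -/
def hash (p a m x : ℕ) : ℕ := a * x % p % m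

theorem card_filter_dvd_Ioo_mul_le (p m : ℕ) (hp : 0 < p) :
    #{e ∈ Ioo 0 p | m ∣ e} * m ≤ p - 1 := by
  have h : ({e ∈ Ioo 0 p | m ∣ e} : Finset ℕ) = {e ∈ Ioc 0 (p - 1) | m ∣ e} := by
    ext e; simp only [mem_filter, mem_Ioo, mem_Ioc]; omega
  rw [h, Nat.Ioc_filter_dvd_card_eq_div]
  exact Nat.div_mul_le_self _ _

/-- A multiplier `a` is determined by the nonzero residue `e = a (x - y) mod p`. If `x` and `y`
collide, their residues `u`, `v` agree modulo `m`, and `e` is `u - v` or `p - (v - u)`; so `e` or `p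
- e` is a multiple of `m` in `(0, p)`, and there are at most `(p - 1) / m` of these. -/
theorem card_collisions_mul_le {p : ℕ} (hp : p.Prime) {m : ℕ} {x y : ℕ}
    (hx : x < p) (hy : y < p) (hxy : x ≠ y) :
    #{a ∈ Ioo 0 p | hash p a m x = hash p a m y} * m ≤ 2 * (p - 1) := by
  have : Fact p.Prime := ⟨hp⟩
  set d : ZMod p := (x : ZMod p) - y with hd
  have hd0 : d ≠ 0 := by
    intro h
    rw [hd, sub_eq_zero, ZMod.natCast_eq_natCast_iff'] at h
    rw [Nat.mod_eq_of_lt hx, Nat.mod_eq_of_lt hy] at h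
    exact hxy h
  have hinj : Set.InjOn (fun a : ℕ => ((a : ZMod p) * d).val)
      ({a ∈ Ioo 0 p | hash p a m x = hash p a m y} : Finset ℕ) := by
    intro a ha b hb hab
    simp only [coe_filter, mem_Ioo, Set.mem_ofPred_eq] at ha hb
    have h1 := mul_right_cancel₀ hd0 (ZMod.val_injective p hab)
    rw [ZMod.natCast_eq_natCast_iff', Nat.mod_eq_of_lt ha.1.2, Nat.mod_eq_of_lt hb.1.2] at h1
    exact h1
  have hsub : ({a ∈ Ioo 0 p | hash p a m x = hash p a m y} : Finset ℕ).image
      (fun a : ℕ => ((a : ZMod p) * d).val) ⊆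
      {e ∈ Ioo 0 p | m ∣ e} ∪ ({e ∈ Ioo 0 p | m ∣ e} : Finset ℕ).image fun e => p - e := by
    intro e he
    simp only [mem_image, mem_filter, mem_Ioo] at he
    obtain ⟨a, ⟨⟨ha0, hap⟩, hh⟩, rfl⟩ := he
    set u := a * x % p with hu
    set v := a * y % p with hv
    have hup : u < p := Nat.mod_lt _ hp.pos
    have hvp : v < p := Nat.mod_lt _ hp.pos
    have hcast : (a : ZMod p) * d = (u : ZMod p) - v := by
      rw [hu, hv, ZMod.natCast_mod, ZMod.natCast_mod, hd]; push_cast; ring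
    have ha : (a : ZMod p) ≠ 0 := by
      intro h
      rw [ZMod.natCast_eq_zero_iff] at h
      exact absurd (Nat.le_of_dvd ha0 h) (by omega)
    have huv : u ≠ v := by
      intro h
      rw [h, sub_self] at hcast
      exact mul_ne_zero ha hd0 hcast
    change u % m = v % m at hh
    simp only [mem_union, mem_filter, mem_Ioo, mem_image]
    rcases lt_or_gt_of_ne huv with hlt | hlt
    · right
      refine ⟨v - u, ⟨by omega, (Nat.modEq_iff_dvd' hlt.le).1 hh⟩, ?_⟩
      have : (a : ZMod p) * d = ((p - (v - u) : ℕ) : ZMod p) := by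
        rw [hcast, Nat.cast_sub (by omega), Nat.cast_sub hlt.le]; simp
      rw [this, ZMod.val_natCast, Nat.mod_eq_of_lt (by omega)]
    · left
      have : (a : ZMod p) * d = ((u - v : ℕ) : ZMod p) := by
        rw [hcast, Nat.cast_sub hlt.le]
      rw [this, ZMod.val_natCast, Nat.mod_eq_of_lt (by omega)]
      exact ⟨by omega, (Nat.modEq_iff_dvd' hlt.le).1 hh.symm⟩
  have h1 := card_le_card hsub
  rw [card_image_of_injOn hinj] at h1
  have h2 := h1.trans ((card_union_le _ _).trans (Nat.add_le_add_left card_image_le _))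
  have h3 := card_filter_dvd_Ioo_mul_le p m hp.pos
  nlinarith

/-- Some multiplier is at least as good as the average over all nonzero ones. -/
theorem exists_few_collisions {p : ℕ} (hp : p.Prime) {m : ℕ} (B : Finset ℕ)
    (hB : ∀ x ∈ B, x < p) :
    ∃ a < p, #{z ∈ B.offDiag | hash p a m z.1 = hash p a m z.2} * m ≤ 2 * #B.offDiag := by
  have hne : (Ioo 0 p).Nonempty := ⟨1, by simp [hp.one_lt]⟩
  have hsum : ∑ a ∈ Ioo 0 p, #{z ∈ B.offDiag | hash p a m z.1 = hash p a m z.2} * m ≤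
      ∑ _a ∈ Ioo 0 p, 2 * #B.offDiag := by
    rw [← sum_mul]
    simp only [card_filter]
    rw [sum_comm, sum_mul]
    simp only [← card_filter]
    calc _ ≤ ∑ z ∈ B.offDiag, 2 * (p - 1) := by
          refine sum_le_sum fun z hz => ?_
          rw [mem_offDiag] at hz
          exact card_collisions_mul_le hp (hB _ hz.1) (hB _ hz.2.1) hz.2.2
      _ = _ := by simp; ring
  obtain ⟨a, ha, h⟩ := exists_le_of_sum_le hne hsum
  exact ⟨a, (mem_Ioo.1 ha).2, h⟩

/-- A two-level hash function. -/
structure Perfect (p : ℕ) where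
  a : ℕ
  M : ℕ
  α : ℕ → ℕ
  μ : ℕ → ℕ
  o : ℕ → ℕ
  R : ℕ

/-- The slot of a key. -/
def Perfect.slot {p : ℕ} (φ : Perfect p) (x : ℕ) : ℕ :=
  φ.o (hash p φ.a φ.M x) + hash p (φ.α (hash p φ.a φ.M x)) (φ.μ (hash p φ.a φ.M x)) x

/-- With `#X + 1` buckets a good first multiplier leaves at most `2 * #X` ordered colliding pairs.
Each bucket gets a private table of size linear in its number of pairs, large enough for some second
multiplier to have no collision, and these tables are laid out one after another. -/
theorem exists_perfect {p : ℕ} (hp : p.Prime) (X : Finset ℕ) (hX : ∀ x ∈ X, x < p) :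
    ∃ φ : Perfect p, φ.a < p ∧ φ.M = #X + 1 ∧ φ.R ≤ 5 * #X + 1 ∧
      (∀ i < φ.M, φ.α i < p ∧ 0 < φ.μ i ∧ φ.o i + φ.μ i ≤ φ.R) ∧ Set.InjOn φ.slot X := by
  obtain ⟨a, hap, ha⟩ := exists_few_collisions hp (m := #X + 1) X hX
  set M := #X + 1 with hM
  let B : ℕ → Finset ℕ := fun i => {x ∈ X | hash p a M x = i}
  -- With this size the bound on (number of collisions) times `μ i` is less than `μ i`, so there is
  -- no collision; the `1` keeps the modulus of an empty bucket positive.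
  let μ : ℕ → ℕ := fun i => 2 * #(B i).offDiag + 1
  have hα : ∀ i, ∃ α < p,
      #{z ∈ (B i).offDiag | hash p α (μ i) z.1 = hash p α (μ i) z.2} * μ i ≤
        2 * #(B i).offDiag := fun i =>
    exists_few_collisions hp (B i) fun x hx => hX x (mem_filter.1 hx).1
  choose α hαp hαc using hα
  let o : ℕ → ℕ := fun i => ∑ j ∈ range i, μ j
  have hoff : ∀ i j, i < j → o i + μ i ≤ o j := by
    intro i j hij
    rw [← sum_range_succ]
    exact sum_le_sum_of_subset (range_subset_range.2 hij)
  have hcoll : ∑ i ∈ range M, #(B i).offDiag =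
      #{z ∈ X.offDiag | hash p a M z.1 = hash p a M z.2} := by
    rw [← card_biUnion]
    · congr 1
      ext ⟨x, y⟩
      simp only [mem_biUnion, mem_range, mem_offDiag, B, mem_filter]
      constructor
      · rintro ⟨i, -, ⟨h1, h2⟩, ⟨h3, h4⟩, h5⟩
        exact ⟨⟨h1, h3, h5⟩, h2.trans h4.symm⟩
      · rintro ⟨⟨h1, h2, h3⟩, h4⟩
        exact ⟨hash p a M x, Nat.mod_lt _ (by omega), ⟨h1, rfl⟩, ⟨h2, h4.symm⟩, h3⟩
    · intro i _ j _ hij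
      rw [Function.onFun, disjoint_left]
      rintro ⟨x, y⟩ h1 h2
      simp only [mem_offDiag, B, mem_filter] at h1 h2
      exact hij (h1.1.2.symm.trans h2.1.2)
  have hR : o M ≤ 5 * #X + 1 := by
    have h1 : o M = 2 * ∑ i ∈ range M, #(B i).offDiag + M := by
      simp only [o, μ, sum_add_distrib, ← mul_sum]; simp
    rw [← hcoll] at ha
    have h2 : #X.offDiag ≤ #X * #X := by rw [offDiag_card]; omega
    have h3 : ∑ i ∈ range M, #(B i).offDiag ≤ 2 * #X := by
      by_contra hcon
      push Not at hcon
      have : (2 * #X + 1) * M ≤ (∑ i ∈ range M, #(B i).offDiag) * M :=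
        Nat.mul_le_mul_right _ hcon
      nlinarith
    omega
  refine ⟨⟨a, M, α, μ, o, o M⟩, hap, rfl, hR, fun i hi => ⟨hαp i, by simp [μ], hoff i M hi⟩, ?_⟩
  intro x hx y hy hxy
  simp only [Perfect.slot] at hxy
  set i := hash p a M x with hi
  set j := hash p a M y with hj
  have hμi : hash p (α i) (μ i) x < μ i := Nat.mod_lt _ (by simp [μ])
  have hμj : hash p (α j) (μ j) y < μ j := Nat.mod_lt _ (by simp [μ])
  rcases lt_trichotomy i j with hij | hij | hij
  · have := hoff i j hij; omega
  · by_contra hne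
    rw [← hij] at hxy
    have hc : #{z ∈ (B i).offDiag | hash p (α i) (μ i) z.1 = hash p (α i) (μ i) z.2} = 0 := by
      by_contra h0
      have h1 := hαc i
      have h2 : μ i ≤ #{z ∈ (B i).offDiag | hash p (α i) (μ i) z.1 = hash p (α i) (μ i) z.2}
          * μ i := Nat.le_mul_of_pos_left _ (Nat.pos_of_ne_zero h0)
      have h3 : μ i = 2 * #(B i).offDiag + 1 := rfl
      omega
    rw [card_eq_zero, filter_eq_empty_iff] at hc
    refine hc (x := (x, y)) ?_ (by simpa using hxy)
    simp only [mem_offDiag, B, mem_filter]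
    exact ⟨⟨hx, rfl⟩, ⟨hy, by rw [← hj, hij]⟩, hne⟩
  · have := hoff j i hij; omega

end Hashing

/-! ### Ranks: sorted sequences and sampled prefix trees -/

namespace WordRAM

open Finset

/-- The number of elements of `A` below `q`. -/
def rk (A : Finset ℕ) (q : ℕ) : ℕ := #{a ∈ A | a < q}

theorem rk_mono (A : Finset ℕ) : Monotone (rk A) := fun _ _ h =>
  card_le_card fun _ hx => by
    rw [mem_filter] at hx ⊢
    exact ⟨hx.1, hx.2.trans_le h⟩

theorem rk_le (A : Finset ℕ) (q : ℕ) : rk A q ≤ #A := card_filter_le _ _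

theorem rk_add_card (A : Finset ℕ) {q q' : ℕ} (h : q ≤ q') :
    rk A q + #{a ∈ A | q ≤ a ∧ a < q'} = rk A q' := by
  unfold rk
  rw [← card_union_of_disjoint]
  · congr 1
    ext a
    simp only [mem_union, mem_filter]
    constructor
    · rintro (⟨h1, h2⟩ | ⟨h1, h2, h3⟩)
      · exact ⟨h1, h2.trans_le h⟩
      · exact ⟨h1, h3⟩
    · rintro ⟨h1, h2⟩
      by_cases h3 : a < q
      · exact Or.inl ⟨h1, h3⟩
      · exact Or.inr ⟨h1, by omega, h2⟩
  · rw [disjoint_left]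
    intro a h1 h2
    rw [mem_filter] at h1 h2
    omega

/-- The elements of `A` in increasing order, continued by large numbers. -/
theorem exists_sorted (A : Finset ℕ) (L : ℕ) :
    ∃ σ : ℕ → ℕ, (∀ i, σ i < 2 ^ L) ∧ ∀ i, ∀ q < 2 ^ L, σ i < q ↔ i < rk A q := by
  classical
  have h2 : 0 < 2 ^ L := by positivity
  -- The filler `2 ^ L - 1` is an `L`-bit number that is not below any admissible `q`; elements of
  -- `A` beyond `2 ^ L` are cut down to it.
  refine ⟨fun i => if h : ∃ t, i < rk A (t + 1) then min (Nat.find h) (2 ^ L - 1) else 2 ^ L - 1,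
    fun i => ?_, fun i q hq => ?_⟩
  · dsimp only; split <;> omega
  · dsimp only
    split
    · rename_i h
      constructor
      · intro hlt
        have h3 : Nat.find h < q := by omega
        exact (Nat.find_spec h).trans_le (rk_mono A h3)
      · intro hlt
        have hq0 : q ≠ 0 := by
          rintro rfl; simp [rk] at hlt
        have h3 : Nat.find h ≤ q - 1 :=
          Nat.find_min' h (by rwa [Nat.sub_add_cancel (by omega)])
        omega
    · rename_i h
      constructor
      · intro; omega
      · intro hlt
        have hq0 : q ≠ 0 := by
          rintro rfl; simp [rk] at hlt
        exact absurd ⟨q - 1, by rwa [Nat.sub_add_cancel (by omega)]⟩ h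

/-- The leading one makes the height of a node readable from its binary length, so prefixes of
different lengths are different keys. -/
theorem div_two_pow_eq_of_mem_Ico {L a b d e : ℕ} (ha : a < 2 ^ L) (hb : b < 2 ^ L) (hd : d ≤ L)
    (he : e ≤ L) (h : (2 ^ L + a) / 2 ^ d = (2 ^ L + b) / 2 ^ e) : d = e := by
  have key : ∀ {a d : ℕ}, a < 2 ^ L → d ≤ L →
      2 ^ (L - d) ≤ (2 ^ L + a) / 2 ^ d ∧ (2 ^ L + a) / 2 ^ d < 2 ^ (L - d + 1) := by
    intro a d ha hd
    have h1 : 2 ^ (L - d) * 2 ^ d = 2 ^ L := by rw [← pow_add, Nat.sub_add_cancel hd]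
    refine ⟨(Nat.le_div_iff_mul_le (by positivity)).2 (by omega),
      (Nat.div_lt_iff_lt_mul (by positivity)).2 ?_⟩
    rw [pow_succ]
    nlinarith
  obtain ⟨h1, h2⟩ := key ha hd
  obtain ⟨h3, h4⟩ := key hb he
  rw [h] at h1 h2
  have h5 := (Nat.pow_lt_pow_iff_right (by norm_num)).1 (h1.trans_lt h4)
  have h6 := (Nat.pow_lt_pow_iff_right (by norm_num)).1 (h3.trans_lt h2)
  omega

/-- The samples sit at the positions `0, L, 2L, …`. If `n` of these positions are below `R` and `n`
is positive, then `(n - 1) * L < R ≤ n * L`; the truncated subtraction takes care of `n = 0`. -/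
theorem card_filter_mul_lt {J L R : ℕ} (hL : 0 < L) (hR : R ≤ J * L) :
    (#{j ∈ range J | j * L < R} - 1) * L ≤ R ∧
      R ≤ (#{j ∈ range J | j * L < R} - 1) * L + L ∧
      (0 < J → (#{j ∈ range J | j * L < R} - 1) * L + L ≤ J * L) := by
  set n := #{j ∈ range J | j * L < R} with hn
  have hnJ : n ≤ J := (card_filter_le _ _).trans (by simp)
  have hdown : ∀ j, j < n ↔ j < J ∧ j * L < R := by
    have hmem : ({j ∈ range J | j * L < R} : Finset ℕ) = range (min J ((R + L - 1) / L)) := by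
      ext j
      simp only [mem_filter, mem_range, lt_min_iff]
      refine and_congr_right fun _ => ?_
      rw [Nat.lt_div_iff_mul_lt hL]
      constructor <;> intro h <;> omega
    intro j
    rw [hn, hmem, card_range, ← mem_range, ← hmem, mem_filter, mem_range]
  have hn1 := hdown n
  have hn2 : n = 0 ∨ (n - 1) * L < R := by
    rcases Nat.eq_zero_or_pos n with h | h
    · exact Or.inl h
    · exact Or.inr ((hdown (n - 1)).1 (by omega)).2
  have hmul : ∀ k, 0 < k → (k - 1) * L + L = k * L := by
    intro k hk
    obtain ⟨k, rfl⟩ := Nat.exists_eq_succ_of_ne_zero hk.ne'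
    simp [Nat.succ_mul]
  have hle : n * L ≤ J * L := Nat.mul_le_mul_right _ hnJ
  have hRn : R ≤ n * L := by
    rcases hnJ.lt_or_eq with h | h
    · by_contra hc
      exact absurd (hn1.2 ⟨h, by omega⟩) (lt_irrefl _)
    · rw [h]; exact hR
  rcases hn2 with h | h
  · rw [h] at hRn ⊢
    simp only [Nat.zero_mul, Nat.zero_sub] at hRn ⊢
    refine ⟨by omega, by omega, fun hJ => ?_⟩
    have := hmul J hJ
    omega
  · rcases Nat.eq_zero_or_pos n with h0 | h0
    · rw [h0] at hRn ⊢
      simp only [Nat.zero_mul, Nat.zero_sub] at hRn ⊢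
      refine ⟨by omega, by omega, fun hJ => ?_⟩
      have := hmul J hJ
      omega
    · have := hmul n h0
      exact ⟨h.le, by omega, fun _ => by omega⟩

/-- The sorted sequence and the prefix tree of a sample of it, that together yield ranks. -/
structure RankData (A : Finset ℕ) (L : ℕ) where
  /-- the sorted sequence -/
  σ : ℕ → ℕ
  /-- the nodes of the tree -/
  X : Finset ℕ
  /-- the lower bound at a node -/
  val : ℕ → ℕ
  /-- the height of the lowest node above a query -/
  h : ℕ → ℕ
  σ_lt : ∀ i, σ i < 2 ^ L
  σ_lt_iff : ∀ i, ∀ q < 2 ^ L, σ i < q ↔ i < rk A q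
  card_X : #X ≤ (#A / L + 1) * (L + 1)
  X_lt : ∀ x ∈ X, 0 < x ∧ x < 2 ^ (L + 1)
  h_le : ∀ q < 2 ^ L, h q ≤ L
  mem_X_iff : ∀ q < 2 ^ L, ∀ e ≤ L, (2 ^ L + q) / 2 ^ e ∈ X ↔ h q ≤ e
  val_le : ∀ q < 2 ^ L, val ((2 ^ L + q) / 2 ^ h q) ≤ rk A q
  rk_le_val : ∀ q < 2 ^ L, rk A q ≤ val ((2 ^ L + q) / 2 ^ h q) + L
  val_add_le : ∀ q < 2 ^ L, val ((2 ^ L + q) / 2 ^ h q) + L ≤ (#A / L + 1) * L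
  val_le' : ∀ x, val x ≤ #A

/-- Two queries with the same lowest stored ancestor compare alike with every sample, so a lower
bound for the rank, correct up to `L`, can be kept at that node. -/
theorem nonempty_rankData (A : Finset ℕ) {L : ℕ} (hL : 0 < L) : Nonempty (RankData A L) := by
  classical
  obtain ⟨σ, hσ, hσ'⟩ := exists_sorted A L
  set J := #A / L + 1 with hJ
  have hJ0 : 0 < J := Nat.succ_pos _
  have hAJ : #A ≤ J * L := by
    rw [hJ, Nat.add_mul, Nat.one_mul]
    have := Nat.div_add_mod #A L
    have := Nat.mod_lt #A hL
    have h3 : L * (#A / L) = #A / L * L := Nat.mul_comm _ _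
    omega
  let X : Finset ℕ := (range J ×ˢ range (L + 1)).image fun z => (2 ^ L + σ (z.1 * L)) / 2 ^ z.2
  have hX : ∀ q < 2 ^ L, ∀ e ≤ L, (2 ^ L + q) / 2 ^ e ∈ X ↔
      ∃ j < J, (2 ^ L + σ (j * L)) / 2 ^ e = (2 ^ L + q) / 2 ^ e := by
    intro q hq e he
    simp only [X, mem_image, mem_product, mem_range, Prod.exists]
    constructor
    · rintro ⟨j, d, ⟨hj, hd⟩, h⟩
      have := div_two_pow_eq_of_mem_Ico (hσ _) hq (by omega) he h
      subst this
      exact ⟨j, hj, h⟩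
    · rintro ⟨j, hj, h⟩
      exact ⟨j, e, ⟨hj, by omega⟩, h⟩
  have hroot : ∀ a < 2 ^ L, (2 ^ L + a) / 2 ^ L = 1 := by
    intro a ha
    rw [Nat.add_div_left _ (by positivity), Nat.div_eq_of_lt ha]
  have hex : ∀ q < 2 ^ L, ∃ e, e ≤ L ∧ (2 ^ L + q) / 2 ^ e ∈ X := fun q hq =>
    ⟨L, le_rfl, (hX q hq L le_rfl).2 ⟨0, hJ0, by rw [hroot _ (hσ _), hroot _ hq]⟩⟩
  let h : ℕ → ℕ := fun q => if hq : q < 2 ^ L then Nat.find (hex q hq) else 0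
  have hspec : ∀ q < 2 ^ L, h q ≤ L ∧ (2 ^ L + q) / 2 ^ h q ∈ X := by
    intro q hq
    simp only [h, dif_pos hq]
    exact Nat.find_spec (hex q hq)
  have hmin : ∀ q < 2 ^ L, ∀ e < h q, (2 ^ L + q) / 2 ^ e ∉ X := by
    intro q hq e he hmem
    have h1 := (hspec q hq).1
    simp only [h, dif_pos hq] at he h1
    exact Nat.find_min (hex q hq) he ⟨by omega, hmem⟩
  have hiff : ∀ q < 2 ^ L, ∀ e ≤ L, (2 ^ L + q) / 2 ^ e ∈ X ↔ h q ≤ e := by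
    intro q hq e he
    constructor
    · intro hm
      by_contra hc
      exact hmin q hq e (by omega) hm
    · intro hle
      obtain ⟨j, hj, h1⟩ := (hX q hq _ (hspec q hq).1).1 (hspec q hq).2
      refine (hX q hq e he).2 ⟨j, hj, ?_⟩
      obtain ⟨d, rfl⟩ := Nat.exists_eq_add_of_le hle
      rw [pow_add, ← Nat.div_div_eq_div_mul, h1, Nat.div_div_eq_div_mul]
  let lb : ℕ → ℕ := fun q => (#{j ∈ range J | j * L < rk A q} - 1) * L
  have hlb : ∀ q < 2 ^ L, ∀ q' < 2 ^ L, (2 ^ L + q) / 2 ^ h q = (2 ^ L + q') / 2 ^ h q' →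
      lb q = lb q' := by
    intro q hq q' hq' heq
    have hee := div_two_pow_eq_of_mem_Ico hq hq' (hspec q hq).1 (hspec q' hq').1 heq
    suffices hcmp : ∀ j < J, j * L < rk A q ↔ j * L < rk A q' by
      have : ({j ∈ range J | j * L < rk A q} : Finset ℕ) = {j ∈ range J | j * L < rk A q'} :=
        filter_congr fun j hj => hcmp j (mem_range.1 hj)
      simp only [lb, this]
    intro j hj
    rw [← hσ' _ q hq, ← hσ' _ q' hq']
    rcases Nat.eq_zero_or_pos (h q) with h0 | h0
    · rw [← hee, h0] at heq
      simp only [pow_zero, Nat.div_one, Nat.add_left_cancel_iff] at heq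
      rw [heq]
    · obtain ⟨e, he⟩ := Nat.exists_eq_succ_of_ne_zero h0.ne'
      have heL : e ≤ L := by have := (hspec q hq).1; omega
      -- The child below the lowest stored ancestor contains no sample.
      have hno : ∀ x < 2 ^ L, h x = e + 1 → ∀ j < J,
          (2 ^ L + σ (j * L)) / 2 ^ e ≠ (2 ^ L + x) / 2 ^ e := by
        intro x hx hxe j hj heq'
        exact hmin x hx e (by omega) ((hX x hx e heL).2 ⟨j, hj, heq'⟩)
      -- The node itself contains a sample, which must be in one of its two children; hence both
      -- queries are in the other child.
      have hchild : (2 ^ L + q) / 2 ^ e = (2 ^ L + q') / 2 ^ e := by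
        obtain ⟨i, hi, h1⟩ := (hX q hq _ (hspec q hq).1).1 (hspec q hq).2
        have n1 := hno q hq he i hi
        have n2 := hno q' hq' (hee ▸ he) i hi
        rw [← hee] at heq
        rw [he, Nat.succ_eq_add_one] at heq h1
        simp only [pow_succ, ← Nat.div_div_eq_div_mul] at heq h1
        omega
      have hlt : ∀ x < 2 ^ L, h x = e + 1 → (σ (j * L) < x ↔
          (2 ^ L + σ (j * L)) / 2 ^ e < (2 ^ L + x) / 2 ^ e) := by
        intro x hx hxe
        have hne := hno x hx hxe j hj
        constructor
        · intro hlt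
          exact lt_of_le_of_ne (Nat.div_le_div_right (by omega)) hne
        · intro hlt
          by_contra hc
          exact absurd (Nat.div_le_div_right (c := 2 ^ e) (show 2 ^ L + x ≤ 2 ^ L + σ (j * L) by
            omega)) (by omega)
      rw [hlt q hq he, hlt q' hq' (hee ▸ he), hchild]
  have hb : ∀ q, lb q ≤ rk A q ∧ rk A q ≤ lb q + L ∧ lb q + L ≤ J * L := by
    intro q
    obtain ⟨h1, h2, h3⟩ := card_filter_mul_lt (J := J) hL ((rk_le A q).trans hAJ)
    exact ⟨h1, h2, h3 hJ0⟩
  -- Any query with lowest stored ancestor `x` may be chosen, by `hlb`.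
  let val : ℕ → ℕ := fun x =>
    if hx : ∃ q, q < 2 ^ L ∧ (2 ^ L + q) / 2 ^ h q = x then lb hx.choose else 0
  have hval : ∀ q < 2 ^ L, val ((2 ^ L + q) / 2 ^ h q) = lb q := by
    intro q hq
    have hx : ∃ q', q' < 2 ^ L ∧ (2 ^ L + q') / 2 ^ h q' = (2 ^ L + q) / 2 ^ h q := ⟨q, hq, rfl⟩
    simp only [val, dif_pos hx]
    exact hlb _ hx.choose_spec.1 _ hq hx.choose_spec.2
  refine ⟨⟨σ, X, val, h, hσ, hσ', ?_, ?_, fun q hq => (hspec q hq).1, hiff, ?_, ?_, ?_, ?_⟩⟩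
  · exact card_image_le.trans (by simp [hJ])
  · intro x hx
    simp only [X, mem_image, mem_product, mem_range, Prod.exists] at hx
    obtain ⟨j, e, ⟨hj, he⟩, rfl⟩ := hx
    have h1 := hσ (j * L)
    refine ⟨Nat.div_pos ?_ (by positivity), (Nat.div_le_self _ _).trans_lt ?_⟩
    · exact (Nat.pow_le_pow_right (by norm_num) (by omega)).trans (Nat.le_add_right _ _)
    · rw [pow_succ]; omega
  · intro q hq; rw [hval q hq]; exact (hb q).1
  · intro q hq; rw [hval q hq]; exact (hb q).2.1
  · intro q hq; rw [hval q hq]; exact (hb q).2.2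
  · intro x
    simp only [val]
    split
    · exact (hb _).1.trans (rk_le _ _)
    · exact Nat.zero_le _

end WordRAM

/-! ### Programs for hash lookup and binary search -/

namespace WordRAM

open Finset Hashing

namespace Expr

instance : Add Expr := ⟨bin .add⟩
instance : Sub Expr := ⟨bin .sub⟩
instance : Mul Expr := ⟨bin .mul⟩
instance : Div Expr := ⟨bin .div⟩

/-- The expression `a / 2 ^ b`. -/
def shr (a b : Expr) : Expr := bin .shr a b

/-- The expression `a * 2 ^ b`. -/
def shl (a b : Expr) : Expr := bin .shl a b

/-- The expression `a % b`. -/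
def mod (a b : Expr) : Expr := a - a / b * b

variable {w S : ℕ} (D : Fin S → BitVec w) (ρ : ℕ → ℕ) (a b : Expr)

@[simp] theorem eval_add : (a + b).eval D ρ = a.eval D ρ + b.eval D ρ := rfl
@[simp] theorem eval_sub : (a - b).eval D ρ = a.eval D ρ - b.eval D ρ := rfl
@[simp] theorem eval_mul : (a * b).eval D ρ = a.eval D ρ * b.eval D ρ := rfl
@[simp] theorem eval_div : (a / b).eval D ρ = a.eval D ρ / b.eval D ρ := rfl
@[simp] theorem eval_shr : (a.shr b).eval D ρ = a.eval D ρ / 2 ^ b.eval D ρ := rfl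
@[simp] theorem eval_shl : (a.shl b).eval D ρ = a.eval D ρ * 2 ^ b.eval D ρ := rfl
@[simp] theorem eval_mod : (a.mod b).eval D ρ = a.eval D ρ % b.eval D ρ := Nat.mod_eq_sub_div_mul.symm
@[simp] theorem eval_ld : (ld a).eval D ρ = cell D (a.eval D ρ) := rfl
@[simp] theorem eval_var (i : ℕ) : (var i).eval D ρ = ρ i := rfl
@[simp] theorem eval_lit (n : ℕ) : (lit n).eval D ρ = n := rfl

@[simp] theorem ok_add : (a + b).Ok D ρ ↔ a.Ok D ρ ∧ b.Ok D ρ := by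
  change _ ∧ _ ∧ True ↔ _; rw [and_true]
@[simp] theorem ok_sub : (a - b).Ok D ρ ↔ a.Ok D ρ ∧ b.Ok D ρ ∧ b.eval D ρ ≤ a.eval D ρ := Iff.rfl
@[simp] theorem ok_mul : (a * b).Ok D ρ ↔ a.Ok D ρ ∧ b.Ok D ρ := by
  change _ ∧ _ ∧ True ↔ _; rw [and_true]
@[simp] theorem ok_div : (a / b).Ok D ρ ↔
    a.Ok D ρ ∧ b.Ok D ρ ∧ a.eval D ρ < 2 ^ w ∧ b.eval D ρ < 2 ^ w := Iff.rfl
@[simp] theorem ok_shr : (a.shr b).Ok D ρ ↔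
    a.Ok D ρ ∧ b.Ok D ρ ∧ a.eval D ρ < 2 ^ w ∧ b.eval D ρ < 2 ^ w := Iff.rfl
@[simp] theorem ok_shl : (a.shl b).Ok D ρ ↔ a.Ok D ρ ∧ b.Ok D ρ ∧ b.eval D ρ < 2 ^ w := Iff.rfl
@[simp] theorem ok_mod : (a.mod b).Ok D ρ ↔
    a.Ok D ρ ∧ b.Ok D ρ ∧ a.eval D ρ < 2 ^ w ∧ b.eval D ρ < 2 ^ w := by
  simp only [mod, ok_sub, ok_mul, ok_div, eval_mul, eval_div]
  have := Nat.div_mul_le_self (a.eval D ρ) (b.eval D ρ)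
  tauto
@[simp] theorem ok_ld : (ld a).Ok D ρ ↔ a.Ok D ρ ∧ a.eval D ρ < S ∧ S ≤ 2 ^ w := Iff.rfl
@[simp] theorem ok_var (i : ℕ) : (var i).Ok D ρ ↔ i < 1000 := Iff.rfl
@[simp] theorem ok_lit (n : ℕ) : (lit n).Ok D ρ ↔ True := Iff.rfl

@[simp] theorem cost_add : (a + b).cost = a.cost + (b.cost + 1) := rfl
@[simp] theorem cost_sub : (a - b).cost = a.cost + (b.cost + 1) := rfl
@[simp] theorem cost_mul : (a * b).cost = a.cost + (b.cost + 1) := rfl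
@[simp] theorem cost_div : (a / b).cost = a.cost + (b.cost + 1) := rfl
@[simp] theorem cost_shr : (a.shr b).cost = a.cost + (b.cost + 1) := rfl
@[simp] theorem cost_shl : (a.shl b).cost = a.cost + (b.cost + 1) := rfl
@[simp] theorem cost_mod : (a.mod b).cost = a.cost + (a.cost + (b.cost + 1) + (b.cost + 1) + 1) := rfl
@[simp] theorem cost_ld : (ld a).cost = a.cost + 1 := rfl
@[simp] theorem cost_var (i : ℕ) : (var i).cost = 1 := rfl
@[simp] theorem cost_lit (n : ℕ) : (lit n).cost = 1 := rfl

end Expr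

open WordRAM.Expr

/-- The search of the key in register `1` in the hash table at the address in register `0`:
register `2` tells whether it is there, register `3` holds its value. -/
def lookup : Prog :=
  .seq (asgs [
    (4, ld (var 0)),
    (5, mod (ld (var 0 + lit 1) * var 1) (var 4)),
    (5, mod (var 5) (ld (var 0 + lit 2))),
    (6, ld (var 0 + ld (var 0 + lit 4) + var 5)),
    (7, ld (var 0 + ld (var 0 + lit 3) + var 5)),
    (7, mod (var 7 * var 1) (var 4)),
    (7, mod (var 7) (var 6)),
    (7, ld (var 0 + ld (var 0 + lit 5) + var 5) + var 7),
    (8, ld (var 0 + ld (var 0 + lit 6) + var 7)),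
    (3, ld (var 0 + ld (var 0 + lit 7) + var 7))])
  (.branch .eq (.reg 8) (.reg 1) (asg 2 (lit 1)) (asg 2 (lit 0)))

/-- The memory at address `b` holds a hash table with the keys `X` and the values `val`. -/
structure HashAt {w S : ℕ} (D : Fin S → BitVec w) (b V : ℕ) (X : Finset ℕ) (val : ℕ → ℕ) where
  p : ℕ
  φ : Perfect p
  oα : ℕ
  oμ : ℕ
  oo : ℕ
  oKey : ℕ
  oVal : ℕ
  le_pow : S ≤ 2 ^ w
  pos_p : 0 < p
  pos_M : 0 < φ.M
  p_lt : p * V < 2 ^ w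
  a_le : φ.a ≤ p
  M_lt : φ.M < 2 ^ w
  hdr : b + 7 < S
  cell_p : cell D b = p
  cell_a : cell D (b + 1) = φ.a
  cell_M : cell D (b + 2) = φ.M
  cell_oα : cell D (b + 3) = oα
  cell_oμ : cell D (b + 4) = oμ
  cell_oo : cell D (b + 5) = oo
  cell_oKey : cell D (b + 6) = oKey
  cell_oVal : cell D (b + 7) = oVal
  tab_α : ∀ i < φ.M, b + oα + i < S ∧ cell D (b + oα + i) = φ.α i
  tab_μ : ∀ i < φ.M, b + oμ + i < S ∧ cell D (b + oμ + i) = φ.μ i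
  tab_o : ∀ i < φ.M, b + oo + i < S ∧ cell D (b + oo + i) = φ.o i
  α_le : ∀ i < φ.M, φ.α i ≤ p
  μ_lt : ∀ i < φ.M, φ.μ i < 2 ^ w
  bound : ∀ x < V, b + oKey + φ.slot x < S ∧ b + oVal + φ.slot x < S
  found : ∀ x ∈ X, cell D (b + oKey + φ.slot x) = x ∧ cell D (b + oVal + φ.slot x) = val x
  missing : ∀ x < V, 0 < x → x ∉ X → cell D (b + oKey + φ.slot x) ≠ x

theorem wp_lookup {w S : ℕ} {D : Fin S → BitVec w} {b V : ℕ} {X : Finset ℕ} {val : ℕ → ℕ}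
    (H : HashAt D b V X val) {ρ : ℕ → ℕ} {x : ℕ} (hx0 : 0 < x)
    (hx : x < V) (hb : ρ 0 = b) (hρ : ρ 1 = x) :
    WP D lookup ρ fun t ρ' => t ≤ 150 ∧ (ρ' 2 = if x ∈ X then 1 else 0) ∧
      (x ∈ X → ρ' 3 = val x) ∧ ∀ r, 20 ≤ r → ρ' r = ρ r := by
  have h1 := H.hdr
  have h2 := H.le_pow
  have hV : H.p < 2 ^ w := (Nat.le_mul_of_pos_right _ (by omega)).trans_lt H.p_lt
  have hVw : x < 2 ^ w :=
    hx.trans_le ((Nat.le_mul_of_pos_left _ H.pos_p).trans H.p_lt.le)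
  have hpx : ∀ a ≤ H.p, a * x < 2 ^ w := fun a ha =>
    (Nat.mul_le_mul ha hx.le).trans_lt H.p_lt
  have hi : hash H.p H.φ.a H.φ.M x < H.φ.M := Nat.mod_lt _ H.pos_M
  obtain ⟨s1, c1⟩ := H.tab_α _ hi
  obtain ⟨s2, c2⟩ := H.tab_μ _ hi
  obtain ⟨s3, c3⟩ := H.tab_o _ hi
  obtain ⟨s4, s5⟩ := H.bound x hx
  have e1 := hpx _ H.a_le
  have e2 := hpx _ (H.α_le _ hi)
  have e3 := H.μ_lt _ hi
  have e4 := H.M_lt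
  have m1 : ∀ y, y % H.p < 2 ^ w := fun y => (Nat.mod_lt _ H.pos_p).trans hV
  have hslot : H.φ.o (hash H.p H.φ.a H.φ.M x) + H.φ.α (hash H.p H.φ.a H.φ.M x) * x % H.p %
    H.φ.μ (hash H.p H.φ.a H.φ.M x) = H.φ.slot x := rfl
  have hh : H.φ.a * x % H.p % H.φ.M = hash H.p H.φ.a H.φ.M x := rfl
  unfold lookup
  refine WP.seq (WP.asgs_of (fun ρ' => ρ' 8 = cell D (b + H.oKey + H.φ.slot x) ∧
    ρ' 3 = cell D (b + H.oVal + H.φ.slot x) ∧ ρ' 1 = x ∧ ∀ r, 20 ≤ r → ρ' r = ρ r) ?_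
    ⟨?_, ?_, ?_, fun r hr => runAsgs_of_le 20 rfl hr⟩ ?_)
  · simp [hb, hρ, H.cell_p, H.cell_a, H.cell_M, H.cell_oα, H.cell_oμ,
      H.cell_oo, H.cell_oKey, H.cell_oVal, hh, c1, c2, c3, s1, s2, s3, hslot, s4, s5, e1, e2, e3,
      m1, h2, hV, e4]
    omega
  · simp [hb, hρ, H.cell_p, H.cell_a, H.cell_M, H.cell_oα, H.cell_oμ,
      H.cell_oo, H.cell_oKey, H.cell_oVal, hh, c1, c2, c3, hslot]
  · simp [hb, hρ, H.cell_p, H.cell_a, H.cell_M, H.cell_oα, H.cell_oμ,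
      H.cell_oo, H.cell_oKey, H.cell_oVal, hh, c1, c2, c3, hslot]
  · simp [hρ]
  · rintro ρ1 ⟨f8, f3, f1, fr⟩
    have hok : Operand.Ok w ρ1 (.reg 8) ∧ Operand.Ok w ρ1 (.reg 1) :=
      ⟨⟨by norm_num, by simp only [Operand.nat, f8]; exact cell_lt _⟩,
        ⟨by norm_num, by simp only [Operand.nat, f1]; exact hVw⟩⟩
    refine WP.branch hok.1 hok.2 ?_ ?_
    · simp only [Cmp.nat, Operand.nat, f8, f1]
      intro hc
      have hm : x ∈ X := by
        by_contra hm
        exact H.missing x hx hx0 hm hc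
      refine WP.asg (by norm_num) trivial ⟨by simp, by simp [hm], fun _ => ?_, fun r hr => ?_⟩
      · rw [Function.update_of_ne (by norm_num), f3, (H.found x hm).2]
      · rw [Function.update_of_ne (by omega), fr r hr]
    · simp only [Cmp.nat, Operand.nat, f8, f1]
      intro hc
      have hm : x ∉ X := fun hm => hc (H.found x hm).1
      refine WP.asg (by norm_num) trivial ⟨by simp, by simp [hm], fun h => absurd h hm,
        fun r hr => ?_⟩
      rw [Function.update_of_ne (by omega), fr r hr]

/-- The binary search for the end of the initial segment of numbers that pass `test`, between the
numbers in registers `55` and `56`. -/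
def bsearch (test : Prog) : Prog :=
  .loop .lt (.reg 55) (.reg 56) (.seq (asg 57 ((var 55 + var 56) / lit 2)) (.seq test
    (.branch .eq (.reg 58) (.imm 0) (asg 56 (var 57)) (asg 55 (var 57 + lit 1)))))

/-- The interval shrinks to less than half in each round, so `k` rounds suffice. The midpoint is
strictly below the upper end, hence the test need only be correct below `B`; `2 * B < 2 ^ w` keeps
the sum of the two ends from overflowing. -/
theorem wp_bsearch {w S : ℕ} {D : Fin S → BitVec w} {test : Prog} {Env : (ℕ → ℕ) → Prop}
    (hE : ∀ ρ x v, 55 ≤ x → x ≤ 57 → Env ρ → Env (Function.update ρ x v)) {R B T : ℕ}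
    (hB : 2 * B < 2 ^ w) (hB0 : 0 < B)
    (htest : ∀ ρ, Env ρ → ρ 57 < B → WP D test ρ fun t ρ' => t ≤ T ∧ Env ρ' ∧ ρ' 55 = ρ 55 ∧
      ρ' 56 = ρ 56 ∧ ρ' 57 = ρ 57 ∧ ρ' 58 = if ρ 57 < R then 1 else 0)
    {k : ℕ} {ρ : ℕ → ℕ} (hρ : Env ρ) (h1 : ρ 55 ≤ R) (h2 : R ≤ ρ 56) (h3 : ρ 56 ≤ B)
    (h4 : ρ 56 - ρ 55 < 2 ^ k) :
    WP D (bsearch test) ρ fun t ρ' => t ≤ k * (T + 20) + 1 ∧ Env ρ' ∧ ρ' 55 = R := by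
  refine (WP.loop (T + 19) (fun k ρ => Env ρ ∧ ρ 55 ≤ R ∧ R ≤ ρ 56 ∧ ρ 56 ≤ B ∧
    ρ 56 - ρ 55 < 2 ^ k) ?_ ?_ k ρ ⟨hρ, h1, h2, h3, h4⟩).mono ?_
  · rintro k ρ ⟨-, i1, i2, i3, -⟩
    refine ⟨⟨by norm_num, ?_⟩, ⟨by norm_num, ?_⟩⟩ <;> simp only [Operand.nat] <;> omega
  · rintro k ρ ⟨i0, i1, i2, i3, i4⟩ hc
    simp only [Cmp.nat, Operand.nat] at hc
    have hk : k ≠ 0 := by rintro rfl; simp at i4; omega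
    obtain ⟨k, rfl⟩ := Nat.exists_eq_succ_of_ne_zero hk
    rw [pow_succ] at i4
    refine WP.seq (WP.asg (by norm_num) ?_ ?_)
    · simp; omega
    set m := (ρ 55 + ρ 56) / 2 with hm
    have hval : ((var 55 + var 56) / lit 2 : Expr).eval D ρ = m := by simp [hm]
    rw [hval]
    refine WP.seq ((htest _ (hE _ _ _ (by norm_num) (by norm_num) i0) (by simp; omega)).mono ?_)
    rintro t ρ1 ⟨ht, e0, e1, e2, e3, e4⟩
    simp only [Function.update_self, ne_eq, Nat.reduceEqDiff, not_false_eq_true,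
      Function.update_of_ne] at e1 e2 e3 e4
    have hok : Operand.Ok w ρ1 (.reg 58) := by
      refine ⟨by norm_num, ?_⟩
      simp only [Operand.nat, e4]
      split <;> omega
    refine WP.branch hok ⟨trivial, by simp [Operand.nat]⟩ ?_ ?_
    · simp only [Cmp.nat, Operand.nat, e4, ite_eq_right_iff, one_ne_zero, imp_false, not_lt]
      intro hR
      refine WP.asg (by norm_num) (by simp) ⟨?_, k, Nat.lt_succ_self k,
        hE _ _ _ (by norm_num) (by norm_num) e0, ?_⟩
      · simp; omega
      · simp [e1, e3]; omega
    · simp only [Cmp.nat, Operand.nat, e4, ite_eq_right_iff, one_ne_zero, imp_false, not_lt, not_le]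
      intro hR
      refine WP.asg (by norm_num) (by simp) ⟨?_, k, Nat.lt_succ_self k,
        hE _ _ _ (by norm_num) (by norm_num) e0, ?_⟩
      · simp; omega
      · simp [e2, e3]; omega
  · rintro t ρ' ⟨ht, k', ⟨i0, i1, i2, -, -⟩, hc⟩
    simp only [Cmp.nat, Operand.nat] at hc
    exact ⟨ht, i0, by omega⟩

end WordRAM

/-! ### The rank program and its memory block -/

namespace WordRAM

open Finset Hashing WordRAM.Expr

/-- The test whether the node at height `57` above the query is missing. -/
def missingTest : Prog :=
  .seq (asgs [(0, var 50), (1, shr (var 54) (var 57))]) (.seq lookup (asg 58 (lit 1 - var 2)))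

/-- The test whether the entry `57` of the sorted sequence is below the query. -/
def belowTest : Prog :=
  .seq (asg 59 (ld (var 50 + ld (var 50 + lit 9) + var 57)))
    (.branch .lt (.reg 59) (.reg 51) (asg 58 (lit 1)) (asg 58 (lit 0)))

/-- The rank of the number in register `51` in the set that is stored at the address in
register `50`, computed into register `52`. -/
def rank : Prog :=
  .seq (asgs [(53, ld (var 50 + lit 8)), (54, shl (lit 1) (var 53) + var 51), (55, lit 0),
    (56, var 53)]) <|
  .seq (bsearch missingTest) <|
  .seq (asgs [(0, var 50), (1, shr (var 54) (var 55))]) <|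
  .seq lookup <|
  .seq (asgs [(55, var 3), (56, var 3 + var 53)]) <|
  .seq (bsearch belowTest) (asg 52 (var 55))

/-- The memory at address `b` holds a structure for ranks in `A`. -/
structure RankBlock {w S : ℕ} (D : Fin S → BitVec w) (b : ℕ) (A : Finset ℕ) (L : ℕ) where
  data : RankData A L
  table : HashAt D b (2 ^ (L + 1)) data.X data.val
  oσ : ℕ
  hdr : b + 9 < S
  cell_L : cell D (b + 8) = L
  cell_oσ : cell D (b + 9) = oσ
  tab_σ : ∀ i < (#A / L + 1) * L, b + oσ + i < S ∧ cell D (b + oσ + i) = data.σ i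
  pos : 0 < L
  lt_w : L + 1 < w
  N_lt : 2 * ((#A / L + 1) * L) < 2 ^ w

section

variable {w S : ℕ} {D : Fin S → BitVec w} {b : ℕ} {A : Finset ℕ} {L : ℕ}

/-- The registers that are fixed during the computation of a rank. -/
def RankEnv (b q L : ℕ) (ρ₀ ρ : ℕ → ℕ) : Prop :=
  ρ 50 = b ∧ ρ 51 = q ∧ ρ 53 = L ∧ ρ 54 = 2 ^ L + q ∧ ∀ r, 60 ≤ r → ρ r = ρ₀ r

/-- Ancestors of stored nodes are stored, so presence is monotone in the height; this is what
permits a binary search over heights. -/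
theorem wp_lookup_node (H : RankBlock D b A L) {q e : ℕ} (hq : q < 2 ^ L) (he : e ≤ L)
    {ρ : ℕ → ℕ} (h0 : ρ 0 = b) (h1 : ρ 1 = (2 ^ L + q) / 2 ^ e) :
    WP D lookup ρ fun t ρ' => t ≤ 150 ∧ (ρ' 2 = if H.data.h q ≤ e then 1 else 0) ∧
      (H.data.h q ≤ e → ρ' 3 = H.data.val ((2 ^ L + q) / 2 ^ e)) ∧
      ∀ r, 20 ≤ r → ρ' r = ρ r := by
  have hlt : (2 ^ L + q) / 2 ^ e < 2 ^ (L + 1) :=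
    (Nat.div_le_self _ _).trans_lt (by rw [pow_succ]; omega)
  have hpos : 0 < (2 ^ L + q) / 2 ^ e :=
    Nat.div_pos ((Nat.pow_le_pow_right (by norm_num) he).trans (Nat.le_add_right _ _))
      (by positivity)
  have := wp_lookup H.table hpos hlt h0 h1
  simpa only [H.data.mem_X_iff q hq e he] using this

theorem wp_missingTest (H : RankBlock D b A L) {q : ℕ} (hq : q < 2 ^ L) {ρ₀ ρ : ℕ → ℕ}
    (hE : RankEnv b q L ρ₀ ρ) (h57 : ρ 57 < L) :
    WP D missingTest ρ fun t ρ' => t ≤ 200 ∧ RankEnv b q L ρ₀ ρ' ∧ ρ' 55 = ρ 55 ∧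
      ρ' 56 = ρ 56 ∧ ρ' 57 = ρ 57 ∧ ρ' 58 = if ρ 57 < H.data.h q then 1 else 0 := by
  obtain ⟨e0, e1, e3, e4, e5⟩ := hE
  have hw : 2 ^ L + q < 2 ^ w :=
    lt_of_lt_of_le (by rw [pow_succ]; omega) (Nat.pow_le_pow_right (n := 2) (by norm_num) H.lt_w.le)
  have hLw : L < 2 ^ w := by
    have := H.lt_w
    have : w < 2 ^ w := Nat.lt_two_pow_self
    omega
  refine WP.seq (WP.asgs_of (fun ρ' => ρ' 0 = b ∧ ρ' 1 = (2 ^ L + q) / 2 ^ ρ 57 ∧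
    ∀ r, 20 ≤ r → ρ' r = ρ r) ?_ ⟨?_, ?_, fun r hr => runAsgs_of_le 20 rfl hr⟩ ?_)
  · simp [e4]; omega
  · simp [e0]
  · simp [e4]
  rintro ρ1 ⟨f0, f1, fr⟩
  refine WP.seq ((wp_lookup_node H hq h57.le f0 f1).mono ?_)
  rintro t ρ2 ⟨ht, g2, -, gr⟩
  refine WP.asg (by norm_num) ?_ ?_
  · simp [g2]; split <;> simp
  · have fr' : ∀ r, 20 ≤ r → ρ2 r = ρ r := fun r hr => (gr r hr).trans (fr r hr)
    refine ⟨?_, ⟨?_, ?_, ?_, ?_, ?_⟩, ?_, ?_, ?_, ?_⟩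
    · simp; omega
    · simp [fr', e0]
    · simp [fr', e1]
    · simp [fr', e3]
    · simp [fr', e4]
    · intro r hr
      rw [Function.update_of_ne (by omega), fr' r (by omega), e5 r hr]
    · simp [fr']
    · simp [fr']
    · simp [fr']
    · simp [g2]
      by_cases h : H.data.h q ≤ ρ 57
      · simp [h]
      · simp [h, not_le.1 h]

theorem wp_belowTest (H : RankBlock D b A L) {q : ℕ} (hq : q < 2 ^ L) {ρ₀ ρ : ℕ → ℕ}
    (hE : RankEnv b q L ρ₀ ρ) (h57 : ρ 57 < (#A / L + 1) * L) :
    WP D belowTest ρ fun t ρ' => t ≤ 200 ∧ RankEnv b q L ρ₀ ρ' ∧ ρ' 55 = ρ 55 ∧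
      ρ' 56 = ρ 56 ∧ ρ' 57 = ρ 57 ∧ ρ' 58 = if ρ 57 < rk A q then 1 else 0 := by
  obtain ⟨e0, e1, e3, e4, e5⟩ := hE
  obtain ⟨s1, c1⟩ := H.tab_σ _ h57
  have h2 := H.hdr
  have h3 := H.table.le_pow
  have hlt := H.data.σ_lt_iff (ρ 57) q hq
  have hqw : q < 2 ^ w := hq.trans_le (Nat.pow_le_pow_right (by norm_num) (by have := H.lt_w; omega))
  have hval : (ld (var 50 + ld (var 50 + lit 9) + var 57)).eval D ρ = H.data.σ (ρ 57) := by
    simp [e0, H.cell_oσ, c1]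
  refine WP.seq (WP.asg (by norm_num) ?_ ?_)
  · simp [e0, H.cell_oσ]; omega
  rw [hval]
  have hok : Operand.Ok w (Function.update ρ 59 (H.data.σ (ρ 57))) (.reg 59) ∧
      Operand.Ok w (Function.update ρ 59 (H.data.σ (ρ 57))) (.reg 51) := by
    refine ⟨⟨by norm_num, ?_⟩, ⟨by norm_num, ?_⟩⟩
    · simp only [Operand.nat, Function.update_self]
      rw [← c1]; exact cell_lt _
    · simpa [Operand.nat, e1] using hqw
  have hfin : ∀ v c, c ≤ 100 → (v = if ρ 57 < rk A q then 1 else 0) →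
      c ≤ 200 ∧ RankEnv b q L ρ₀ (Function.update (Function.update ρ 59 (H.data.σ (ρ 57))) 58 v) ∧
      Function.update (Function.update ρ 59 (H.data.σ (ρ 57))) 58 v 55 = ρ 55 ∧
      Function.update (Function.update ρ 59 (H.data.σ (ρ 57))) 58 v 56 = ρ 56 ∧
      Function.update (Function.update ρ 59 (H.data.σ (ρ 57))) 58 v 57 = ρ 57 ∧
      Function.update (Function.update ρ 59 (H.data.σ (ρ 57))) 58 v 58 =
        if ρ 57 < rk A q then 1 else 0 := by
    intro v c hc hv
    refine ⟨by omega, ⟨by simp [e0], by simp [e1], by simp [e3], by simp [e4], fun r hr => ?_⟩,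
      by simp, by simp, by simp, by simp [hv]⟩
    rw [Function.update_of_ne (by omega), Function.update_of_ne (by omega), e5 r hr]
  refine WP.branch hok.1 hok.2 ?_ ?_
  · intro hc
    simp [Cmp.nat, Operand.nat, e1] at hc
    refine WP.asg (by norm_num) trivial (hfin _ _ (by simp) ?_)
    rw [if_pos (hlt.1 hc)]; rfl
  · intro hc
    simp only [Cmp.nat, Operand.nat, Function.update_self, ne_eq, Nat.reduceEqDiff,
      not_false_eq_true, Function.update_of_ne, e1] at hc
    refine WP.asg (by norm_num) trivial (hfin _ _ (by simp) ?_)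
    rw [if_neg (fun h => hc (hlt.2 h))]; rfl

theorem wp_rank (H : RankBlock D b A L) {q : ℕ} (hq : q < 2 ^ L) {ρ : ℕ → ℕ} (h50 : ρ 50 = b)
    (h51 : ρ 51 = q) :
    WP D rank ρ fun t ρ' => t ≤ 1000 * (Nat.log 2 L + 1) ∧ ρ' 52 = rk A q ∧
      ∀ r, 60 ≤ r → ρ' r = ρ r := by
  have h2 := H.hdr
  have h3 := H.table.le_pow
  have h4 := H.lt_w
  have h5 := H.pos
  have hLw : L + 1 < 2 ^ w := h4.trans Nat.lt_two_pow_self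
  have h2L : 2 * L < 2 ^ w := by
    have h6 : L < 2 ^ L := Nat.lt_two_pow_self
    have h7 : 2 ^ (L + 1) ≤ 2 ^ w := Nat.pow_le_pow_right (by norm_num) h4.le
    rw [pow_succ] at h7
    omega
  have hw : 2 ^ L + q < 2 ^ w :=
    lt_of_lt_of_le (by rw [pow_succ]; omega) (Nat.pow_le_pow_right (n := 2) (by norm_num) h4.le)
  have hk : L < 2 ^ (Nat.log 2 L + 1) := Nat.lt_pow_succ_log_self (by norm_num) L
  have hstab : ∀ ρ₁ x v, 55 ≤ x → x ≤ 57 → RankEnv b q L ρ ρ₁ →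
      RankEnv b q L ρ (Function.update ρ₁ x v) := by
    rintro ρ₁ x v hx hx' ⟨i1, i2, i3, i4, i5⟩
    refine ⟨?_, ?_, ?_, ?_, fun r hr => ?_⟩ <;> rw [Function.update_of_ne (by omega)]
    exacts [i1, i2, i3, i4, i5 r hr]
  unfold rank
  refine WP.seq (WP.asgs_of (fun ρ' => RankEnv b q L ρ ρ' ∧ ρ' 55 = 0 ∧ ρ' 56 = L) ?_
    ⟨⟨?_, ?_, ?_, ?_, fun r hr => runAsgs_of_le 60 rfl hr⟩, ?_, ?_⟩ ?_)
  · simp [h50, H.cell_L]; omega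
  · simp [h50]
  · simp [h51]
  · simp [h50, H.cell_L]
  · simp [h50, h51, H.cell_L]
  · simp
  · simp [h50, H.cell_L]
  rintro ρ1 ⟨hE1, i1, i2⟩
  -- The missing heights are exactly those below `h q`. The root at height `L` is always stored and
  -- never tested.
  refine WP.seq ((wp_bsearch hstab (R := H.data.h q) (B := L) (T := 200) h2L h5
    (fun ρ' hE' hlt => wp_missingTest H hq hE' hlt) (k := Nat.log 2 L + 1) hE1 (by omega)
    (by rw [i2]; exact H.data.h_le q hq) (by omega) (by omega)).mono ?_)
  rintro t1 ρ2 ⟨ht1, ⟨j0, j1, j3, j4, j5⟩, j6⟩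
  have hh := H.data.h_le q hq
  refine WP.seq (WP.asgs_of (fun ρ' => ρ' 0 = b ∧ ρ' 1 = (2 ^ L + q) / 2 ^ H.data.h q ∧
    ∀ r, 20 ≤ r → ρ' r = ρ2 r) ?_ ⟨?_, ?_, fun r hr => runAsgs_of_le 20 rfl hr⟩ ?_)
  · simp [j4, j6]; omega
  · simp [j0]
  · simp [j4, j6]
  rintro ρ3 ⟨f0, f1, fr⟩
  refine WP.seq ((wp_lookup_node H hq hh f0 f1).mono ?_)
  rintro t2 ρ4 ⟨ht2, -, g3, gr⟩
  have g3 := g3 le_rfl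
  have fr' : ∀ r, 20 ≤ r → ρ4 r = ρ2 r := fun r hr => (gr r hr).trans (fr r hr)
  refine WP.seq (WP.asgs_of (fun ρ' => RankEnv b q L ρ ρ' ∧
    ρ' 55 = H.data.val ((2 ^ L + q) / 2 ^ H.data.h q) ∧
    ρ' 56 = H.data.val ((2 ^ L + q) / 2 ^ H.data.h q) + L) ?_
    ⟨⟨?_, ?_, ?_, ?_, fun r hr => ?_⟩, ?_, ?_⟩ ?_)
  · simp
  · simp [fr', j0]
  · simp [fr', j1]
  · simp [fr', j3]
  · simp [fr', j4]
  · rw [runAsgs_of_le 60 rfl hr, fr' r (by omega), j5 r hr]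
  · simp [g3]
  · simp [g3, fr', j3]
  rintro ρ5 ⟨hE5, k1, k2⟩
  have v1 := H.data.val_le q hq
  have v2 := H.data.rk_le_val q hq
  have v3 := H.data.val_add_le q hq
  -- The window of length `L` ends within the stored part of the sorted sequence; its entries below
  -- `q` are those with index less than the rank.
  refine WP.seq ((wp_bsearch hstab (R := rk A q) (B := (#A / L + 1) * L) (T := 200) H.N_lt (by omega)
    (fun ρ' hE' hlt => wp_belowTest H hq hE' hlt) (k := Nat.log 2 L + 1) hE5 (by omega)
    (by omega) (by omega) (by omega)).mono ?_)
  rintro t3 ρ6 ⟨ht3, ⟨-, -, -, -, l5⟩, l6⟩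
  refine WP.asg (by norm_num) (by simp) ⟨?_, by simp [l6], fun r hr => ?_⟩
  · simp; omega
  · rw [Function.update_of_ne (by omega), l5 r hr]

end

/-- There are about `#A / L` samples with `L + 1` prefixes each, so the tree, and with it the hash
table, is linear in `#A + L`. -/
theorem exists_rankBlock (A : Finset ℕ) {L : ℕ} (hL : 0 < L) (hA : #A ≤ 2 ^ L) :
    ∃ l : List ℕ, l.length ≤ 60 * (#A + L) ∧ (∀ x ∈ l, x < 2 ^ (2 * L + 10)) ∧
      ∀ (w S : ℕ) (D : Fin S → BitVec w) (b : ℕ), S ≤ 2 ^ w → 2 * L + 10 ≤ w → Stored D b l →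
        Nonempty (RankBlock D b A L) := by
  classical
  obtain ⟨rd⟩ := nonempty_rankData A hL
  -- The prime exceeds all nodes, and the product of a residue and a node still has fewer than `2 *
  -- L + 10` bits.
  obtain ⟨p, hp, hp1, hp2⟩ := Nat.exists_prime_lt_and_le_two_mul (2 ^ (L + 1)) (by positivity)
  obtain ⟨φ, ha, hM, hR, htab, hinj⟩ := exists_perfect hp rd.X
    fun x hx => (rd.X_lt x hx).2.trans hp1
  set N := (#A / L + 1) * L with hN
  have hNle : N ≤ #A + L := by
    rw [hN, Nat.add_mul, Nat.one_mul]
    have := Nat.div_mul_le_self #A L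
    omega
  have hX : #rd.X ≤ 2 * #A + L + 1 := by
    have h1 := rd.card_X
    have h2 : #A / L ≤ #A := Nat.div_le_self _ _
    have h3 : (#A / L + 1) * (L + 1) = N + #A / L + 1 := by rw [hN]; ring
    omega
  -- Nodes are positive, so `0` can mark an empty slot.
  let key : ℕ → ℕ := fun s => if h : ∃ x ∈ rd.X, φ.slot x = s then h.choose else 0
  let val : ℕ → ℕ := fun s => if h : ∃ x ∈ rd.X, φ.slot x = s then rd.val h.choose else 0
  have hkv : ∀ x ∈ rd.X, key (φ.slot x) = x ∧ val (φ.slot x) = rd.val x := by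
    intro x hx
    have h : ∃ y ∈ rd.X, φ.slot y = φ.slot x := ⟨x, hx, rfl⟩
    have h1 : h.choose = x := hinj h.choose_spec.1 hx h.choose_spec.2
    simp only [key, val, dif_pos h, h1, and_self]
  have hkey : ∀ s, key s = 0 ∨ key s ∈ rd.X := by
    intro s
    simp only [key]
    split
    · rename_i h; exact Or.inr h.choose_spec.1
    · exact Or.inl rfl
  have hval : ∀ s, val s ≤ #A := by
    intro s
    simp only [val]
    split
    · exact rd.val_le' _
    · exact Nat.zero_le _
  have hslot : ∀ x, φ.slot x < φ.R := by
    intro x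
    have h1 : hash p φ.a φ.M x < φ.M := Nat.mod_lt _ (by omega)
    obtain ⟨-, h2, h3⟩ := htab _ h1
    have h4 : hash p (φ.α (hash p φ.a φ.M x)) (φ.μ (hash p φ.a φ.M x)) x <
      φ.μ (hash p φ.a φ.M x) := Nat.mod_lt _ h2
    unfold Perfect.slot
    omega
  set oα := 10 with hoα
  set oμ := oα + φ.M with hoμ
  set oo := oμ + φ.M with hoo
  set oK := oo + φ.M with hoK
  set oV := oK + φ.R with hoV
  set oσ := oV + φ.R with hoσ
  have hL2 : L < 2 ^ L := Nat.lt_two_pow_self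
  have hpow : 2 ^ (2 * L + 10) = 2 ^ L * (2 ^ L * 1024) := by ring
  have hbig : 128 * 2 ^ L ≤ 2 ^ (2 * L + 10) := by
    rw [hpow]; nlinarith [Nat.one_le_two_pow (n := L)]
  have hpL : p ≤ 4 * 2 ^ L := by rw [pow_succ] at hp2; omega
  refine ⟨[p, φ.a, φ.M, oα, oμ, oo, oK, oV, L, oσ] ++ (tab φ.M φ.α ++ (tab φ.M φ.μ ++
    (tab φ.M φ.o ++ (tab φ.R key ++ (tab φ.R val ++ tab N rd.σ))))), ?_, ?_, ?_⟩
  · simp only [List.length_append, List.length_cons, List.length_nil, length_tab]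
    omega
  · have hall : ∀ x < 128 * 2 ^ L, x < 2 ^ (2 * L + 10) := fun x hx => hx.trans_le hbig
    intro x hx
    apply hall
    simp only [List.mem_append, List.mem_cons, List.not_mem_nil, or_false, mem_tab] at hx
    rcases hx with h | ⟨i, hi, rfl⟩ | ⟨i, hi, rfl⟩ | ⟨i, hi, rfl⟩ | ⟨i, hi, rfl⟩ | ⟨i, hi, rfl⟩ |
      ⟨i, hi, rfl⟩
    · omega
    · have := (htab i hi).1; omega
    · have := (htab i hi).2; omega
    · have := (htab i hi).2; omega
    · rcases hkey i with h | h
      · omega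
      · have := (rd.X_lt _ h).2; rw [pow_succ] at this; omega
    · have := hval i; omega
    · have := rd.σ_lt i; omega
  · intro w S D b hS hw hst
    have hbw : 2 ^ (2 * L + 10) ≤ 2 ^ w := Nat.pow_le_pow_right (by norm_num) hw
    simp only [stored_append, List.length_cons, List.length_nil, length_tab, Nat.zero_add,
      Nat.reduceAdd] at hst
    obtain ⟨s0, s1, s2, s3, s4, s5, s6⟩ := hst
    have t1 := fun i (hi : i < φ.M) => s1.tab hi
    have t2 := fun i (hi : i < φ.M) => s2.tab hi
    have t3 := fun i (hi : i < φ.M) => s3.tab hi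
    have t4 := fun i (hi : i < φ.R) => s4.tab hi
    have t5 := fun i (hi : i < φ.R) => s5.tab hi
    have t6 := fun i (hi : i < N) => s6.tab hi
    have hlen := s0.1
    have hc := s0.2
    simp only [List.length_cons, List.length_nil, Nat.zero_add, Nat.reduceAdd] at hlen hc
    have e1 : b + oμ = b + 10 + φ.M := by omega
    have e2 : b + oo = b + 10 + φ.M + φ.M := by omega
    have e3 : b + oK = b + 10 + φ.M + φ.M + φ.M := by omega
    have e4 : b + oV = b + 10 + φ.M + φ.M + φ.M + φ.R := by omega
    have e5 : b + oσ = b + 10 + φ.M + φ.M + φ.M + φ.R + φ.R := by omega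
    have hlast := s6.1
    rw [length_tab] at hlast
    have hNpos : 0 < N := by rw [hN]; positivity
    refine ⟨⟨rd, ⟨p, φ, oα, oμ, oo, oK, oV, hS, hp.pos, by omega, ?_, ha.le, by omega, by omega,
      hc 0 (by norm_num), hc 1 (by norm_num), hc 2 (by norm_num), hc 3 (by norm_num),
      hc 4 (by norm_num), hc 5 (by norm_num), hc 6 (by norm_num), hc 7 (by norm_num), t1,
      by rwa [e1], by rwa [e2], fun i hi => (htab i hi).1.le, fun i hi => ?_, fun x hx => ?_,
      fun x hx => ?_, fun x hx hx0 hxX => ?_⟩, oσ, ?_, hc 8 (by norm_num), hc 9 (by norm_num),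
      by rwa [e5], hL, by omega, by omega⟩⟩
    · refine lt_of_lt_of_le ?_ hbw
      rw [hpow, pow_succ]
      have h1 : 0 < 2 ^ L * 2 ^ L := by positivity
      calc p * (2 ^ L * 2) ≤ 4 * 2 ^ L * (2 ^ L * 2) := Nat.mul_le_mul_right _ hpL
        _ = 8 * (2 ^ L * 2 ^ L) := by ring
        _ < 1024 * (2 ^ L * 2 ^ L) := by omega
        _ = _ := by ring
    · have := (htab i hi).2; omega
    · rw [e3, e4]
      exact ⟨(t4 _ (hslot x)).1, (t5 _ (hslot x)).1⟩
    · rw [e3, e4, (t4 _ (hslot x)).2, (t5 _ (hslot x)).2]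
      exact hkv x hx
    · rw [e3, (t4 _ (hslot x)).2]
      intro h
      rcases hkey (φ.slot x) with h1 | h1
      · omega
      · rw [h] at h1; exact hxX h1
    · omega

end WordRAM

/-! ### Sampling by rank from above, and tagged unions of groups -/

namespace WordRAM

open Finset

/-- The ranks from above of the elements that are at least `s` are exactly `1, 2, …` up to their
number. A selection by this rank can therefore be counted above every threshold: `sample` gives an
exact floor, `largest` an exact minimum. -/
theorem card_filter_topRank (Y : Finset ℕ) (s : ℕ) (p : ℕ → Prop) [DecidablePred p] :
    #{y ∈ Y | p #{z ∈ Y | y ≤ z} ∧ s ≤ y} = #{i ∈ Ioc 0 #{y ∈ Y | s ≤ y} | p i} := by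
  set T : Finset ℕ := {y ∈ Y | s ≤ y} with hT
  let f : ℕ → ℕ := fun y => #{z ∈ Y | y ≤ z}
  have hanti : ∀ y ∈ Y, ∀ y', y < y' → f y' < f y := by
    intro y hy y' hlt
    refine card_lt_card ⟨fun z hz => ?_, fun h => ?_⟩
    · rw [mem_filter] at hz ⊢; exact ⟨hz.1, by omega⟩
    · have := h (mem_filter.2 ⟨hy, le_rfl⟩)
      rw [mem_filter] at this; omega
  have hinj : Set.InjOn f T := by
    intro y hy y' hy' heq
    have h1 := (mem_filter.1 hy).1
    have h2 := (mem_filter.1 hy').1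
    rcases lt_trichotomy y y' with h | h | h
    · have := hanti y h1 y' h; omega
    · exact h
    · have := hanti y' h2 y h; omega
  have himg : T.image f = Ioc 0 #T := by
    apply eq_of_subset_of_card_le
    · intro i hi
      rw [mem_image] at hi
      obtain ⟨y, hy, rfl⟩ := hi
      rw [hT, mem_filter] at hy
      rw [mem_Ioc]
      refine ⟨card_pos.2 ⟨y, mem_filter.2 ⟨hy.1, le_rfl⟩⟩, card_le_card fun z hz => ?_⟩
      rw [mem_filter] at hz ⊢
      exact ⟨hz.1, hy.2.trans hz.2⟩
    · rw [card_image_of_injOn hinj]; simp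
  have h1 : ({y ∈ Y | p #{z ∈ Y | y ≤ z} ∧ s ≤ y} : Finset ℕ) = {y ∈ T | p (f y)} := by
    ext y; simp only [hT, mem_filter, f]; tauto
  rw [h1, ← himg, filter_image, card_image_of_injOn]
  exact hinj.mono (by intro y hy; exact (mem_filter.1 hy).1)

/-- Every `Δ`-th element of `Y`, from above. -/
def sample (Δ : ℕ) (Y : Finset ℕ) : Finset ℕ := {y ∈ Y | Δ ∣ #{z ∈ Y | y ≤ z}}

/-- The `K` largest elements of `Y`. -/
def largest (K : ℕ) (Y : Finset ℕ) : Finset ℕ := {y ∈ Y | #{z ∈ Y | y ≤ z} ≤ K}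

theorem card_sample (Δ : ℕ) (Y : Finset ℕ) (s : ℕ) :
    #{y ∈ sample Δ Y | s ≤ y} = #{y ∈ Y | s ≤ y} / Δ := by
  rw [sample, filter_filter, card_filter_topRank Y s (Δ ∣ ·), Nat.Ioc_filter_dvd_card_eq_div]

theorem card_largest (K : ℕ) (Y : Finset ℕ) (s : ℕ) :
    #{y ∈ largest K Y | s ≤ y} = min #{y ∈ Y | s ≤ y} K := by
  rw [largest, filter_filter, card_filter_topRank Y s (· ≤ K)]
  have : ({i ∈ Ioc 0 #{y ∈ Y | s ≤ y} | i ≤ K} : Finset ℕ) = Ioc 0 (min #{y ∈ Y | s ≤ y} K) := by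
    ext i; simp only [mem_filter, mem_Ioc]; omega
  rw [this, Nat.card_Ioc, Nat.sub_zero]

theorem card_sample' (Δ : ℕ) (Y : Finset ℕ) : #(sample Δ Y) = #Y / Δ := by
  simpa using card_sample Δ Y 0

theorem card_largest_le (K : ℕ) (Y : Finset ℕ) : #(largest K Y) ≤ K := by
  have h := card_largest K Y 0
  simp only [Nat.zero_le, filter_true] at h
  omega

/-- The numbers `τ t * W + y` for `y` in the group `G t`. -/
def grouped {ι : Type*} (W : ℕ) (τ : ι → ℕ) (U : Finset ι) (G : ι → Finset ℕ) : Finset ℕ :=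
  U.biUnion fun t => (G t).image (τ t * W + ·)

theorem card_grouped_le {ι : Type*} (W : ℕ) (τ : ι → ℕ) (U : Finset ι) (G : ι → Finset ℕ) :
    #(grouped W τ U G) ≤ ∑ t ∈ U, #(G t) :=
  card_biUnion_le.trans (sum_le_sum fun _ _ => card_image_le)

/-- The group of `t` occupies the interval of length `W` that starts at `τ t * W`, and distinct tags
give disjoint intervals. Indices outside `U` are admitted if their group is empty. -/
theorem rk_grouped {ι : Type*} {W : ℕ} {τ : ι → ℕ} {U : Finset ι} {G : ι → Finset ℕ}
    (hG : ∀ t ∈ U, ∀ y ∈ G t, y < W) {t : ι} (ht : ∀ t' ∈ U, τ t' = τ t → t' = t)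
    (hU : t ∉ U → G t = ∅) {s : ℕ} (hs : s ≤ W) :
    rk (grouped W τ U G) (τ t * W + s) + #{y ∈ G t | s ≤ y} =
      rk (grouped W τ U G) (τ t * W + W) := by
  rw [← rk_add_card _ (show τ t * W + s ≤ τ t * W + W by omega)]
  congr 1
  have himg : ({a ∈ grouped W τ U G | τ t * W + s ≤ a ∧ a < τ t * W + W} : Finset ℕ) =
      ({y ∈ G t | s ≤ y} : Finset ℕ).image (τ t * W + ·) := by
    ext a
    simp only [grouped, mem_filter, mem_biUnion, mem_image]
    constructor
    · rintro ⟨⟨t', ht', y, hy, rfl⟩, h1, h2⟩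
      have hyW := hG t' ht' y hy
      have : τ t' = τ t := by
        rcases lt_trichotomy (τ t') (τ t) with h | h | h
        · have : (τ t' + 1) * W ≤ τ t * W := Nat.mul_le_mul_right _ h
          rw [Nat.add_mul] at this; omega
        · exact h
        · have : (τ t + 1) * W ≤ τ t' * W := Nat.mul_le_mul_right _ h
          rw [Nat.add_mul] at this; omega
      obtain rfl := ht t' ht' this
      exact ⟨y, ⟨hy, by omega⟩, rfl⟩
    · rintro ⟨y, ⟨hy, hsy⟩, rfl⟩
      have hm : t ∈ U := by
        by_contra hm
        rw [hU hm] at hy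
        simp at hy
      have := hG t hm y hy
      exact ⟨⟨t, hm, y, hy, rfl⟩, by omega, by omega⟩
  rw [himg, card_image_of_injective _ (add_right_injective _)]

/-! ### Slabs, stairs and the approximate dominance count -/

section Dominance

/-- The number of points of the graph of `π` in `[a, b) × [s, ∞)`. -/
def strip (π : ℕ → ℕ) (a b s : ℕ) : ℕ := #{x ∈ Ico a b | s ≤ π x}

/-- The minimum is there because the end `b` of a slab may lie beyond `m`. -/
theorem strip_add (π : ℕ → ℕ) {a b m : ℕ} (hab : a ≤ b) (s : ℕ) :
    strip π a (min m b) s + strip π b m s = strip π a m s := by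
  unfold strip
  rw [← card_union_of_disjoint]
  · congr 1
    ext x
    simp only [mem_union, mem_filter, mem_Ico, lt_min_iff]
    constructor
    · rintro (⟨⟨h1, h2⟩, h3⟩ | ⟨⟨h1, h2⟩, h3⟩)
      · exact ⟨⟨h1, h2.1⟩, h3⟩
      · exact ⟨⟨by omega, h2⟩, h3⟩
    · rintro ⟨⟨h1, h2⟩, h3⟩
      by_cases hx : x < b
      · exact Or.inl ⟨⟨h1, h2, hx⟩, h3⟩
      · exact Or.inr ⟨⟨by omega, h2⟩, h3⟩
  · rw [disjoint_left]
    intro x h1 h2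
    simp only [mem_filter, mem_Ico, lt_min_iff] at h1 h2
    omega

theorem strip_le (π : ℕ → ℕ) (a b s : ℕ) : strip π a b s ≤ b - a :=
  (card_filter_le _ _).trans (by simp)

theorem strip_eq_zero {π : ℕ → ℕ} {a m s : ℕ} (hπ : ∀ x < m, π x < s) : strip π a m s = 0 := by
  unfold strip
  rw [card_eq_zero, filter_eq_empty_iff]
  intro x hx
  have := hπ x (mem_Ico.1 hx).2
  omega

theorem exists_strip_le {π : ℕ → ℕ} {m : ℕ} (hπ : ∀ x < m, π x < m) (e J : ℕ) :
    ∃ s, strip π ((J + 1) * 2 ^ e) m s ≤ 2 ^ e :=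
  ⟨m, by rw [strip_eq_zero hπ]; exact Nat.zero_le _⟩

open Classical in
/-- The least height at which at most `2 ^ e` points lie to the right of slab `J`. -/
noncomputable def stair (π : ℕ → ℕ) (m e J : ℕ) : ℕ :=
  if h : ∃ s, strip π ((J + 1) * 2 ^ e) m s ≤ 2 ^ e then Nat.find h else 0

variable {π : ℕ → ℕ} {m : ℕ}

theorem strip_stair_le (hπ : ∀ x < m, π x < m) (e J : ℕ) :
    strip π ((J + 1) * 2 ^ e) m (stair π m e J) ≤ 2 ^ e := by
  classical
  have h := exists_strip_le hπ e J
  rw [stair, dif_pos h]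
  exact Nat.find_spec h

/-- By minimality of the stair, a query that is rejected at this width is certified to have many
points. -/
theorem stair_le_iff (hπ : ∀ x < m, π x < m) {e J s : ℕ} (hs : s < stair π m e J) :
    2 ^ e < strip π ((J + 1) * 2 ^ e) m s := by
  classical
  have h := exists_strip_le hπ e J
  rw [stair, dif_pos h] at hs
  have := Nat.find_min h hs
  omega

theorem stair_le (hπ : ∀ x < m, π x < m) (e J : ℕ) : stair π m e J ≤ m := by
  classical
  have h := exists_strip_le hπ e J
  rw [stair, dif_pos h]
  exact Nat.find_min' h (by rw [strip_eq_zero hπ]; exact Nat.zero_le _)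

/-- Widths of at least `m` reject no query, which is why the scan over scales ends. -/
theorem stair_eq_zero {e J : ℕ} (he : m ≤ 2 ^ e) : stair π m e J = 0 := by
  classical
  have h0 : strip π ((J + 1) * 2 ^ e) m 0 ≤ 2 ^ e :=
    (strip_le _ _ _ _).trans ((Nat.sub_le _ _).trans he)
  have h : ∃ s, strip π ((J + 1) * 2 ^ e) m s ≤ 2 ^ e := ⟨0, h0⟩
  rw [stair, dif_pos h]
  have := Nat.find_min' h h0
  omega

variable (π m) (g : ℕ)

/-- The heights of the points to the right of slab `J` of width `2 ^ (f * d)`, up to the end of the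
slab of width `2 ^ (f * d + f)` around it; for `d = g` up to the end, but above the stair. -/
noncomputable def slabGroup (f d J : ℕ) : Finset ℕ :=
  if d < g then (Ico ((J + 1) * 2 ^ (f * d)) (min m ((J / 2 ^ f + 1) * 2 ^ (f * d + f)))).image π
  else ({x ∈ Ico ((J + 1) * 2 ^ (f * d)) m | stair π m (f * d) J ≤ π x}).image π

variable {π m g}

theorem card_filter_image_Ico (hinj : Set.InjOn π (Set.Iio m)) {a b : ℕ} (hb : b ≤ m) (s : ℕ) :
    #{y ∈ (Ico a b).image π | s ≤ y} = strip π a b s := by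
  rw [filter_image, card_image_of_injOn, strip]
  refine hinj.mono ?_
  intro x hx
  simp only [coe_filter, mem_Ico, Set.mem_ofPred_eq] at hx
  exact lt_of_lt_of_le hx.1.2 hb

/-- The slab of the next width around `r` ends at or after the current one, so the group is what
lies between the two ends. -/
theorem card_slabGroup_ge_of_lt (hinj : Set.InjOn π (Set.Iio m)) {f d : ℕ} (hd : d < g) (r s : ℕ) :
    #{y ∈ slabGroup π m g f d (r / 2 ^ (f * d)) | s ≤ y} +
        strip π ((r / 2 ^ (f * (d + 1)) + 1) * 2 ^ (f * (d + 1))) m s =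
      strip π ((r / 2 ^ (f * d) + 1) * 2 ^ (f * d)) m s := by
  rw [slabGroup, if_pos hd, card_filter_image_Ico hinj (min_le_left _ _)]
  have h1 : r / 2 ^ (f * d) / 2 ^ f = r / 2 ^ (f * (d + 1)) := by
    rw [Nat.div_div_eq_div_mul, ← pow_add, Nat.mul_succ]
  have h2 : f * d + f = f * (d + 1) := (Nat.mul_succ f d).symm
  rw [h1, h2]
  refine strip_add π ?_ s
  rw [← h1, ← h2, pow_add, ← Nat.mul_assoc, Nat.mul_right_comm]
  refine Nat.mul_le_mul_right _ ?_
  have := Nat.div_add_mod' (r / 2 ^ (f * d)) (2 ^ f)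
  have h3 := Nat.mod_lt (r / 2 ^ (f * d)) (show 0 < 2 ^ f by positivity)
  rw [Nat.add_mul, Nat.one_mul]
  omega

/-- The last group has lost only points below the stair, which do not count when `s` is not below
it. -/
theorem card_slabGroup_ge_top (hinj : Set.InjOn π (Set.Iio m)) {f J s : ℕ}
    (hs : stair π m (f * g) J ≤ s) :
    #{y ∈ slabGroup π m g f g J | s ≤ y} = strip π ((J + 1) * 2 ^ (f * g)) m s := by
  rw [slabGroup, if_neg (lt_irrefl _), filter_image, card_image_of_injOn, filter_filter, strip]
  · congr 1
    ext x
    simp only [mem_filter]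
    constructor
    · rintro ⟨h1, -, h2⟩; exact ⟨h1, h2⟩
    · rintro ⟨h1, h2⟩; exact ⟨h1, hs.trans h2, h2⟩
  · refine hinj.mono ?_
    intro x hx
    simp only [coe_filter, mem_filter, mem_Ico, Set.mem_ofPred_eq] at hx
    exact hx.1.1.2

/-- An inner group lies within one slab of the next width; the last one is bounded by the defining
property of the stair. -/
theorem card_slabGroup_le (hπ : ∀ x < m, π x < m) (f d J : ℕ) :
    #(slabGroup π m g f d J) ≤ 2 ^ (f * d + f) := by
  unfold slabGroup
  split
  · refine card_image_le.trans ?_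
    rw [Nat.card_Ico]
    have h1 : J / 2 ^ f * 2 ^ (f * d + f) ≤ J * 2 ^ (f * d) := by
      rw [pow_add, Nat.mul_comm (2 ^ (f * d)), ← Nat.mul_assoc]
      exact Nat.mul_le_mul_right _ (Nat.div_mul_le_self _ _)
    rw [Nat.add_mul, Nat.add_mul]
    generalize J / 2 ^ f * 2 ^ (f * d + f) = u at h1 ⊢
    omega
  · refine card_image_le.trans ((strip_stair_le hπ (f * d) J).trans ?_)
    exact Nat.pow_le_pow_right (by norm_num) (by omega)

theorem slabGroup_eq_empty {f d J : ℕ} (h : m ≤ (J + 1) * 2 ^ (f * d)) :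
    slabGroup π m g f d J = ∅ := by
  unfold slabGroup
  split
  · rw [Ico_eq_empty (by omega), image_empty]
  · rw [Ico_eq_empty (by omega), filter_empty, image_empty]

theorem slabGroup_lt (hπ : ∀ x < m, π x < m) {f d J y : ℕ} (hy : y ∈ slabGroup π m g f d J) :
    y < m := by
  unfold slabGroup at hy
  split at hy
  · simp only [mem_image, mem_Ico] at hy
    obtain ⟨x, hx, rfl⟩ := hy
    exact hπ x (by omega)
  · simp only [mem_image, mem_filter, mem_Ico] at hy
    obtain ⟨x, hx, rfl⟩ := hy
    exact hπ x (by omega)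

/-- The number of points of the groups of a query from the slabs of width at least `2 ^ (f * d)`. -/
theorem sum_card_slabGroup (hinj : Set.InjOn π (Set.Iio m)) {f r s : ℕ}
    (hs : stair π m (f * g) (r / 2 ^ (f * g)) ≤ s) {d : ℕ} (hd : d ≤ g) :
    ∑ i ∈ Icc d g, #{y ∈ slabGroup π m g f i (r / 2 ^ (f * i)) | s ≤ y} =
      strip π ((r / 2 ^ (f * d) + 1) * 2 ^ (f * d)) m s := by
  -- The groups telescope, starting from the widest slab.
  induction hd using Nat.decreasingInduction with
  | self => rw [Icc_self, sum_singleton, card_slabGroup_ge_top hinj hs]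
  | of_succ d hd ih =>
    rw [← card_slabGroup_ge_of_lt hinj hd r s, ← ih, ← Finset.add_sum_Ioc_eq_sum_Icc (by omega)]
    congr 1
    exact sum_congr (by ext; simp only [mem_Ioc, mem_Icc]; omega) fun _ _ => rfl

/-- The value that is computed from the sampled groups. -/
noncomputable def approx (π : ℕ → ℕ) (m g f r s : ℕ) : ℕ :=
  (∑ d ∈ Icc 2 g, #{y ∈ slabGroup π m g f d (r / 2 ^ (f * d)) | s ≤ y} / 2 ^ (2 * f)) * 2 ^ (2 * f)

/-- Sampling loses less than `2 ^ (2 * f)` in each of the `g - 1` groups, and the skipped points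
between `r` and the end `E` of the slab of width `2 ^ (2 * f)` account for one more such term.
Nothing is counted twice, so the value never exceeds the count. -/
theorem approx_le (hinj : Set.InjOn π (Set.Iio m)) (hg : 2 ≤ g) {f r s : ℕ}
    (hs : stair π m (f * g) (r / 2 ^ (f * g)) ≤ s) :
    approx π m g f r s ≤ strip π r m s ∧
      strip π r m s ≤ approx π m g f r s + g * 2 ^ (2 * f) := by
  set Δ := 2 ^ (2 * f) with hΔ
  have hΔ0 : 0 < Δ := by positivity
  have h1 := sum_card_slabGroup hinj hs hg
  set c : ℕ → ℕ := fun d => #{y ∈ slabGroup π m g f d (r / 2 ^ (f * d)) | s ≤ y} with hc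
  set E := (r / 2 ^ (f * 2) + 1) * 2 ^ (f * 2) with hE
  have hrE : r < E := Nat.lt_mul_of_div_lt (Nat.lt_succ_self _) (by positivity)
  have hEr : E ≤ r + Δ := by
    have := Nat.div_mul_le_self r (2 ^ (f * 2))
    rw [hE, hΔ, Nat.add_mul, Nat.one_mul, Nat.mul_comm 2 f]
    omega
  have h2 := strip_add π (m := m) hrE.le s
  have h3 := strip_le π r (min m E) s
  have h4 : approx π m g f r s = ∑ d ∈ Icc 2 g, c d / Δ * Δ := by rw [approx, sum_mul]
  have h5 : ∑ d ∈ Icc 2 g, c d / Δ * Δ ≤ ∑ d ∈ Icc 2 g, c d :=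
    sum_le_sum fun d _ => Nat.div_mul_le_self _ _
  have h6 : ∑ d ∈ Icc 2 g, c d ≤ ∑ d ∈ Icc 2 g, (c d / Δ * Δ + Δ) := by
    refine sum_le_sum fun d _ => ?_
    have := Nat.div_add_mod' (c d) Δ
    have := Nat.mod_lt (c d) hΔ0
    omega
  rw [sum_add_distrib, sum_const, Nat.card_Icc, smul_eq_mul] at h6
  have h7 : (g + 1 - 2) * Δ + Δ = g * Δ := by
    obtain ⟨g', rfl⟩ := Nat.exists_eq_add_of_le hg
    rw [show 2 + g' + 1 - 2 = g' + 1 by omega]; ring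
  change ∑ d ∈ Icc 2 g, c d = _ at h1
  omega

end Dominance

end WordRAM

/-! ### The set of all samples, its size, and the dominance program -/

namespace WordRAM

open Finset WordRAM.Expr

theorem mul_add_inj {W a b a' b' : ℕ} (hb : b < W) (hb' : b' < W) (h : a * W + b = a' * W + b') :
    a = a' ∧ b = b' := by
  have hW : 0 < W := by omega
  have h1 : (a * W + b) / W = (a' * W + b') / W := by rw [h]
  rw [Nat.mul_comm a, Nat.mul_comm a', Nat.mul_add_div hW, Nat.mul_add_div hW,
    Nat.div_eq_of_lt hb, Nat.div_eq_of_lt hb'] at h1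
  have h2 : a = a' := by simpa using h1
  subst h2
  exact ⟨rfl, by omega⟩

theorem sum_div_two_pow_le (m I : ℕ) : ∑ i ∈ range I, m / 2 ^ (i + 1) ≤ m := by
  -- The extra term is the remainder that the next step halves.
  suffices h : ∑ i ∈ range I, m / 2 ^ (i + 1) + m / 2 ^ I ≤ m from
    (Nat.le_add_right _ _).trans h
  induction I with
  | zero => simp
  | succ I ih =>
    rw [sum_range_succ]
    have : m / 2 ^ (I + 1) = m / 2 ^ I / 2 := by rw [pow_succ, Nat.div_div_eq_div_mul]
    omega

section Keys

variable (π : ℕ → ℕ) (m g f₀ K : ℕ)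

/-- The sampled groups. -/
noncomputable def domGroup (t : ℕ × ℕ × ℕ) : Finset ℕ :=
  if t.2.1 = 0 then if t.1 = 0 then largest K ((Ico t.2.2 m).image π) else ∅
  else if 2 ≤ t.2.1 then
    sample (2 ^ (2 * (f₀ * 2 ^ t.1))) (slabGroup π m g (f₀ * 2 ^ t.1) t.2.1 t.2.2)
  else ∅

/-- The index of a group. -/
def domTag (W : ℕ) (t : ℕ × ℕ × ℕ) : ℕ := ((f₀ * 2 ^ t.1) * W + t.2.1) * W + t.2.2

/-- The set of all sampled heights, tagged with their groups. -/
noncomputable def domKeys (W I : ℕ) : Finset ℕ :=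
  grouped W (domTag f₀ W) (range I ×ˢ range (g + 1) ×ˢ range m) (domGroup π m g f₀ K)

variable {π m g f₀ K}

theorem domGroup_lt (hπ : ∀ x < m, π x < m) (t : ℕ × ℕ × ℕ) {y : ℕ}
    (hy : y ∈ domGroup π m g f₀ K t) : y < m := by
  unfold domGroup at hy
  split_ifs at hy
  · have := (mem_filter.1 hy).1
    simp only [mem_image, mem_Ico] at this
    obtain ⟨x, hx, rfl⟩ := this
    exact hπ x hx.2
  · simp at hy
  · exact slabGroup_lt hπ (mem_filter.1 hy).1
  · simp at hy

theorem domGroup_eq_empty {t : ℕ × ℕ × ℕ} (ht : m ≤ t.2.2) : domGroup π m g f₀ K t = ∅ := by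
  unfold domGroup
  split_ifs
  · rw [Ico_eq_empty (by omega)]; simp [largest]
  · rfl
  · rw [slabGroup_eq_empty]
    · simp [sample]
    · have : 1 ≤ 2 ^ (f₀ * 2 ^ t.1 * t.2.1) := Nat.one_le_two_pow
      nlinarith
  · rfl

/-- At most `m / 2 ^ (f * d)` slabs have a nonempty group, and a group of at most `2 ^ (f * d + f)`
points keeps at most `2 ^ (f * d - f)` of them. -/
theorem sum_card_sample_slabGroup_le (hπ : ∀ x < m, π x < m) (f : ℕ) {d : ℕ} (hd : 2 ≤ d) :
    ∑ J ∈ range m, #(sample (2 ^ (2 * f)) (slabGroup π m g f d J)) ≤ m / 2 ^ f := by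
  have hsub : range (m / 2 ^ (f * d)) ⊆ range m := range_subset_range.2 (Nat.div_le_self _ _)
  rw [← sum_subset hsub]
  · have hfd : f * d + f = (f * d - f) + 2 * f ∧ f ≤ f * d := by
      have : f * 2 ≤ f * d := Nat.mul_le_mul_left _ hd
      omega
    have hle : ∀ J ∈ range (m / 2 ^ (f * d)),
        #(sample (2 ^ (2 * f)) (slabGroup π m g f d J)) ≤ 2 ^ (f * d - f) := by
      intro J _
      rw [card_sample']
      refine (Nat.div_le_div_right (card_slabGroup_le hπ f d J)).trans ?_
      rw [hfd.1, pow_add, Nat.mul_div_cancel _ (by positivity)]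
    refine (sum_le_sum hle).trans ?_
    rw [sum_const, card_range, smul_eq_mul, Nat.le_div_iff_mul_le (by positivity), Nat.mul_assoc,
      ← pow_add, Nat.sub_add_cancel hfd.2]
    exact Nat.div_mul_le_self _ _
  · intro J _ hJ
    rw [mem_range, not_lt] at hJ
    rw [slabGroup_eq_empty]
    · simp [sample]
    · have h1 := Nat.div_add_mod' m (2 ^ (f * d))
      have h2 := Nat.mod_lt m (show 0 < 2 ^ (f * d) by positivity)
      have h3 := Nat.mul_le_mul_right (2 ^ (f * d)) hJ
      rw [Nat.add_mul, Nat.one_mul]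
      omega

/-- Scale `i` has `f₀ * 2 ^ i ≥ i + 1`, so each of the `g` levels costs at most `m / 2 ^ (i + 1)`
there and at most `m` over all scales. The exact lists of `K` heights exist at scale `0` only. -/
theorem card_domKeys_le (hπ : ∀ x < m, π x < m) (hf : 0 < f₀) (W I : ℕ) :
    #(domKeys π m g f₀ K W I) ≤ (K + g) * m := by
  refine (card_grouped_le _ _ _ _).trans ?_
  simp only [sum_product]
  have h1 : ∀ i ∈ range I, ∑ d ∈ range (g + 1), ∑ J ∈ range m, #(domGroup π m g f₀ K (i, d, J)) ≤
      (if i = 0 then m * K else 0) + g * (m / 2 ^ (i + 1)) := by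
    intro i _
    rw [sum_range_succ', Nat.add_comm]
    refine Nat.add_le_add ?_ ?_
    · by_cases hi : i = 0
      · simp only [hi, domGroup, if_true]
        refine (sum_le_sum fun J _ => card_largest_le K _).trans ?_
        simp
      · simp [hi, domGroup]
    · have : ∀ d ∈ range g, ∑ J ∈ range m, #(domGroup π m g f₀ K (i, d + 1, J)) ≤
          m / 2 ^ (i + 1) := by
        intro d _
        by_cases hd : 2 ≤ d + 1
        · simp only [domGroup, hd, if_true, Nat.succ_ne_zero, if_false]
          refine (sum_card_sample_slabGroup_le hπ _ hd).trans ?_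
          refine Nat.div_le_div_left (Nat.pow_le_pow_right (by norm_num) ?_) (by positivity)
          have h2 : i < 2 ^ i := Nat.lt_two_pow_self
          nlinarith
        · simp [domGroup, hd]
      refine (sum_le_sum this).trans ?_
      simp
  refine (sum_le_sum h1).trans ?_
  rw [sum_add_distrib, ← mul_sum]
  have h2 : ∑ i ∈ range I, (if i = 0 then m * K else 0) ≤ m * K := by
    rw [sum_ite_eq']; split <;> omega
  have h3 := Nat.mul_le_mul_left g (sum_div_two_pow_le m I)
  calc _ ≤ m * K + g * m := Nat.add_le_add h2 h3
    _ = _ := by ring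

/-- A tag has the base-`W` digits `d` and `J` below the leading part `f₀ * 2 ^ i`, which may be
large; so tags are distinct. A query with `J = m` belongs to an empty group. -/
theorem rk_domKeys (hπ : ∀ x < m, π x < m) (hf : 0 < f₀) {W I : ℕ} (hm : m < W) (hg : g < W)
    {i d J s : ℕ} (hi : i < I) (hd : d ≤ g) (hJ : J < W) (hs : s ≤ W) :
    rk (domKeys π m g f₀ K W I) (domTag f₀ W (i, d, J) * W + s) +
        #{y ∈ domGroup π m g f₀ K (i, d, J) | s ≤ y} =
      rk (domKeys π m g f₀ K W I) (domTag f₀ W (i, d, J) * W + W) := by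
  refine rk_grouped (fun t _ y hy => (domGroup_lt hπ t hy).trans hm) ?_ ?_ hs
  · rintro ⟨i', d', J'⟩ ht' heq
    simp only [mem_product, mem_range] at ht'
    simp only [domTag] at heq
    obtain ⟨h1, h2⟩ := mul_add_inj (by omega) hJ heq
    obtain ⟨h3, h4⟩ := mul_add_inj (by omega) (by omega) h1
    have h5 := Nat.pow_right_injective le_rfl (Nat.eq_of_mul_eq_mul_left hf h3)
    rw [h5, h2, h4]
  · intro ht
    apply domGroup_eq_empty
    simp only [mem_product, mem_range] at ht
    by_contra hJm
    exact ht ⟨hi, by omega, by simpa using hJm⟩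

theorem card_domGroup_small (hinj : Set.InjOn π (Set.Iio m)) (r s : ℕ) :
    #{y ∈ domGroup π m g f₀ K (0, 0, r) | s ≤ y} = min (strip π r m s) K := by
  simp only [domGroup, if_true]
  rw [card_largest, card_filter_image_Ico hinj le_rfl]

theorem card_domGroup_of_two_le {i d J s : ℕ} (hd : 2 ≤ d) :
    #{y ∈ domGroup π m g f₀ K (i, d, J) | s ≤ y} =
      #{y ∈ slabGroup π m g (f₀ * 2 ^ i) d J | s ≤ y} / 2 ^ (2 * (f₀ * 2 ^ i)) := by
  simp only [domGroup, if_neg (show d ≠ 0 by omega), if_pos hd]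
  rw [card_sample]

end Keys

/-- The heap order of the dyadic slabs. -/
noncomputable def stairTable (π : ℕ → ℕ) (m lam : ℕ) (i : ℕ) : ℕ :=
  if i = 0 then 0 else stair π m (lam - Nat.log 2 i) (i - 2 ^ Nat.log 2 i)

/-- The slab of width `2 ^ e` around `r` has heap index `2 ^ (lam - e) + r / 2 ^ e`, which a single
shift produces. When `e` exceeds `lam` the shift gives index `0`, where the table holds the correct
value `0`. -/
theorem stairTable_eq {π : ℕ → ℕ} {m lam : ℕ} (hm : m < 2 ^ lam) {r : ℕ} (hr : r ≤ m) (e : ℕ) :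
    (2 ^ lam + r) / 2 ^ e < 2 ^ (lam + 1) ∧
      stairTable π m lam ((2 ^ lam + r) / 2 ^ e) = stair π m e (r / 2 ^ e) := by
  refine ⟨(Nat.div_le_self _ _).trans_lt (by rw [pow_succ]; omega), ?_⟩
  rcases le_or_gt e lam with he | he
  · have h1 : 2 ^ lam = 2 ^ (lam - e) * 2 ^ e := by rw [← pow_add, Nat.sub_add_cancel he]
    have h2 : (2 ^ lam + r) / 2 ^ e = 2 ^ (lam - e) + r / 2 ^ e := by
      rw [h1, Nat.add_comm, Nat.add_mul_div_right _ _ (by positivity), Nat.add_comm]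
    have h3 : r / 2 ^ e < 2 ^ (lam - e) := by
      rw [Nat.div_lt_iff_lt_mul (by positivity), ← h1]; omega
    have h4 : Nat.log 2 (2 ^ (lam - e) + r / 2 ^ e) = lam - e :=
      Nat.log_eq_of_pow_le_of_lt_pow (Nat.le_add_right _ _)
      (by rw [pow_succ, Nat.mul_two]; exact Nat.add_lt_add_left h3 _)
    have h5 : 0 < 2 ^ (lam - e) := by positivity
    rw [h2, stairTable, if_neg (Nat.add_pos_left h5 _).ne', h4, Nat.add_sub_cancel_left, Nat.sub_sub_self he]
  · have h1 : 2 ^ (lam + 1) ≤ 2 ^ e := Nat.pow_le_pow_right (by norm_num) he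
    rw [pow_succ] at h1
    rw [Nat.div_eq_of_lt (by omega), stairTable, if_pos rfl, stair_eq_zero (by omega)]

/-- The number of elements above `102` of the group that is given by the registers `104`, `105`
and `106`, computed into register `109`. -/
def groupCount : Prog :=
  .seq (asgs [(107, ((var 104 * var 112 + var 105) * var 112 + var 106) * var 112), (50, var 114),
    (51, var 107 + var 102)]) <|
  .seq rank <|
  .seq (asgs [(108, var 52), (50, var 114), (51, var 107 + var 112)]) <|
  .seq rank (asg 109 (var 52 - var 108))

/-- The address of the stair at the current scale. -/
def stairExpr (g : ℕ) : Expr := ld (var 100 + lit 3 + shr (var 113 + var 101) (var 104 * lit g))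

/-- The approximate number of points in `[101, ∞) × [102, ∞)`, computed into register `103` from
the structure at the address in register `100`. -/
def dominance (g f₀ K : ℕ) : Prog :=
  .seq (asgs [(112, ld (var 100)), (113, ld (var 100 + lit 1)),
    (114, var 100 + ld (var 100 + lit 2)), (104, lit f₀), (105, lit 0), (106, var 101)]) <|
  .seq groupCount <|
  .branch .lt (.reg 109) (.imm K) (asg 103 (var 109)) <|
  .seq (asg 110 (stairExpr g)) <|
  .seq (.loop .lt (.reg 102) (.reg 110) (asgs [(104, var 104 * lit 2), (110, stairExpr g)])) <|
  .seq (asgs [(111, lit 0), (105, lit g)]) <|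
  .seq (.loop .le (.imm 2) (.reg 105) <|
    .seq (asg 106 (shr (var 101) (var 104 * var 105))) <|
    .seq groupCount (asgs [(111, var 111 + var 109), (105, var 105 - lit 1)]))
  (asg 103 (shl (var 111) (var 104 * lit 2)))

/-- The memory at address `b` holds a structure for the points of the graph of `π` on `[0, m)`. -/
structure DomBlock {w S : ℕ} (D : Fin S → BitVec w) (b g f₀ K : ℕ) (π : ℕ → ℕ) (m : ℕ) where
  lam : ℕ
  ω : ℕ
  oR : ℕ
  map_lt : ∀ x < m, π x < m
  inj : Set.InjOn π (Set.Iio m)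
  m_lt : m < 2 ^ lam
  le_m : 2 ^ lam ≤ 2 * m
  ω_eq : ω = lam + f₀ + g + K + 2
  rankBlock : RankBlock D (b + oR) (domKeys π m g f₀ K (2 ^ ω) (lam + 1)) (4 * ω + 1)
  hdr : b + 2 < S
  cell_W : cell D b = 2 ^ ω
  cell_M : cell D (b + 1) = 2 ^ lam
  cell_oR : cell D (b + 2) = oR
  stairs : ∀ i < 2 ^ (lam + 1), b + 3 + i < S ∧ cell D (b + 3 + i) = stairTable π m lam i

section

variable {w S : ℕ} {D : Fin S → BitVec w} {b g f₀ K : ℕ} {π : ℕ → ℕ} {m : ℕ}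

/-- Two ranks, at the threshold and at the end of the group's interval; their difference is the
count. -/
theorem wp_groupCount (H : DomBlock D b g f₀ K π m) (hf : 0 < f₀) {i d J s : ℕ}
    (hi : i ≤ H.lam) (hd : d ≤ g) (hJ : J ≤ m) (hs : s ≤ m) (hfi : f₀ * 2 ^ i < 2 ^ H.ω)
    {ρ : ℕ → ℕ} (h102 : ρ 102 = s) (h104 : ρ 104 = f₀ * 2 ^ i) (h105 : ρ 105 = d)
    (h106 : ρ 106 = J) (h112 : ρ 112 = 2 ^ H.ω) (h114 : ρ 114 = b + H.oR) :
    WP D groupCount ρ fun t ρ' => t ≤ 2100 * (Nat.log 2 (4 * H.ω + 1) + 1) ∧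
      ρ' 109 = #{y ∈ domGroup π m g f₀ K (i, d, J) | s ≤ y} ∧
      ∀ r, 100 ≤ r → r ≠ 107 → r ≠ 108 → r ≠ 109 → ρ' r = ρ r := by
  have hmW : m < 2 ^ H.ω :=
    H.m_lt.trans_le (Nat.pow_le_pow_right (by norm_num) (by have := H.ω_eq; omega))
  have hgW : g < 2 ^ H.ω :=
    (Nat.lt_two_pow_self (n := g)).trans_le (Nat.pow_le_pow_right (by norm_num)
      (by have := H.ω_eq; omega))
  have hrk := rk_domKeys (K := K) H.map_lt hf hmW hgW (Nat.lt_add_one_of_le hi) hd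
    (hJ.trans_lt hmW) (hs.trans hmW.le)
  have hRB := H.rankBlock
  set W := 2 ^ H.ω with hW
  set τ := domTag f₀ W (i, d, J) with hτ
  -- Four digits in base `W`; the end of the last interval may equal `W ^ 4`, hence keys of `4 * ω +
  -- 1` bits.
  have hτW : τ * W + W ≤ W ^ 4 := by
    have h1 : (f₀ * 2 ^ i) * W + d < W * W := by nlinarith
    have h2 : τ < W * W * W := by
      have h3 : τ = ((f₀ * 2 ^ i) * W + d) * W + J := rfl
      have h4 := Nat.mul_le_mul_right W (show (f₀ * 2 ^ i) * W + d + 1 ≤ W * W from h1)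
      rw [Nat.add_mul] at h4
      omega
    have h5 := Nat.mul_le_mul_right W (show τ + 1 ≤ W * W * W from h2)
    rw [Nat.add_mul] at h5
    calc _ ≤ W * W * W * W := by omega
      _ = _ := by ring
  have hlt : τ * W + W < 2 ^ (4 * H.ω + 1) := by
    have h1 : W ^ 4 = 2 ^ (4 * H.ω) := by rw [hW, ← pow_mul, Nat.mul_comm]
    have h2 : 0 < 2 ^ (4 * H.ω) := by positivity
    rw [pow_succ]; omega
  unfold groupCount
  refine WP.seq (WP.asgs_of (fun ρ' => ρ' 50 = b + H.oR ∧ ρ' 51 = τ * W + s ∧ ρ' 107 = τ * W ∧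
    ∀ r, 100 ≤ r → r ≠ 107 → ρ' r = ρ r) ?_ ⟨?_, ?_, ?_, fun r hr hr' => ?_⟩ ?_)
  · simp
  · simp [h114]
  · simp [h102, h104, h105, h106, h112, hτ, domTag]
  · simp [h104, h105, h106, h112, hτ, domTag]
  · simp only [runAsgs]
    rw [Function.update_of_ne (by omega), Function.update_of_ne (by omega),
      Function.update_of_ne (by omega)]
  rintro ρ1 ⟨a1, a2, a3, a4⟩
  refine WP.seq ((wp_rank hRB (by omega) a1 a2).mono ?_)
  rintro t1 ρ2 ⟨ht1, b1, b2⟩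
  refine WP.seq (WP.asgs_of (fun ρ' => ρ' 50 = b + H.oR ∧ ρ' 51 = τ * W + W ∧
    ρ' 108 = rk (domKeys π m g f₀ K W (H.lam + 1)) (τ * W + s) ∧
    ∀ r, 100 ≤ r → r ≠ 107 → r ≠ 108 → ρ' r = ρ r) ?_ ⟨?_, ?_, ?_, fun r hr hr' hr'' => ?_⟩ ?_)
  · simp
  · simp [b2, a4, h114]
  · simp [b2, a3, a4, h112]
  · simp [b1]
  · simp only [runAsgs]
    rw [Function.update_of_ne (by omega), Function.update_of_ne (by omega),
      Function.update_of_ne (by omega), b2 r (by omega), a4 r hr hr']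
  rintro ρ3 ⟨c1, c2, c3, c4⟩
  refine WP.seq ((wp_rank hRB hlt c1 c2).mono ?_)
  rintro t2 ρ4 ⟨ht2, d1, d2⟩
  refine WP.asg (by norm_num) ?_ ⟨?_, ?_, fun r hr h7 h8 h9 => ?_⟩
  · simp [d1, d2, c3]; omega
  · simp; omega
  · simp [d1, d2, c3]; omega
  · rw [Function.update_of_ne h9, d2 r (by omega), c4 r hr h7 h8]

/-- The outcome of an approximate query for `k` points. -/
def ApproxOutcome (g f₀ K k k' : ℕ) : Prop :=
  k' = k ∨ (K ≤ k ∧ ∃ i, k' ≤ k ∧ k ≤ k' + g * 2 ^ (2 * (f₀ * 2 ^ i)) ∧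
    (i = 0 ∨ 2 ^ (f₀ * 2 ^ (i - 1) * g) < k))

theorem strip_anti {π : ℕ → ℕ} {a a' b s : ℕ} (h : a ≤ a') : strip π a' b s ≤ strip π a b s :=
  card_le_card (filter_subset_filter _ (Ico_subset_Ico_left h))

theorem lt_of_lt_stair (H : DomBlock D b g f₀ K π m) (hg : 2 ≤ g) {f J s : ℕ}
    (hs : s < stair π m (f * g) J) : f < H.lam := by
  by_contra hc
  have h1 : m ≤ 2 ^ (f * g) := H.m_lt.le.trans (Nat.pow_le_pow_right (by norm_num) (by nlinarith))
  rw [stair_eq_zero h1] at hs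
  omega

/-- The registers that are fixed during a dominance query. -/
def DomEnv (b r s W M R : ℕ) (ρ₀ ρ : ℕ → ℕ) : Prop :=
  ρ 100 = b ∧ ρ 101 = r ∧ ρ 102 = s ∧ ρ 112 = W ∧ ρ 113 = M ∧ ρ 114 = R ∧
    ∀ x, 120 ≤ x → ρ x = ρ₀ x

theorem DomEnv.congr {b r s W M R : ℕ} {ρ₀ ρ ρ' : ℕ → ℕ} (h : DomEnv b r s W M R ρ₀ ρ)
    (h' : ∀ x, 100 ≤ x → ¬(103 ≤ x ∧ x ≤ 111) → ρ' x = ρ x) : DomEnv b r s W M R ρ₀ ρ' := by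
  obtain ⟨h1, h2, h3, h4, h5, h6, h7⟩ := h
  refine ⟨?_, ?_, ?_, ?_, ?_, ?_, fun x hx => ?_⟩ <;> rw [h' _ (by omega) (by omega)]
  exacts [h1, h2, h3, h4, h5, h6, h7 x hx]

end

end WordRAM

/-! ### Correctness and time of the dominance program -/

namespace WordRAM

open Finset WordRAM.Expr

variable {w S : ℕ} {D : Fin S → BitVec w} {b g f₀ K : ℕ} {π : ℕ → ℕ} {m : ℕ}

theorem DomBlock.lam_pos (H : DomBlock D b g f₀ K π m) (hm : 0 < m) : 0 < H.lam := by
  by_contra hc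
  have h1 := H.m_lt
  have h0 : H.lam = 0 := by omega
  rw [h0] at h1
  simp at h1
  omega

theorem wp_stairExpr (H : DomBlock D b g f₀ K π m) {f r : ℕ} (hr : r ≤ m)
    (hfw : f * g < 2 ^ w) {ρ : ℕ → ℕ} (h100 : ρ 100 = b) (h101 : ρ 101 = r)
    (h104 : ρ 104 = f) (h113 : ρ 113 = 2 ^ H.lam) :
    (stairExpr g).Ok D ρ ∧ (stairExpr g).eval D ρ = stair π m (f * g) (r / 2 ^ (f * g)) := by
  obtain ⟨h1, h2⟩ := stairTable_eq (π := π) H.m_lt hr (f * g)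
  obtain ⟨h3, h4⟩ := H.stairs _ h1
  have hS := H.rankBlock.table.le_pow
  have hlam : 2 ^ H.lam + r < 2 ^ w := by
    have hw := H.rankBlock.lt_w
    have h5 : 2 ^ H.lam + r < 2 ^ (H.lam + 1) := by
      have := H.m_lt
      rw [pow_succ]; omega
    refine h5.trans_le (Nat.pow_le_pow_right (by norm_num) ?_)
    have := H.ω_eq; omega
  constructor
  · simp only [stairExpr, ok_ld, ok_add, ok_var, ok_lit, ok_shr, eval_add, eval_var, eval_lit,
      eval_shr, ok_mul, eval_mul, h100, h101, h104, h113]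
    norm_num
    exact ⟨⟨hlam, hfw⟩, h3, hS⟩
  · simp only [stairExpr, eval_ld, eval_add, eval_var, eval_lit,
      eval_shr, eval_mul, h100, h101, h104, h113, h4, h2]

/-- A rejected scale is less than `lam`, and scales double, so the number of rounds is at most `log
lam + 1`. The last rejection supplies the lower bound on the count. -/
theorem wp_scan (H : DomBlock D b g f₀ K π m) (hg : 2 ≤ g) (hm : 0 < m)
    {r s : ℕ} (hr : r ≤ m) (hs : s ≤ m) {ρ₀ ρ : ℕ → ℕ}
    (hE : DomEnv b r s (2 ^ H.ω) (2 ^ H.lam) (b + H.oR) ρ₀ ρ) (h104 : ρ 104 = f₀)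
    (h110 : ρ 110 = stair π m (f₀ * g) (r / 2 ^ (f₀ * g))) (hf : 0 < f₀) :
    WP D (.loop .lt (.reg 102) (.reg 110) (asgs [(104, var 104 * lit 2), (110, stairExpr g)])) ρ
      fun t ρ' => t ≤ (Nat.log 2 H.lam + 1) * 30 + 1 ∧
        DomEnv b r s (2 ^ H.ω) (2 ^ H.lam) (b + H.oR) ρ₀ ρ' ∧ ∃ i ≤ H.lam,
          ρ' 104 = f₀ * 2 ^ i ∧ f₀ * 2 ^ i < 2 ^ H.ω ∧
          stair π m (f₀ * 2 ^ i * g) (r / 2 ^ (f₀ * 2 ^ i * g)) ≤ s ∧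
          (i = 0 ∨ 2 ^ (f₀ * 2 ^ (i - 1) * g) < strip π r m s) := by
  have hlam := H.lam_pos hm
  have hω := H.ω_eq
  have hWw : 2 ^ H.ω * 2 ^ H.ω < 2 ^ w := by
    rw [← pow_add]
    have := H.rankBlock.lt_w
    exact Nat.pow_lt_pow_right (by norm_num) (by omega)
  have hgW : g < 2 ^ H.ω :=
    (Nat.lt_two_pow_self (n := g)).trans_le (Nat.pow_le_pow_right (by norm_num) (by omega))
  have hf0W : f₀ < 2 ^ H.ω :=
    (Nat.lt_two_pow_self (n := f₀)).trans_le (Nat.pow_le_pow_right (by norm_num) (by omega))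
  have hmW : m < 2 ^ H.ω := H.m_lt.trans_le (Nat.pow_le_pow_right (by norm_num) (by omega))
  have hW1 : 2 ^ H.ω ≤ 2 ^ w := Nat.pow_le_pow_right (by norm_num) (by
    have := H.rankBlock.lt_w; omega)
  -- Consequences of a rejection: few scales so far, the next scale still fits in a digit, and the
  -- points right of the slab, all of them right of `r`, are many.
  have hstep : ∀ i, s < stair π m (f₀ * 2 ^ i * g) (r / 2 ^ (f₀ * 2 ^ i * g)) →
      i ≤ Nat.log 2 H.lam ∧ f₀ * 2 ^ (i + 1) < 2 ^ H.ω ∧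
      2 ^ (f₀ * 2 ^ i * g) < strip π r m s := by
    intro i hi
    have h1 := lt_of_lt_stair H hg hi
    have h2 : 2 ^ i ≤ f₀ * 2 ^ i := Nat.le_mul_of_pos_left _ hf
    refine ⟨Nat.le_log_of_pow_le (by norm_num) (by omega), ?_, ?_⟩
    · have h3 : H.lam < 2 ^ H.lam := Nat.lt_two_pow_self
      have h4 : 2 ^ (H.lam + 1) ≤ 2 ^ H.ω := Nat.pow_le_pow_right (by norm_num) (by omega)
      rw [pow_succ] at h4 ⊢
      rw [← Nat.mul_assoc]; omega
    · refine (stair_le_iff H.map_lt hi).trans_le (strip_anti ?_)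
      exact (Nat.lt_mul_of_div_lt (Nat.lt_succ_self _) (by positivity)).le
  refine (WP.loop 29 (fun k ρ => DomEnv b r s (2 ^ H.ω) (2 ^ H.lam) (b + H.oR) ρ₀ ρ ∧ ∃ i,
    Nat.log 2 H.lam + 1 - i ≤ k ∧ i ≤ Nat.log 2 H.lam + 1 ∧
    ρ 104 = f₀ * 2 ^ i ∧ f₀ * 2 ^ i < 2 ^ H.ω ∧
    ρ 110 = stair π m (f₀ * 2 ^ i * g) (r / 2 ^ (f₀ * 2 ^ i * g)) ∧
    (i = 0 ∨ 2 ^ (f₀ * 2 ^ (i - 1) * g) < strip π r m s)) ?_ ?_ (Nat.log 2 H.lam + 1) ρ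
    ⟨hE, 0, by omega, by omega, by simpa using h104, by simpa using hf0W, by simpa using h110,
      Or.inl rfl⟩).mono ?_
  · rintro k ρ ⟨⟨-, -, h2, -⟩, i, -, -, -, -, h10, -⟩
    have := stair_le H.map_lt (f₀ * 2 ^ i * g) (r / 2 ^ (f₀ * 2 ^ i * g))
    refine ⟨⟨by norm_num, ?_⟩, ⟨by norm_num, ?_⟩⟩ <;> simp only [Operand.nat] <;> omega
  · rintro k ρ ⟨hE', i, i1, i2, i3, i4, i5, i6⟩ hc
    simp only [Cmp.nat, Operand.nat, hE'.2.2.1, i5] at hc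
    obtain ⟨j1, j2, j3⟩ := hstep i hc
    have hfw : f₀ * 2 ^ (i + 1) * g < 2 ^ w :=
      (Nat.mul_le_mul j2.le hgW.le).trans_lt hWw
    have hst := wp_stairExpr H hr hfw (ρ := Function.update ρ 104 (f₀ * 2 ^ (i + 1)))
      (by simpa using hE'.1) (by simpa using hE'.2.1) (by simp) (by simpa using hE'.2.2.2.2.1)
    have hval : (var 104 * lit 2).eval D ρ = f₀ * 2 ^ (i + 1) := by
      simp [i3, pow_succ, Nat.mul_assoc]
    refine WP.asgs ?_ ⟨?_, k - 1, by omega, hE'.congr ?_, i + 1, by omega, by omega, ?_, j2, ?_,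
      Or.inr ?_⟩
    · simp only [OkAsgs, hval]
      exact ⟨by norm_num, by simp, by norm_num, hst.1, trivial⟩
    · simp [stairExpr]
    · intro x hx hx'
      simp only [runAsgs]
      rw [Function.update_of_ne (by omega), Function.update_of_ne (by omega)]
    · simp only [runAsgs, hval]; simp
    · simp only [runAsgs, hval, hst.2]; simp
    · simpa using j3
  · rintro t ρ' ⟨ht, k, ⟨hE', i, i1, i2, i3, i4, i5, i6⟩, hc⟩
    simp only [Cmp.nat, Operand.nat, hE'.2.2.1, i5, not_lt] at hc
    have hlog : Nat.log 2 H.lam < H.lam := Nat.log_lt_self 2 (by omega)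
    exact ⟨ht, hE', i, by omega, i3, i4, hc, i6⟩

theorem wp_sumLoop (H : DomBlock D b g f₀ K π m) (hf : 0 < f₀)
    {r s i : ℕ} (hr : r ≤ m) (hs : s ≤ m) (hi : i ≤ H.lam) (hfi : f₀ * 2 ^ i < 2 ^ H.ω)
    {ρ₀ ρ : ℕ → ℕ}
    (hE : DomEnv b r s (2 ^ H.ω) (2 ^ H.lam) (b + H.oR) ρ₀ ρ) (h104 : ρ 104 = f₀ * 2 ^ i)
    (h105 : ρ 105 = g) (h111 : ρ 111 = 0) :
    WP D (.loop .le (.imm 2) (.reg 105) <|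
      .seq (asg 106 (shr (var 101) (var 104 * var 105))) <|
      .seq groupCount (asgs [(111, var 111 + var 109), (105, var 105 - lit 1)])) ρ
      fun t ρ' => t ≤ g * (2200 * (Nat.log 2 (4 * H.ω + 1) + 1) + 1) + 1 ∧
        DomEnv b r s (2 ^ H.ω) (2 ^ H.lam) (b + H.oR) ρ₀ ρ' ∧
        ρ' 104 = f₀ * 2 ^ i ∧
        ρ' 111 = ∑ d ∈ Icc 2 g, #{y ∈ domGroup π m g f₀ K (i, d, r / 2 ^ (f₀ * 2 ^ i * d)) |
          s ≤ y} := by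
  have hω := H.ω_eq
  have hWw : 2 ^ H.ω * 2 ^ H.ω < 2 ^ w := by
    rw [← pow_add]
    have := H.rankBlock.lt_w
    exact Nat.pow_lt_pow_right (by norm_num) (by omega)
  have hgW : g < 2 ^ H.ω :=
    (Nat.lt_two_pow_self (n := g)).trans_le (Nat.pow_le_pow_right (by norm_num) (by omega))
  have hW2 : 2 < 2 ^ H.ω := by
    calc 2 = 2 ^ 1 := rfl
      _ < 2 ^ H.ω := Nat.pow_lt_pow_right (by norm_num) (by omega)
  have hmW : m < 2 ^ H.ω := H.m_lt.trans_le (Nat.pow_le_pow_right (by norm_num) (by omega))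
  have hW1 : 2 ^ H.ω ≤ 2 ^ w := Nat.pow_le_pow_right (by norm_num) (by
    have := H.rankBlock.lt_w; omega)
  set c : ℕ → ℕ := fun d =>
    #{y ∈ domGroup π m g f₀ K (i, d, r / 2 ^ (f₀ * 2 ^ i * d)) | s ≤ y} with hc
  -- The levels are visited from `g` down to `2`; `k` is the next level, and the sum covers those
  -- above it.
  refine (WP.loop (2200 * (Nat.log 2 (4 * H.ω + 1) + 1)) (fun k ρ =>
    DomEnv b r s (2 ^ H.ω) (2 ^ H.lam) (b + H.oR) ρ₀ ρ ∧
    ρ 104 = f₀ * 2 ^ i ∧ ρ 105 = k ∧ k ≤ g ∧ (k = 0 → g = 0) ∧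
      ρ 111 = ∑ d ∈ Icc (max 2 (k + 1)) g, c d) ?_ ?_ g ρ
    ⟨hE, h104, h105, le_rfl, id, ?_⟩).mono ?_
  · rintro k ρ ⟨-, -, h5, h6, -⟩
    refine ⟨⟨trivial, ?_⟩, ⟨by norm_num, ?_⟩⟩ <;> simp only [Operand.nat] <;> omega
  · rintro k ρ ⟨hE', h4, h5, h6, h6', h11⟩ hk
    simp only [Cmp.nat, Operand.nat, h5] at hk
    have hkW : f₀ * 2 ^ i * k < 2 ^ w :=
      (Nat.mul_le_mul hfi.le (h6.trans hgW.le)).trans_lt hWw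
    refine WP.seq (WP.asg (by norm_num) ?_ ?_)
    · simp [hE'.2.1, h4, h5, hkW]; omega
    have hval : (shr (var 101) (var 104 * var 105)).eval D ρ = r / 2 ^ (f₀ * 2 ^ i * k) := by
      simp [hE'.2.1, h4, h5]
    rw [hval]
    refine WP.seq ((wp_groupCount H hf (J := r / 2 ^ (f₀ * 2 ^ i * k)) hi h6 ((Nat.div_le_self _ _).trans hr) hs hfi
      (by simpa using hE'.2.2.1) (by simpa using h4) (by simpa using h5) (by simp)
      (by simpa using hE'.2.2.2.1) (by simpa using hE'.2.2.2.2.2.1)).mono ?_)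
    rintro t ρ1 ⟨ht, a1, a2⟩
    have a3 : ∀ x, 100 ≤ x → x ≠ 106 → x ≠ 107 → x ≠ 108 → x ≠ 109 → ρ1 x = ρ x := by
      intro x hx x6 x7 x8 x9
      rw [a2 x hx x7 x8 x9, Function.update_of_ne x6]
    refine WP.asgs ?_ ⟨?_, k - 1, by omega, hE'.congr ?_, ?_, ?_, by omega, by omega, ?_⟩
    · simp [a3, h5]; omega
    · simp; omega
    · intro x hx hx'
      simp only [runAsgs]
      rw [Function.update_of_ne (by omega), Function.update_of_ne (by omega)]
      exact a3 x hx (by omega) (by omega) (by omega) (by omega)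
    · simp [a3, h4]
    · simp [a3, h5]
    · simp only [runAsgs, eval_add, eval_var, ne_eq, Nat.reduceEqDiff, not_false_eq_true,
        Function.update_of_ne, Function.update_self, a1, a3 111 (by norm_num) (by norm_num)
        (by norm_num) (by norm_num) (by norm_num), h11]
      rw [show max 2 (k + 1) = k + 1 by omega, show max 2 (k - 1 + 1) = k by omega,
        ← Finset.add_sum_Ioc_eq_sum_Icc h6, Nat.add_comm]
      exact congrArg₂ _ rfl (sum_congr (by ext; simp only [mem_Ioc, mem_Icc]; omega) fun _ _ => rfl)
  · rw [h111, Icc_eq_empty (by omega), sum_empty]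
  · rintro t ρ' ⟨ht, k, ⟨hE', h4, h5, h6, h6', h11⟩, hk⟩
    simp only [Cmp.nat, Operand.nat, h5, not_le] at hk
    refine ⟨ht, hE', h4, ?_⟩
    rw [h11, show max 2 (k + 1) = 2 by omega]

set_option maxHeartbeats 600000 in
theorem wp_dominance (H : DomBlock D b g f₀ K π m) (hg : 2 ≤ g) (hf : 0 < f₀) (hm : 0 < m)
    {r s : ℕ} (hr : r ≤ m) (hs : s ≤ m) {ρ : ℕ → ℕ} (h100 : ρ 100 = b) (h101 : ρ 101 = r)
    (h102 : ρ 102 = s) :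
    WP D (dominance g f₀ K) ρ fun t ρ' =>
      t ≤ (g + 2) * 3000 * (Nat.log 2 (4 * H.ω + 1) + 1) ∧
      ApproxOutcome g f₀ K (strip π r m s) (ρ' 103) ∧ ∀ x, 120 ≤ x → ρ' x = ρ x := by
  have hω := H.ω_eq
  have hWw : 2 ^ H.ω * 2 ^ H.ω < 2 ^ w := by
    rw [← pow_add]
    have := H.rankBlock.lt_w
    exact Nat.pow_lt_pow_right (by norm_num) (by omega)
  have hgW : g < 2 ^ H.ω :=
    (Nat.lt_two_pow_self (n := g)).trans_le (Nat.pow_le_pow_right (by norm_num) (by omega))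
  have hW2 : 2 < 2 ^ H.ω := by omega
  have hf0W : f₀ < 2 ^ H.ω :=
    (Nat.lt_two_pow_self (n := f₀)).trans_le (Nat.pow_le_pow_right (by norm_num) (by omega))
  have hKW : K < 2 ^ H.ω :=
    (Nat.lt_two_pow_self (n := K)).trans_le (Nat.pow_le_pow_right (by norm_num) (by omega))
  have hW1 : 2 ^ H.ω ≤ 2 ^ w := Nat.pow_le_pow_right (by norm_num) (by
    have := H.rankBlock.lt_w; omega)
  have hhdr := H.hdr
  have hS := H.rankBlock.table.le_pow
  have hlog : Nat.log 2 H.lam ≤ Nat.log 2 (4 * H.ω + 1) := Nat.log_mono_right (by omega)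
  unfold dominance
  refine WP.seq (WP.asgs_of (fun ρ' => DomEnv b r s (2 ^ H.ω) (2 ^ H.lam) (b + H.oR) ρ ρ' ∧
    ρ' 104 = f₀ ∧ ρ' 105 = 0 ∧ ρ' 106 = r) ?_ ⟨⟨?_, ?_, ?_, ?_, ?_, ?_, fun x hx => ?_⟩,
      ?_, ?_, ?_⟩ ?_)
  · simp [h100]; omega
  · simp [h100]
  · simp [h101]
  · simp [h102]
  · simp [h100, H.cell_W]
  · simp [h100, H.cell_M]
  · simp [h100, H.cell_oR]
  · exact runAsgs_of_le 120 rfl hx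
  · simp
  · simp
  · simp [h101]
  rintro ρ1 ⟨hE1, a4, a5, a6⟩
  refine WP.seq ((wp_groupCount H hf (i := 0) (Nat.zero_le _) (Nat.zero_le g) hr hs (by simpa)
    hE1.2.2.1 (by simpa using a4) a5 a6 hE1.2.2.2.1 hE1.2.2.2.2.2.1).mono ?_)
  rintro t1 ρ2 ⟨ht1, c1, c2⟩
  rw [card_domGroup_small H.inj] at c1
  have hE2 : DomEnv b r s (2 ^ H.ω) (2 ^ H.lam) (b + H.oR) ρ ρ2 :=
    hE1.congr fun x hx hx' => c2 x hx (by omega) (by omega) (by omega)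
  have b4 : ρ2 104 = f₀ := by rw [c2 _ (by norm_num) (by norm_num) (by norm_num) (by norm_num), a4]
  refine WP.branch ⟨by norm_num, ?_⟩ ⟨trivial, ?_⟩ ?_ ?_
  · simp only [Operand.nat]; omega
  · simp only [Operand.nat]; omega
  · intro hc
    simp only [Cmp.nat, Operand.nat, c1] at hc
    refine WP.asg (by norm_num) (by simp) ⟨?_, ?_, fun x hx => ?_⟩
    · simp
      generalize Nat.log 2 (4 * H.ω + 1) = q at *
      have h4 : (g + 2) * 3000 * (q + 1) = 3000 * (g * q) + 3000 * g + 6000 * q + 6000 := by ring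
      omega
    · left
      simp [c1]; omega
    · rw [Function.update_of_ne (by omega), hE2.2.2.2.2.2.2 x hx]
  · intro hc
    simp only [Cmp.nat, Operand.nat, c1] at hc
    have hK : K ≤ strip π r m s := by omega
    obtain ⟨ok1, val1⟩ := wp_stairExpr H (f := f₀) hr ((Nat.mul_le_mul hf0W.le hgW.le).trans_lt hWw)
      hE2.1 hE2.2.1 b4 hE2.2.2.2.2.1
    refine WP.seq (WP.asg (by norm_num) ok1 ?_)
    rw [val1]
    refine WP.seq ((wp_scan H hg hm hr hs (hE2.congr ?_) (by simpa using b4) (by simp) hf).mono ?_)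
    · intro x hx hx'
      rw [Function.update_of_ne (by omega)]
    rintro t2 ρ3 ⟨ht2, hE3, i, hi, d4, hfi, hst, hlow⟩
    refine WP.seq (WP.asgs_of (fun ρ' => DomEnv b r s (2 ^ H.ω) (2 ^ H.lam) (b + H.oR) ρ ρ' ∧
      ρ' 104 = f₀ * 2 ^ i ∧ ρ' 105 = g ∧ ρ' 111 = 0) (by simp)
      ⟨hE3.congr ?_, by simp [d4], by simp, by simp⟩ ?_)
    · intro x hx hx'
      simp only [runAsgs]
      rw [Function.update_of_ne (by omega), Function.update_of_ne (by omega)]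
    rintro ρ4 ⟨hE4, e4, e5, e11⟩
    refine WP.seq ((wp_sumLoop H hf hr hs hi hfi hE4 e4 e5 e11).mono ?_)
    rintro t3 ρ5 ⟨ht3, hE5, k4, k11⟩
    have hval : (shl (var 111) (var 104 * lit 2)).eval D ρ5 =
        approx π m g (f₀ * 2 ^ i) r s := by
      simp only [eval_shl, eval_var, eval_mul, eval_lit, k4, k11, approx]
      rw [Nat.mul_comm (f₀ * 2 ^ i) 2]
      congr 1
      refine sum_congr rfl fun d hd => card_domGroup_of_two_le (mem_Icc.1 hd).1
    refine WP.asg (by norm_num) ?_ ⟨?_, ?_, fun x hx => ?_⟩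
    · simp [k4]
      exact (Nat.mul_le_mul hfi.le hW2.le).trans_lt hWw
    · simp [stairExpr]
      generalize Nat.log 2 (4 * H.ω + 1) = q at *
      have h1 : (Nat.log 2 H.lam + 1) * 30 ≤ (q + 1) * 30 := Nat.mul_le_mul_right _ (by omega)
      have h2 : g * (2200 * (q + 1) + 1) ≤ g * (2201 * (q + 1)) := Nat.mul_le_mul_left _ (by omega)
      have h3 : g * (2201 * (q + 1)) = 2201 * (g * q) + 2201 * g := by ring
      have h4 : (g + 2) * 3000 * (q + 1) = 3000 * (g * q) + 3000 * g + 6000 * q + 6000 := by ring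
      omega
    · right
      obtain ⟨u1, u2⟩ := approx_le H.inj hg hst
      rw [hval, Function.update_self]
      exact ⟨hK, i, u1, u2, hlow⟩
    · rw [Function.update_of_ne (by omega), hE5.2.2.2.2.2.2 x hx]

end WordRAM

/-! ### The dominance block, the choice of constants, and rank space -/

namespace WordRAM

open Finset WordRAM.Expr

/-- The table of stairs has at most `4 * m` entries and there are at most `(K + g) * m` samples; the
additive cost of the rank structure is logarithmic in `m` up to constants. -/
theorem exists_domBlock {g f₀ K : ℕ} (hf : 0 < f₀) {π : ℕ → ℕ} {m : ℕ} (hm : 0 < m)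
    (hπ : ∀ x < m, π x < m) (hinj : Set.InjOn π (Set.Iio m)) :
    ∃ l : List ℕ, l.length ≤ 1000 * (f₀ + g + K + 1) * m ∧
      (∀ x ∈ l, x < 2 ^ (8 * (Nat.log 2 m + f₀ + g + K + 3) + 12)) ∧
      ∀ (w S : ℕ) (D : Fin S → BitVec w) (b : ℕ), S ≤ 2 ^ w →
        8 * (Nat.log 2 m + f₀ + g + K + 3) + 12 ≤ w → Stored D b l →
        Nonempty (DomBlock D b g f₀ K π m) := by
  set lam := Nat.log 2 m + 1 with hlam
  set ω := lam + f₀ + g + K + 2 with hω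
  have h8 : 8 * (Nat.log 2 m + f₀ + g + K + 3) + 12 = 2 * (4 * ω + 1) + 10 := by omega
  rw [h8]
  have hmlt : m < 2 ^ lam := Nat.lt_pow_succ_log_self (by norm_num) m
  have hle : 2 ^ lam ≤ 2 * m := by
    rw [hlam, pow_succ, Nat.mul_comm]
    exact Nat.mul_le_mul_left _ (Nat.pow_log_le_self 2 hm.ne')
  have hcard := card_domKeys_le (g := g) (K := K) hπ hf (2 ^ ω) (lam + 1)
  have hlamm : lam ≤ m := Nat.log_lt_self 2 hm.ne'
  have hcard2 : #(domKeys π m g f₀ K (2 ^ ω) (lam + 1)) ≤ 2 ^ (4 * ω + 1) := by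
    refine hcard.trans ?_
    calc (K + g) * m ≤ 2 ^ (K + g) * 2 ^ lam :=
          Nat.mul_le_mul Nat.lt_two_pow_self.le hmlt.le
      _ = 2 ^ (K + g + lam) := (pow_add _ _ _).symm
      _ ≤ _ := Nat.pow_le_pow_right (by norm_num) (by omega)
  obtain ⟨rl, hlen, hbd, hrl⟩ := exists_rankBlock _ (by omega : 0 < 4 * ω + 1) hcard2
  have hpω : ∀ e ≤ 4 * ω, 2 ^ e < 2 ^ (2 * (4 * ω + 1) + 10) := fun e he =>
    Nat.pow_lt_pow_right (by norm_num) (by omega)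
  refine ⟨[2 ^ ω, 2 ^ lam, 3 + 2 ^ (lam + 1)] ++ (tab (2 ^ (lam + 1)) (stairTable π m lam) ++ rl),
    ?_, ?_, ?_⟩
  · simp only [List.length_append, List.length_cons, List.length_nil, length_tab]
    rw [pow_succ]
    have h1 : (K + g) * m ≤ (f₀ + g + K + 1) * m := Nat.mul_le_mul_right _ (by omega)
    have h2 : ω ≤ 3 * ((f₀ + g + K + 1) * m) := by
      have : (f₀ + g + K + 1) ≤ (f₀ + g + K + 1) * m := Nat.le_mul_of_pos_right _ hm
      have : m ≤ (f₀ + g + K + 1) * m := Nat.le_mul_of_pos_left _ (by omega)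
      omega
    have h3 : m ≤ (f₀ + g + K + 1) * m := Nat.le_mul_of_pos_left _ (by omega)
    rw [Nat.mul_assoc]
    omega
  · intro x hx
    simp only [List.mem_append, List.mem_cons, List.not_mem_nil, or_false, mem_tab] at hx
    rcases hx with (rfl | rfl | rfl) | ⟨i, hi, rfl⟩ | hx
    · exact hpω _ (by omega)
    · exact hpω _ (by omega)
    · refine lt_trans ?_ (hpω (lam + 2 + 1) (by omega))
      have : 1 ≤ 2 ^ (lam + 1) := Nat.one_le_two_pow
      simp only [pow_succ] at *
      omega
    · refine lt_of_le_of_lt ?_ (hpω lam (by omega))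
      unfold stairTable
      split
      · exact Nat.zero_le _
      · exact (stair_le hπ _ _).trans hmlt.le
    · exact hbd x hx
  · intro w S D b hS hw hst
    simp only [stored_append, List.length_cons, List.length_nil, length_tab, Nat.zero_add,
      Nat.reduceAdd] at hst
    obtain ⟨s0, s1, s2⟩ := hst
    have hlen := s0.1
    have hc := s0.2
    simp only [List.length_cons, List.length_nil, Nat.zero_add, Nat.reduceAdd] at hlen hc
    rw [Nat.add_assoc b] at s2
    obtain ⟨rb⟩ := hrl w S D _ hS hw s2
    exact ⟨⟨lam, ω, 3 + 2 ^ (lam + 1), hπ, hinj, hmlt, hle, hω, rb, by omega, hc 0 (by norm_num),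
      hc 1 (by norm_num), hc 2 (by norm_num), fun i hi => s1.tab hi⟩⟩

/-- The factor `4` leaves room for the four queries of a range. If the scale `f` was rejected and `2
* f` accepted, then four times the error is at most `4 * g * 2 ^ (4 * f) ≤ 2 ^ (6 * f) ≤ (2 ^ (f *
g)) ^ c ≤ k ^ c`, where `f₀ = 4 * g` gives `4 * g ≤ f ≤ 2 ^ (2 * f)`. -/
theorem exists_approx_params {c : ℝ} (hc0 : 0 < c) :
    ∃ g f₀ K : ℕ, 2 ≤ g ∧ 0 < f₀ ∧ ∀ k k' : ℕ, ApproxOutcome g f₀ K k k' →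
      4 * |(k' : ℝ) - k| ≤ (k : ℝ) ^ c := by
  set g := ⌈6 / c⌉₊ + 2 with hg
  have hgc : 6 ≤ (g : ℝ) * c := by
    have h1 : 6 / c ≤ (⌈6 / c⌉₊ : ℝ) := Nat.le_ceil _
    have h2 : 6 / c ≤ (g : ℝ) := by rw [hg]; push_cast; linarith
    rwa [div_le_iff₀ hc0] at h2
  -- Four times the error bound at the first scale; `K` is chosen such that `K ^ c ≥ B`.
  set B : ℝ := 4 * g * 2 ^ (2 * (4 * g)) with hB
  have hB0 : 0 ≤ B := by positivity
  set K := ⌈B ^ (1 / c)⌉₊ with hK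
  refine ⟨g, 4 * g, K, by omega, by omega, ?_⟩
  rintro k k' (rfl | ⟨hk, i, h1, h2, h3⟩)
  · simp; positivity
  · have habs : |(k' : ℝ) - k| ≤ g * 2 ^ (2 * (4 * g * 2 ^ i)) := by
      rw [abs_sub_comm, abs_of_nonneg (by simpa using h1)]
      have : (k : ℝ) ≤ k' + g * 2 ^ (2 * (4 * g * 2 ^ i)) := by exact_mod_cast h2
      linarith
    refine (mul_le_mul_of_nonneg_left habs (by norm_num)).trans ?_
    rcases h3 with rfl | h3
    · calc 4 * ((g : ℝ) * 2 ^ (2 * (4 * g * 2 ^ 0))) = B := by rw [hB]; simp; ring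
        _ = (B ^ (1 / c)) ^ c := by
          rw [← Real.rpow_mul hB0, one_div_mul_cancel hc0.ne', Real.rpow_one]
        _ ≤ (k : ℝ) ^ c := by
          refine Real.rpow_le_rpow (by positivity) ?_ hc0.le
          exact (Nat.le_ceil _).trans (by exact_mod_cast hk)
    -- For `i = 0` the truncated `i - 1` denotes no earlier scale, and the bound by `K` applies
    -- again.
    · rcases Nat.eq_zero_or_pos i with hi | hi
      · subst hi
        calc 4 * ((g : ℝ) * 2 ^ (2 * (4 * g * 2 ^ 0))) = B := by rw [hB]; simp; ring
          _ = (B ^ (1 / c)) ^ c := by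
            rw [← Real.rpow_mul hB0, one_div_mul_cancel hc0.ne', Real.rpow_one]
          _ ≤ (k : ℝ) ^ c := by
            refine Real.rpow_le_rpow (by positivity) ?_ hc0.le
            exact (Nat.le_ceil _).trans (by exact_mod_cast hk)
      · obtain ⟨j, rfl⟩ := Nat.exists_eq_succ_of_ne_zero hi.ne'
        set f := 4 * g * 2 ^ j with hfdef
        have e1 : 4 * g * 2 ^ (j + 1) = 2 * f := by rw [hfdef, pow_succ]; ring
        rw [Nat.succ_eq_add_one, e1]
        rw [Nat.succ_eq_add_one, Nat.add_sub_cancel] at h3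
        have h4 : 4 * g ≤ 2 ^ (2 * f) := by
          have h5 : 4 * g ≤ f := Nat.le_mul_of_pos_right _ (by positivity)
          exact h5.trans (Nat.lt_two_pow_self.le.trans (Nat.pow_le_pow_right (by norm_num) (by omega)))
        have h4' : (4 * g : ℝ) ≤ 2 ^ (2 * f) := by exact_mod_cast h4
        calc 4 * ((g : ℝ) * 2 ^ (2 * (2 * f))) = 4 * g * 2 ^ (4 * f) := by
              rw [← mul_assoc, ← mul_assoc]; norm_num
          _ ≤ 2 ^ (2 * f) * 2 ^ (4 * f) := mul_le_mul_of_nonneg_right h4' (by positivity)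
          _ = (2 : ℝ) ^ ((6 * f : ℕ) : ℝ) := by rw [Real.rpow_natCast, ← pow_add]; congr 1; ring
          _ ≤ (2 : ℝ) ^ (((f * g : ℕ) : ℝ) * c) := by
              refine Real.rpow_le_rpow_of_exponent_le (by norm_num) ?_
              push_cast
              nlinarith [Nat.cast_nonneg (α := ℝ) f]
          _ = ((2 : ℝ) ^ (f * g)) ^ c := by
              rw [Real.rpow_mul (by norm_num), Real.rpow_natCast]
          _ ≤ (k : ℝ) ^ c := by
              refine Real.rpow_le_rpow (by positivity) ?_ hc0.le
              exact_mod_cast h3.le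

theorem ApproxOutcome.le {g f₀ K k k' : ℕ} (h : ApproxOutcome g f₀ K k k') : k' ≤ k := by
  rcases h with rfl | ⟨-, i, h, -⟩
  · exact le_rfl
  · exact h

section Permutation

variable {α : Type*}

/-- Passing to ranks preserves comparisons with an arbitrary threshold, not only with keys that
occur. -/
theorem card_filter_lt_iff {Q : Finset α} {κ : α → ℕ} {p : α} (hp : p ∈ Q) (a : ℕ) :
    #{q ∈ Q | κ q < a} ≤ #{q ∈ Q | κ q < κ p} ↔ a ≤ κ p := by
  constructor
  · intro h
    by_contra hc
    refine absurd (card_lt_card (s := {q ∈ Q | κ q < κ p}) (t := {q ∈ Q | κ q < a})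
      ⟨fun q hq => ?_, fun hs => ?_⟩) (by omega)
    · rw [mem_filter] at hq ⊢; exact ⟨hq.1, by omega⟩
    · have := hs (mem_filter.2 ⟨hp, by omega⟩)
      rw [mem_filter] at this; omega
  · intro h
    refine card_le_card fun q hq => ?_
    rw [mem_filter] at hq ⊢; exact ⟨hq.1, by omega⟩

/-- Injective keys make the ranks a bijection onto `[0, #Q)`; then `π` sends the rank by `κ` to the
rank by `κ'`. -/
theorem exists_rank_permutation (Q : Finset α) {κ κ' : α → ℕ} (hκ : Set.InjOn κ Q)
    (hκ' : Set.InjOn κ' Q) :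
    ∃ π : ℕ → ℕ, (∀ x < #Q, π x < #Q) ∧ Set.InjOn π (Set.Iio #Q) ∧
      ∀ a b, strip π #{q ∈ Q | κ q < a} #Q #{q ∈ Q | κ' q < b} =
        #{q ∈ Q | a ≤ κ q ∧ b ≤ κ' q} := by
  classical
  have key : ∀ κ : α → ℕ, Set.InjOn κ Q → (∀ p ∈ Q, #{q ∈ Q | κ q < κ p} < #Q) ∧
      Set.InjOn (fun p => #{q ∈ Q | κ q < κ p}) Q := by
    intro κ hκ
    refine ⟨fun p hp => card_lt_card ⟨filter_subset _ _, fun h => ?_⟩, fun p hp p' hp' h => ?_⟩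
    · have := (mem_filter.1 (h hp)).2; omega
    · dsimp only at h
      have h1 := (card_filter_lt_iff (κ := κ) hp (κ p')).1 h.ge
      have h2 := (card_filter_lt_iff (κ := κ) hp' (κ p)).1 h.le
      exact hκ hp hp' (by omega)
  obtain ⟨hlt, hinj⟩ := key κ hκ
  obtain ⟨hlt', hinj'⟩ := key κ' hκ'
  set r : α → ℕ := fun p => #{q ∈ Q | κ q < κ p} with hr
  set r' : α → ℕ := fun p => #{q ∈ Q | κ' q < κ' p} with hr'
  have himg : Q.image r = range #Q := by
    apply eq_of_subset_of_card_le
    · intro i hi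
      obtain ⟨p, hp, rfl⟩ := mem_image.1 hi
      exact mem_range.2 (hlt p hp)
    · rw [card_image_of_injOn hinj, card_range]
  have hsurj : ∀ i < #Q, ∃ p ∈ Q, r p = i := fun i hi => by
    rw [← mem_range, ← himg, mem_image] at hi; exact hi
  let π : ℕ → ℕ := fun i => if h : i < #Q then r' (hsurj i h).choose else 0
  have hπ : ∀ p ∈ Q, π (r p) = r' p := by
    intro p hp
    have hi : r p < #Q := hlt p hp
    refine (dif_pos hi).trans (congrArg r' ?_)
    exact hinj (hsurj _ hi).choose_spec.1 hp (hsurj _ hi).choose_spec.2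
  refine ⟨π, fun x hx => ?_, fun x hx y hy hxy => ?_, fun a b => ?_⟩
  · obtain ⟨p, hp, rfl⟩ := hsurj x hx
    rw [hπ p hp]; exact hlt' p hp
  · obtain ⟨p, hp, rfl⟩ := hsurj x hx
    obtain ⟨q, hq, rfl⟩ := hsurj y hy
    rw [hπ p hp, hπ q hq] at hxy
    rw [hinj' hp hq hxy]
  · have : ({x ∈ Ico #{q ∈ Q | κ q < a} #Q | #{q ∈ Q | κ' q < b} ≤ π x} : Finset ℕ) =
        ({q ∈ Q | a ≤ κ q ∧ b ≤ κ' q} : Finset α).image r := by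
      ext x
      simp only [mem_filter, mem_Ico, mem_image]
      constructor
      · rintro ⟨⟨h1, h2⟩, h3⟩
        obtain ⟨p, hp, rfl⟩ := hsurj x h2
        rw [hπ p hp] at h3
        exact ⟨p, ⟨hp, (card_filter_lt_iff hp a).1 h1, (card_filter_lt_iff hp b).1 h3⟩, rfl⟩
      · rintro ⟨p, ⟨hp, h1, h2⟩, rfl⟩
        rw [hπ p hp]
        exact ⟨⟨(card_filter_lt_iff hp a).2 h1, hlt p hp⟩, (card_filter_lt_iff hp b).2 h2⟩
    rw [strip, this, card_image_of_injOn]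
    exact hinj.mono fun p hp => (mem_filter.1 hp).1

end Permutation

end WordRAM

/-! ### Families of point sets, with one dominance structure per class -/

namespace WordRAM

open Finset WordRAM.Expr

/-- The triples `(u, x, y)` with `u, x, y < W` in lexicographic order. -/
def key3 (W u x y : ℕ) : ℕ := (u * W + x) * W + y

theorem mul_add_lt_mul_add_iff {W a b c d : ℕ} (hb : b < W) (hd : d ≤ W) :
    a * W + b < c * W + d ↔ a < c ∨ (a = c ∧ b < d) := by
  rcases lt_trichotomy a c with h | h | h
  · have := Nat.mul_le_mul_right W h
    rw [Nat.succ_mul] at this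
    constructor
    · intro; exact Or.inl h
    · intro; omega
  · subst h; omega
  · have := Nat.mul_le_mul_right W h
    rw [Nat.succ_mul] at this
    constructor
    · intro; omega
    · rintro (h1 | h1) <;> omega

theorem key3_lt_iff {W u x y u' x' : ℕ} (hx : x < W) (hy : y < W) (hx' : x' ≤ W) :
    key3 W u x y < key3 W u' x' 0 ↔ u < u' ∨ (u = u' ∧ x < x') := by
  unfold key3
  rw [mul_add_lt_mul_add_iff hy (Nat.zero_le _), mul_add_lt_mul_add_iff hx hx']
  simp

theorem key3_inj {W u x y u' x' y' : ℕ} (hx : x < W) (hy : y < W) (hx' : x' < W) (hy' : y' < W)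
    (h : key3 W u x y = key3 W u' x' y') : u = u' ∧ x = x' ∧ y = y' := by
  obtain ⟨h1, h2⟩ := mul_add_inj hy hy' h
  obtain ⟨h3, h4⟩ := mul_add_inj hx hx' h1
  exact ⟨h3, h4, h2⟩

theorem rk_image {α : Type*} [DecidableEq α] {Q : Finset α} {κ : α → ℕ} (hκ : Set.InjOn κ Q)
    (q : ℕ) : rk (Q.image κ) q = #{p ∈ Q | κ p < q} := by
  rw [rk, filter_image, card_image_of_injOn]
  exact hκ.mono fun p hp => (mem_filter.1 hp).1

/-- The points of the family `Q` in the class `u`. -/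
def fiber (Q : Finset (ℕ × ℕ × ℕ)) (u : ℕ) : Finset (ℕ × ℕ × ℕ) := {p ∈ Q | p.1 = u}

/-- The number of points of the family in the classes below `u`. -/
def below (Q : Finset (ℕ × ℕ × ℕ)) (u : ℕ) : ℕ := #{p ∈ Q | p.1 < u}

theorem below_succ (Q : Finset (ℕ × ℕ × ℕ)) (u : ℕ) : below Q (u + 1) = below Q u + #(fiber Q u) := by
  unfold below fiber
  rw [← card_union_of_disjoint]
  · congr 1
    ext p
    simp only [mem_union, mem_filter]
    constructor
    · rintro ⟨h1, h2⟩
      rcases Nat.lt_succ_iff_lt_or_eq.1 h2 with h | h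
      · exact Or.inl ⟨h1, h⟩
      · exact Or.inr ⟨h1, h⟩
    · rintro (⟨h1, h2⟩ | ⟨h1, h2⟩) <;> exact ⟨h1, by omega⟩
  · rw [disjoint_left]
    intro p h1 h2
    have := (mem_filter.1 h1).2
    have := (mem_filter.1 h2).2
    omega

theorem below_eq_sum (Q : Finset (ℕ × ℕ × ℕ)) (u : ℕ) :
    below Q u = ∑ i ∈ range u, #(fiber Q i) := by
  induction u with
  | zero => simp [below]
  | succ u ih => rw [below_succ, sum_range_succ, ih]

/-- The points by class, then by the first coordinate. -/
def keyX (W : ℕ) (p : ℕ × ℕ × ℕ) : ℕ := key3 W p.1 p.2.1 p.2.2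

/-- The points by class, then by the second coordinate. -/
def keyY (W : ℕ) (p : ℕ × ℕ × ℕ) : ℕ := key3 W p.1 p.2.2 p.2.1

/-- All coordinates of the family are below `W`. -/
def Bounded (Q : Finset (ℕ × ℕ × ℕ)) (W : ℕ) : Prop :=
  ∀ p ∈ Q, p.1 < W ∧ p.2.1 < W ∧ p.2.2 < W

theorem keyX_injOn {Q : Finset (ℕ × ℕ × ℕ)} {W : ℕ} (hQ : Bounded Q W) :
    Set.InjOn (keyX W) Q := by
  rintro ⟨u, x, y⟩ hp ⟨u', x', y'⟩ hp' h
  have h1 := hQ _ hp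
  have h2 := hQ _ hp'
  obtain ⟨rfl, rfl, rfl⟩ := key3_inj h1.2.1 h1.2.2 h2.2.1 h2.2.2 h
  rfl

theorem keyY_injOn {Q : Finset (ℕ × ℕ × ℕ)} {W : ℕ} (hQ : Bounded Q W) :
    Set.InjOn (keyY W) Q := by
  rintro ⟨u, x, y⟩ hp ⟨u', x', y'⟩ hp' h
  have h1 := hQ _ hp
  have h2 := hQ _ hp'
  obtain ⟨rfl, rfl, rfl⟩ := key3_inj h1.2.2 h1.2.1 h2.2.2 h2.2.1 h
  rfl

/-- In an order that sorts by class first, a threshold within class `u` is above all earlier classes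
and above nothing of the later ones. Subtracting `below Q u` thus turns a global rank into a rank
within the class. -/
theorem card_key_lt {Q : Finset (ℕ × ℕ × ℕ)} {κ : ℕ × ℕ × ℕ → ℕ} {k u : ℕ}
    (h : ∀ p ∈ Q, (p.1 < u → κ p < k) ∧ (u < p.1 → k ≤ κ p)) :
    #{p ∈ Q | κ p < k} = below Q u + #{p ∈ fiber Q u | κ p < k} := by
  unfold below fiber
  rw [filter_filter, ← card_union_of_disjoint]
  · congr 1
    ext p
    simp only [mem_union, mem_filter]
    constructor
    · rintro ⟨h1, h2⟩
      have h3 := h p h1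
      rcases lt_trichotomy p.1 u with h4 | h4 | h4
      · exact Or.inl ⟨h1, h4⟩
      · exact Or.inr ⟨h1, h4, h2⟩
      · have := h3.2 h4; omega
    · rintro (⟨h1, h2⟩ | ⟨h1, h2, h3⟩)
      · exact ⟨h1, (h p h1).1 h2⟩
      · exact ⟨h1, h3⟩
  · rw [disjoint_left]
    intro p h1 h2
    have := (mem_filter.1 h1).2
    have := (mem_filter.1 h2).2.1
    omega

theorem rk_keyX {Q : Finset (ℕ × ℕ × ℕ)} {W : ℕ} (hQ : Bounded Q W) {u x : ℕ} (hx : x ≤ W) :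
    rk (Q.image (keyX W)) (key3 W u x 0) =
      below Q u + #{p ∈ fiber Q u | keyX W p < key3 W u x 0} := by
  rw [rk_image (keyX_injOn hQ), card_key_lt]
  intro p hp
  have h1 := hQ p hp
  have h2 : keyX W p < key3 W u x 0 ↔ _ := key3_lt_iff h1.2.1 h1.2.2 hx
  exact ⟨fun h => h2.2 (Or.inl h), fun h => not_lt.1 fun h3 => by rcases h2.1 h3 with h | h <;> omega⟩

theorem rk_keyY {Q : Finset (ℕ × ℕ × ℕ)} {W : ℕ} (hQ : Bounded Q W) {u y : ℕ} (hy : y ≤ W) :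
    rk (Q.image (keyY W)) (key3 W u y 0) =
      below Q u + #{p ∈ fiber Q u | keyY W p < key3 W u y 0} := by
  rw [rk_image (keyY_injOn hQ), card_key_lt]
  intro p hp
  have h1 := hQ p hp
  have h2 : keyY W p < key3 W u y 0 ↔ _ := key3_lt_iff h1.2.2 h1.2.1 hy
  exact ⟨fun h => h2.2 (Or.inl h), fun h => not_lt.1 fun h3 => by rcases h2.1 h3 with h | h <;> omega⟩

theorem rk_keyX_zero {Q : Finset (ℕ × ℕ × ℕ)} {W : ℕ} (hQ : Bounded Q W) (u : ℕ) :
    rk (Q.image (keyX W)) (key3 W u 0 0) = below Q u := by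
  rw [rk_keyX hQ (Nat.zero_le _), Nat.add_eq_left, card_eq_zero, filter_eq_empty_iff]
  intro p hp
  obtain ⟨hpQ, rfl⟩ := mem_filter.1 hp
  have h1 := hQ p hpQ
  have h2 : keyX W p < key3 W p.1 0 0 ↔ _ := key3_lt_iff h1.2.1 h1.2.2 (Nat.zero_le _)
  rw [h2]; omega

/-- The number of points of class `u` that dominate `(x, y)`. -/
def classCount (Q : Finset (ℕ × ℕ × ℕ)) (u x y : ℕ) : ℕ :=
  #{p ∈ Q | p.1 = u ∧ x ≤ p.2.1 ∧ y ≤ p.2.2}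

theorem card_fiber_dominating {Q : Finset (ℕ × ℕ × ℕ)} {W : ℕ} (hQ : Bounded Q W) {u x y : ℕ}
    (hx : x ≤ W) (hy : y ≤ W) :
    #{p ∈ fiber Q u | key3 W u x 0 ≤ keyX W p ∧ key3 W u y 0 ≤ keyY W p} = classCount Q u x y := by
  unfold fiber classCount
  rw [filter_filter]
  congr 1
  refine filter_congr fun p hp => and_congr_right ?_
  rintro rfl
  have h1 := hQ p hp
  have h2 : keyX W p < key3 W p.1 x 0 ↔ _ := key3_lt_iff h1.2.1 h1.2.2 hx
  have h3 : keyY W p < key3 W p.1 y 0 ↔ _ := key3_lt_iff h1.2.2 h1.2.1 hy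
  rw [← not_lt, ← not_lt, h2, h3]
  omega

theorem card_le_of_bounded {Q : Finset (ℕ × ℕ × ℕ)} {Λ : ℕ} (hQ : Bounded Q (2 ^ Λ)) :
    #Q ≤ 2 ^ (3 * Λ) := by
  have : Q ⊆ range (2 ^ Λ) ×ˢ range (2 ^ Λ) ×ˢ range (2 ^ Λ) := by
    intro p hp
    simp only [mem_product, mem_range]
    exact hQ p hp
  refine (card_le_card this).trans_eq ?_
  simp only [card_product, card_range]
  ring

/-- The approximate number of points of class `151` that dominate the point `(152, 153)`, computed
into register `154` from the structure at the address in register `150`. -/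
def familyQuery (g f₀ K : ℕ) : Prog :=
  .seq (asgs [(155, ld (var 150)), (156, var 150 + ld (var 150 + lit 1)),
    (157, var 150 + ld (var 150 + lit 2)), (158, var 150 + ld (var 150 + lit 3)),
    (161, var 151 * var 155 * var 155), (50, var 156), (51, var 161)]) <|
  .seq rank <|
  .seq (asgs [(159, var 52), (50, var 156), (51, var 161 + var 155 * var 155)]) <|
  .seq rank <|
  .seq (asg 160 (var 52 - var 159)) <|
  .branch .eq (.reg 160) (.imm 0) (asg 154 (lit 0)) <|
  .seq (asgs [(50, var 156), (51, (var 151 * var 155 + var 152) * var 155)]) <|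
  .seq rank <|
  .seq (asgs [(162, var 52 - var 159), (50, var 157),
    (51, (var 151 * var 155 + var 153) * var 155)]) <|
  .seq rank <|
  .seq (asgs [(102, var 52 - var 159), (101, var 162),
    (100, var 158 + var 159 * lit (1000 * (f₀ + g + K + 1)))]) <|
  .seq (dominance g f₀ K) (asg 154 (var 103))

/-- The memory at address `b` holds a structure for dominance queries in the classes of `Q`. -/
structure FamilyBlock {w S : ℕ} (D : Fin S → BitVec w) (b g f₀ K : ℕ) (Q : Finset (ℕ × ℕ × ℕ))
    (Λ : ℕ) where
  bounded : Bounded Q (2 ^ Λ)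
  oX : ℕ
  oY : ℕ
  oB : ℕ
  rankX : RankBlock D (b + oX) (Q.image (keyX (2 ^ Λ))) (3 * Λ + 1)
  rankY : RankBlock D (b + oY) (Q.image (keyY (2 ^ Λ))) (3 * Λ + 1)
  hdr : b + 3 < S
  cell_W : cell D b = 2 ^ Λ
  cell_oX : cell D (b + 1) = oX
  cell_oY : cell D (b + 2) = oY
  cell_oB : cell D (b + 3) = oB
  blocks : ∀ u < 2 ^ Λ, 0 < #(fiber Q u) → ∃ π : ℕ → ℕ,
    (∀ a b, strip π #{p ∈ fiber Q u | keyX (2 ^ Λ) p < a} #(fiber Q u)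
      #{p ∈ fiber Q u | keyY (2 ^ Λ) p < b} =
        #{p ∈ fiber Q u | a ≤ keyX (2 ^ Λ) p ∧ b ≤ keyY (2 ^ Λ) p}) ∧
    Nonempty (DomBlock D (b + oB + below Q u * (1000 * (f₀ + g + K + 1))) g f₀ K π #(fiber Q u))

/-- The constant in the time of a query. -/
def familyTime (g f₀ K : ℕ) : ℕ := 20000 + (g + 2) * 3000 * (4 * (f₀ + g + K) + 30)

theorem log_mul_two_pow {n : ℕ} (hn : 0 < n) (k : ℕ) :
    Nat.log 2 (n * 2 ^ k) = Nat.log 2 n + k := by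
  induction k with
  | zero => simp
  | succ k ih =>
    rw [pow_succ, ← Nat.mul_assoc, Nat.log_mul_base (by norm_num) (by positivity), ih, Nat.add_assoc]

/-- A constant factor in the key length is an additive constant in its logarithm. -/
theorem dominance_time_le (g : ℕ) {n k l : ℕ} (hn : 0 < n) (h : l ≤ n * (k + 25)) :
    (g + 2) * 3000 * (Nat.log 2 l + 1) ≤ (g + 2) * 3000 * ((k + 30) * (Nat.log 2 n + 1)) := by
  have h1 : Nat.log 2 l ≤ Nat.log 2 n + (k + 25) := by
    rw [← log_mul_two_pow hn]
    exact Nat.log_mono_right (h.trans (Nat.mul_le_mul_left _ Nat.lt_two_pow_self.le))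
  refine Nat.mul_le_mul_left _ ?_
  rw [Nat.mul_succ]
  have : Nat.log 2 n ≤ (k + 30) * Nat.log 2 n := Nat.le_mul_of_pos_left _ (by omega)
  omega

set_option maxHeartbeats 1000000 in
theorem wp_familyQuery {w S : ℕ} {D : Fin S → BitVec w} {b g f₀ K : ℕ}
    {Q : Finset (ℕ × ℕ × ℕ)} {Λ : ℕ} (H : FamilyBlock D b g f₀ K Q Λ) (hΛ : 0 < Λ) (hg : 2 ≤ g)
    (hf : 0 < f₀) {u x y : ℕ} (hu : u < 2 ^ Λ) (hx : x ≤ 2 ^ Λ) (hy : y ≤ 2 ^ Λ) {ρ : ℕ → ℕ}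
    (h150 : ρ 150 = b) (h151 : ρ 151 = u) (h152 : ρ 152 = x) (h153 : ρ 153 = y) :
    WP D (familyQuery g f₀ K) ρ fun t ρ' => t ≤ familyTime g f₀ K * (Nat.log 2 Λ + 1) ∧
      ApproxOutcome g f₀ K (classCount Q u x y) (ρ' 154) ∧ ∀ r, 170 ≤ r → ρ' r = ρ r := by
  have hQ := H.bounded
  have hhdr := H.hdr
  have hS := H.rankX.table.le_pow
  have hRX := H.rankX
  have hRY := H.rankY
  have hlogL : Nat.log 2 (3 * Λ + 1) ≤ Nat.log 2 Λ + 2 := by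
    rw [← log_mul_two_pow hΛ]
    exact Nat.log_mono_right (by omega)
  have hcube : 2 ^ (3 * Λ) = 2 ^ Λ * 2 ^ Λ * 2 ^ Λ := by ring
  have hQw : #Q < 2 ^ w := by
    refine (card_le_of_bounded hQ).trans_lt (Nat.pow_lt_pow_right (by norm_num) ?_)
    have := hRX.lt_w; omega
  have hblocks := H.blocks u hu
  have hcW := H.cell_W
  have hle : #(fiber Q u) ≤ 2 ^ (3 * Λ) := (card_filter_le _ _).trans (card_le_of_bounded hQ)
  have hfQ : #(fiber Q u) ≤ #Q := card_filter_le _ _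
  set W := 2 ^ Λ with hW
  have hkey : ∀ v ≤ W, key3 W u v 0 < 2 ^ (3 * Λ + 1) := by
    intro v hv
    have h1 : (u + 1) * W ≤ W * W := Nat.mul_le_mul_right _ hu
    rw [Nat.add_mul, Nat.one_mul] at h1
    have h2 := Nat.mul_le_mul_right W (show u * W + v ≤ W * W by omega)
    have h3 : 0 < W * W * W := by positivity
    rw [pow_succ, hcube, key3]; omega
  have hkey' : key3 W (u + 1) 0 0 < 2 ^ (3 * Λ + 1) := by
    have h1 : (u + 1) * W ≤ W * W := Nat.mul_le_mul_right _ hu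
    have h2 := Nat.mul_le_mul_right W h1
    have h3 : 0 < W * W * W := by positivity
    rw [pow_succ, hcube, key3, Nat.add_zero, Nat.add_zero]; omega
  unfold familyQuery
  refine WP.seq (WP.asgs_of (fun ρ' => ρ' 50 = b + H.oX ∧ ρ' 51 = key3 W u 0 0 ∧
    ρ' 155 = W ∧ ρ' 156 = b + H.oX ∧ ρ' 157 = b + H.oY ∧ ρ' 158 = b + H.oB ∧
    ρ' 161 = key3 W u 0 0 ∧ ρ' 151 = u ∧ ρ' 152 = x ∧ ρ' 153 = y ∧
    ∀ r, 170 ≤ r → ρ' r = ρ r) ?_ ⟨?_, ?_, ?_, ?_, ?_, ?_, ?_, ?_, ?_, ?_,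
      fun r hr => runAsgs_of_le 170 rfl hr⟩ ?_)
  · simp [h150]; omega
  · simp [h150, H.cell_oX]
  · simp [h150, h151, hcW, key3]
  · simp [h150, hcW]
  · simp [h150, H.cell_oX]
  · simp [h150, H.cell_oY]
  · simp [h150, H.cell_oB]
  · simp [h150, h151, hcW, key3]
  · simp [h151]
  · simp [h152]
  · simp [h153]
  rintro ρ1 ⟨a50, a51, a155, a156, a157, a158, a161, a151, a152, a153, ar⟩
  refine WP.seq ((wp_rank hRX (hkey 0 (Nat.zero_le _)) a50 a51).mono ?_)
  rintro t1 ρ2 ⟨ht1, b52, br⟩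
  rw [rk_keyX_zero hQ] at b52
  refine WP.seq (WP.asgs_of (fun ρ' => ρ' 50 = b + H.oX ∧ ρ' 51 = key3 W (u + 1) 0 0 ∧
    ρ' 159 = below Q u ∧ ∀ r, 100 ≤ r → r ≠ 159 → ρ' r = ρ1 r) ?_ ⟨?_, ?_, ?_, fun r hr hr' => ?_⟩ ?_)
  · simp
  · simp [br, a156]
  · simp [br, a161, a155, key3]; ring
  · simp [b52]
  · simp only [runAsgs]
    rw [Function.update_of_ne (by omega), Function.update_of_ne (by omega),
      Function.update_of_ne (by omega), br r (by omega)]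
  rintro ρ3 ⟨c50, c51, c159, cr⟩
  refine WP.seq ((wp_rank hRX hkey' c50 c51).mono ?_)
  rintro t2 ρ4 ⟨ht2, d52, dr⟩
  rw [rk_keyX_zero hQ, below_succ] at d52
  have dr' : ∀ r, 100 ≤ r → r ≠ 159 → ρ4 r = ρ1 r := fun r hr hr' =>
    (dr r (by omega)).trans (cr r hr hr')
  have d159 : ρ4 159 = below Q u := (dr 159 (by norm_num)).trans c159
  refine WP.seq (WP.asg (by norm_num) ?_ ?_)
  · simp [d52, d159]
  have hval : (var 52 - var 159).eval D ρ4 = #(fiber Q u) := by simp [d52, d159]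
  rw [hval]
  -- Register `160` holds the size of the class, a difference of the ranks at which two consecutive
  -- classes begin. An empty class has no block and must be caught here.
  refine WP.branch ⟨by norm_num, ?_⟩ ⟨trivial, by simp [Operand.nat]⟩ ?_ ?_
  · simp only [Operand.nat, Function.update_self]; omega
  · intro hc
    simp only [Cmp.nat, Operand.nat, Function.update_self] at hc
    refine WP.asg (by norm_num) trivial ⟨?_, ?_, fun r hr => ?_⟩
    · have h1 : familyTime g f₀ K * (Nat.log 2 Λ + 1) ≥ 20000 * (Nat.log 2 Λ + 1) :=
        Nat.mul_le_mul_right _ (by unfold familyTime; omega)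
      simp; omega
    · left
      rw [← card_fiber_dominating hQ hx hy, card_eq_zero.1 hc]
      simp
    · rw [Function.update_of_ne (by omega), Function.update_of_ne (by omega), dr' r (by omega)
        (by omega), ar r hr]
  · intro hc
    simp only [Cmp.nat, Operand.nat, Function.update_self] at hc
    obtain ⟨π, hπ, ⟨HD⟩⟩ := hblocks (Nat.pos_of_ne_zero hc)
    refine WP.seq (WP.asgs_of (fun ρ' => ρ' 50 = b + H.oX ∧ ρ' 51 = key3 W u x 0 ∧
      ρ' 159 = below Q u ∧ ∀ r, 100 ≤ r → r ≠ 159 → r ≠ 160 → ρ' r = ρ1 r) ?_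
      ⟨?_, ?_, ?_, fun r hr hr' hr'' => ?_⟩ ?_)
    · simp
    · simp [dr', a156]
    · simp [dr', a151, a152, a155, key3]
    · simp [d159]
    · simp only [runAsgs]
      rw [Function.update_of_ne (by omega), Function.update_of_ne (by omega),
        Function.update_of_ne (by omega), dr' r (by omega) (by omega)]
    rintro ρ5 ⟨e50, e51, e159, er⟩
    refine WP.seq ((wp_rank hRX (hkey x hx) e50 e51).mono ?_)
    rintro t3 ρ6 ⟨ht3, f52, fr⟩
    rw [rk_keyX hQ hx] at f52
    have fr' : ∀ r, 100 ≤ r → r ≠ 159 → r ≠ 160 → ρ6 r = ρ1 r := fun r hr hr' hr'' =>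
      (fr r (by omega)).trans (er r hr hr' hr'')
    have f159 : ρ6 159 = below Q u := (fr 159 (by norm_num)).trans e159
    refine WP.seq (WP.asgs_of (fun ρ' => ρ' 50 = b + H.oY ∧ ρ' 51 = key3 W u y 0 ∧
      ρ' 159 = below Q u ∧ ρ' 162 = #{p ∈ fiber Q u | keyX W p < key3 W u x 0} ∧
      ∀ r, 100 ≤ r → r ≠ 159 → r ≠ 160 → r ≠ 162 → ρ' r = ρ1 r) ?_
      ⟨?_, ?_, ?_, ?_, fun r hr hr' hr'' h => ?_⟩ ?_)
    · simp [f52, f159]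
    · simp [fr', a157]
    · simp [fr', a151, a153, a155, key3]
    · simp [f159]
    · simp [f52, f159]
    · simp only [runAsgs]
      rw [Function.update_of_ne (by omega), Function.update_of_ne (by omega),
        Function.update_of_ne (by omega), fr' r (by omega) (by omega) (by omega)]
    rintro ρ7 ⟨g50, g51, g159, g162, gr⟩
    refine WP.seq ((wp_rank hRY (hkey y hy) g50 g51).mono ?_)
    rintro t4 ρ8 ⟨ht4, h52, hr⟩
    rw [rk_keyY hQ hy] at h52
    refine WP.seq (WP.asgs_of (fun ρ' =>
      ρ' 100 = b + H.oB + below Q u * (1000 * (f₀ + g + K + 1)) ∧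
      ρ' 101 = #{p ∈ fiber Q u | keyX W p < key3 W u x 0} ∧
      ρ' 102 = #{p ∈ fiber Q u | keyY W p < key3 W u y 0} ∧
      ∀ r, 170 ≤ r → ρ' r = ρ r) ?_ ⟨?_, ?_, ?_, fun r hr' => ?_⟩ ?_)
    · simp [h52, hr, g159]
    · simp [hr, gr, g159, a158]
    · simp [hr, g162]
    · simp [h52, hr, g159]
    · simp only [runAsgs]
      rw [Function.update_of_ne (by omega), Function.update_of_ne (by omega),
        Function.update_of_ne (by omega), hr r (by omega), gr r (by omega) (by omega) (by omega)
          (by omega), ar r hr']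
    rintro ρ9 ⟨k100, k101, k102, kr⟩
    refine WP.seq ((wp_dominance HD hg hf (Nat.pos_of_ne_zero hc) (card_filter_le _ _)
      (card_filter_le _ _) k100 k101 k102).mono ?_)
    rintro t5 ρ10 ⟨ht5, l103, lr⟩
    rw [hπ, card_fiber_dominating hQ hx hy] at l103
    refine WP.asg (by norm_num) (by simp) ⟨?_, by simpa using l103, fun r hr => ?_⟩
    · have hω := HD.ω_eq
      -- A class has at most `2 ^ (3 * Λ)` points, so the dominance query also runs in time `O(log
      -- Λ)`.
      have hlam : HD.lam ≤ 3 * Λ + 1 := by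
        have h1 := HD.le_m
        have h2 : 2 ^ HD.lam ≤ 2 ^ (3 * Λ + 1) := by rw [pow_succ 2 (3 * Λ)]; omega
        exact (Nat.pow_le_pow_iff_right (by norm_num)).1 h2
      have h5 := dominance_time_le g hΛ (show 4 * HD.ω + 1 ≤ Λ * (4 * (f₀ + g + K) + 25) by
        have h6 : Λ * (4 * (f₀ + g + K) + 25) = Λ * (4 * (f₀ + g + K)) + Λ * 25 :=
          Nat.mul_add _ _ _
        rw [hω, h6]
        have : 4 * (f₀ + g + K) ≤ Λ * (4 * (f₀ + g + K)) := Nat.le_mul_of_pos_left _ hΛ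
        omega)
      unfold familyTime
      rw [Nat.add_mul, Nat.mul_assoc ((g + 2) * 3000)]
      simp
      omega
    · rw [Function.update_of_ne (by omega), lr r (by omega), kr r hr]

end WordRAM

/-! ### Memory layout of a family, and queries on a concrete memory -/

namespace WordRAM

open Finset WordRAM.Expr

theorem Stored.flatMap_range {w S : ℕ} {D : Fin S → BitVec w} {b : ℕ} {F : ℕ → List ℕ} {n : ℕ}
    (h : Stored D b ((List.range n).flatMap F)) {u : ℕ} (hu : u < n) :
    Stored D (b + ∑ i ∈ range u, (F i).length) (F u) := by
  induction n with
  | zero => omega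
  | succ n ih =>
    rw [List.range_succ, List.flatMap_append, stored_append] at h
    rcases Nat.lt_succ_iff_lt_or_eq.1 hu with h1 | rfl
    · exact ih h.1 h1
    · have h2 := h.2
      simp only [List.flatMap_cons, List.flatMap_nil, List.append_nil] at h2
      convert h2 using 2
      clear h h2 ih hu
      induction u with
      | zero => simp
      | succ u ih => rw [sum_range_succ, ih, List.range_succ, List.flatMap_append]; simp

theorem length_flatMap_range (F : ℕ → List ℕ) (n : ℕ) :
    ((List.range n).flatMap F).length = ∑ i ∈ range n, (F i).length := by
  induction n with
  | zero => simp
  | succ n ih => rw [sum_range_succ, ← ih, List.range_succ, List.flatMap_append]; simp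

/-- Zeros pad the block to an exact multiple of the size of the class. The address of a block is
then computed from `below Q u`, and no table of pointers is needed for the possibly very many empty
classes. -/
theorem exists_classList {g f₀ K : ℕ} (hf : 0 < f₀) {Q : Finset (ℕ × ℕ × ℕ)} {Λ : ℕ}
    (hQ : Bounded Q (2 ^ Λ)) (u : ℕ) :
    ∃ l : List ℕ, l.length = #(fiber Q u) * (1000 * (f₀ + g + K + 1)) ∧
      (∀ x ∈ l, x < 2 ^ (8 * (3 * Λ + f₀ + g + K + 3) + 12)) ∧
      (0 < #(fiber Q u) → ∃ π : ℕ → ℕ,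
        (∀ a b, strip π #{p ∈ fiber Q u | keyX (2 ^ Λ) p < a} #(fiber Q u)
          #{p ∈ fiber Q u | keyY (2 ^ Λ) p < b} =
            #{p ∈ fiber Q u | a ≤ keyX (2 ^ Λ) p ∧ b ≤ keyY (2 ^ Λ) p}) ∧
        ∀ (w S : ℕ) (D : Fin S → BitVec w) (b : ℕ), S ≤ 2 ^ w →
          8 * (3 * Λ + f₀ + g + K + 3) + 12 ≤ w → Stored D b l →
          Nonempty (DomBlock D b g f₀ K π #(fiber Q u))) := by
  have hsub : fiber Q u ⊆ Q := filter_subset _ _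
  have hlog : Nat.log 2 #(fiber Q u) ≤ 3 * Λ := by
    refine (Nat.log_mono_right ((card_le_card hsub).trans (card_le_of_bounded hQ))).trans_eq ?_
    exact Nat.log_pow (by norm_num) _
  rcases Nat.eq_zero_or_pos #(fiber Q u) with h0 | h0
  · exact ⟨[], by simp [h0], by simp, fun h => by omega⟩
  · obtain ⟨π, h1, h2, h3⟩ := exists_rank_permutation (fiber Q u)
      ((keyX_injOn hQ).mono hsub) ((keyY_injOn hQ).mono hsub)
    obtain ⟨l, h4, h5, h6⟩ := exists_domBlock (g := g) (K := K) hf h0 h1 h2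
    refine ⟨l ++ List.replicate (#(fiber Q u) * (1000 * (f₀ + g + K + 1)) - l.length) 0, ?_, ?_,
      fun _ => ⟨π, h3, fun w S D b hS hw hD => h6 w S D b hS (by omega) (stored_append.1 hD).1⟩⟩
    · rw [List.length_append, List.length_replicate]
      rw [Nat.mul_comm] at h4
      omega
    · intro x hx
      rcases List.mem_append.1 hx with h | h
      · exact (h5 x h).trans_le (Nat.pow_le_pow_right (by norm_num) (by omega))
      · rw [List.eq_of_mem_replicate h]; positivity

theorem exists_familyBlock {g f₀ K : ℕ} (hf : 0 < f₀) {Q : Finset (ℕ × ℕ × ℕ)} {Λ : ℕ}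
    (hQ : Bounded Q (2 ^ Λ)) :
    ∃ l : List ℕ, l.length ≤ 2000 * (f₀ + g + K + 1) * (#Q + Λ + 1) ∧
      (∀ x ∈ l, x < 2 ^ (8 * (3 * Λ + f₀ + g + K + 3) + 12)) ∧
      ∀ (w S : ℕ) (D : Fin S → BitVec w) (b : ℕ), S ≤ 2 ^ w →
        8 * (3 * Λ + f₀ + g + K + 3) + 12 ≤ w → Stored D b l →
        Nonempty (FamilyBlock D b g f₀ K Q Λ) := by
  have hQc := card_le_of_bounded hQ
  have hpow : #Q ≤ 2 ^ (3 * Λ + 1) := hQc.trans (Nat.pow_le_pow_right (by norm_num) (by omega))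
  obtain ⟨lX, hX1, hX2, hX3⟩ := exists_rankBlock (Q.image (keyX (2 ^ Λ))) (L := 3 * Λ + 1)
    (by omega) (card_image_le.trans hpow)
  obtain ⟨lY, hY1, hY2, hY3⟩ := exists_rankBlock (Q.image (keyY (2 ^ Λ))) (L := 3 * Λ + 1)
    (by omega) (card_image_le.trans hpow)
  choose F hF1 hF2 hF3 using exists_classList (g := g) (K := K) hf hQ
  have hX0 : #(Q.image (keyX (2 ^ Λ))) ≤ #Q := card_image_le
  have hY0 : #(Q.image (keyY (2 ^ Λ))) ≤ #Q := card_image_le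
  have hsum : ∀ u, ∑ i ∈ range u, (F i).length = below Q u * (1000 * (f₀ + g + K + 1)) := by
    intro u
    rw [below_eq_sum, sum_mul]
    exact sum_congr rfl fun i _ => hF1 i
  have hbig : ∀ x, x ≤ 4 + lX.length + lY.length →
      x < 2 ^ (8 * (3 * Λ + f₀ + g + K + 3) + 12) := by
    intro x hx
    have h1 : 3 * Λ < 2 ^ (3 * Λ) := Nat.lt_two_pow_self
    have h2 : 2 ^ (3 * Λ + 8) ≤ 2 ^ (8 * (3 * Λ + f₀ + g + K + 3) + 12) :=
      Nat.pow_le_pow_right (by norm_num) (by omega)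
    rw [Nat.pow_add] at h2
    omega
  refine ⟨[2 ^ Λ, 4, 4 + lX.length, 4 + lX.length + lY.length] ++
    (lX ++ (lY ++ (List.range (2 ^ Λ)).flatMap F)), ?_, ?_, ?_⟩
  · simp only [List.length_append, length_flatMap_range, hsum]
    have h1 : below Q (2 ^ Λ) ≤ #Q := card_filter_le _ _
    have h2 := Nat.mul_le_mul_right (1000 * (f₀ + g + K + 1)) h1
    have h3 : 2000 * (f₀ + g + K + 1) * (#Q + Λ + 1) =
      2 * (#Q * (1000 * (f₀ + g + K + 1))) + 2 * ((Λ + 1) * (1000 * (f₀ + g + K + 1))) := by ring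
    have h4 : (Λ + 1) * 1000 ≤ (Λ + 1) * (1000 * (f₀ + g + K + 1)) :=
      Nat.mul_le_mul_left _ (Nat.le_mul_of_pos_right _ (by omega))
    have h5 : #Q * 1000 ≤ #Q * (1000 * (f₀ + g + K + 1)) :=
      Nat.mul_le_mul_left _ (Nat.le_mul_of_pos_right _ (by omega))
    simp only [List.length_cons, List.length_nil]
    omega
  · intro x hx
    have hmono : 2 ^ (2 * (3 * Λ + 1) + 10) ≤ 2 ^ (8 * (3 * Λ + f₀ + g + K + 3) + 12) :=
      Nat.pow_le_pow_right (by norm_num) (by omega)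
    simp only [List.mem_append, List.mem_flatMap, List.mem_cons, List.not_mem_nil, or_false] at hx
    rcases hx with (rfl | rfl | rfl | rfl) | hx | hx | ⟨u, -, hx⟩
    · exact Nat.pow_lt_pow_right (by norm_num) (by omega)
    · exact hbig _ (by omega)
    · exact hbig _ (by omega)
    · exact hbig _ le_rfl
    · exact (hX2 x hx).trans_le hmono
    · exact (hY2 x hx).trans_le hmono
    · exact hF2 u x hx
  · intro w S D b hS hw hD
    rw [stored_append, stored_append, stored_append] at hD
    obtain ⟨hH, hDX, hDY, hDB⟩ := hD
    have hH1 := hH.1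
    simp only [List.length_cons, List.length_nil] at hDX hDY hDB hH1
    obtain ⟨bX⟩ := hX3 w S D (b + 4) hS (by omega) hDX
    obtain ⟨bY⟩ := hY3 w S D (b + (4 + lX.length)) hS (by omega) (by rwa [← Nat.add_assoc])
    refine ⟨⟨hQ, 4, 4 + lX.length, 4 + lX.length + lY.length, bX, bY, by omega, ?_, ?_, ?_, ?_, ?_⟩⟩
    · simpa using hH.2 0 (by simp)
    · simpa using hH.2 1 (by simp)
    · simpa using hH.2 2 (by simp)
    · simpa using hH.2 3 (by simp)
    · intro u hu hpos
      obtain ⟨π, h1, h2⟩ := hF3 u hpos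
      refine ⟨π, h1, h2 w S D _ hS hw ?_⟩
      have := hDB.flatMap_range hu
      rwa [hsum, show b + (0 + 1 + 1 + 1 + 1) + lX.length + lY.length =
        b + (4 + lX.length + lY.length) by omega] at this

/-- The memory with the content `l`. -/
def memOf (w : ℕ) (l : List ℕ) : Fin l.length → BitVec w := fun i => BitVec.ofNat w (l.getD i 0)

theorem stored_memOf {w : ℕ} {l : List ℕ} (h : ∀ x ∈ l, x < 2 ^ w) : Stored (memOf w l) 0 l := by
  refine ⟨by omega, fun i hi => ?_⟩
  rw [Nat.zero_add, cell, dif_pos hi, memOf, BitVec.toNat_ofNat, Nat.mod_eq_of_lt]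
  simp only [List.getD_eq_getElem?_getD, List.getElem?_eq_getElem hi, Option.getD_some]
  exact h _ (List.getElem_mem hi)

/-- The bound `hP` ensures that the word in register `0` is the number itself and not merely its
residue. -/
theorem exists_answers {w S : ℕ} {D : Fin S → BitVec w} {p : Prog} {args : List ℕ} {T : ℕ}
    {P : ℕ → Prop} (hP : ∀ k, P k → k < 2 ^ w)
    (h : WP D p (fun r => args.getD r 0) fun t ρ' => t ≤ T ∧ P (ρ' 0)) :
    ∃ k, Answers p D args T k ∧ P k := by
  obtain ⟨t, s, ρ', h1, ⟨h2, h3⟩, h4, h5⟩ := h (start D args) ⟨rfl, fun r _ => rfl⟩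
  refine ⟨ρ' 0, ⟨t, s, h4, h1, h2, ?_⟩, h5⟩
  rw [h3 0 (by norm_num), BitVec.toNat_ofNat, Nat.mod_eq_of_lt (hP _ h5)]

/-- The program of a dominance query. -/
def dominanceQuery (g f₀ K : ℕ) : Prog :=
  .seq (asgs [(150, lit 0), (151, lit 0), (152, var 0), (153, var 1)]) <|
  .seq (familyQuery g f₀ K) (asg 0 (var 154))

theorem log_log_le (n k : ℕ) : Nat.log 2 (Nat.log 2 n + k + 1) ≤ Nat.log 2 (Nat.log 2 n) + k + 1 := by
  rcases Nat.eq_zero_or_pos (Nat.log 2 n) with h | h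
  · rw [h]
    exact (Nat.log_le_self _ _).trans (by omega)
  · rw [Nat.add_assoc (Nat.log 2 (Nat.log 2 n)), ← log_mul_two_pow h]
    refine Nat.log_mono_right ?_
    have h1 : k + 1 < 2 ^ (k + 1) := Nat.lt_two_pow_self
    have h2 : 2 ^ (k + 1) - 1 ≤ Nat.log 2 n * (2 ^ (k + 1) - 1) := Nat.le_mul_of_pos_left _ h
    have h3 : Nat.log 2 n * 2 ^ (k + 1) = Nat.log 2 n * (2 ^ (k + 1) - 1) + Nat.log 2 n := by
      rw [Nat.mul_sub, Nat.mul_one, Nat.sub_add_cancel]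
      exact Nat.le_mul_of_pos_right _ (by positivity)
    omega

end WordRAM

/-! ### Dominance counting in linear space -/

namespace WordRAM

open Finset WordRAM.Expr

theorem exists_dominance_structure {c : ℝ} (hc0 : 0 < c) :
    ∃ (p : Prog) (κ C : ℕ), ∀ n w : ℕ, κ * (Nat.log 2 n + 1) ≤ w →
      ∀ P : Finset (ℕ × ℕ), P ⊆ grid n → P.card ≤ n →
        ∃ (S : ℕ) (D : Fin S → BitVec w), S ≤ C * n ∧
          ∀ q ∈ grid n, ∃ k' : ℕ,
            Answers p D [q.1, q.2] (C * (Nat.log 2 (Nat.log 2 n) + 1)) k' ∧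
            |(k' : ℝ) - (dominanceCount P q : ℝ)| ≤ (dominanceCount P q : ℝ) ^ c := by
  obtain ⟨g, f₀, K, hg, hf, hE⟩ := exists_approx_params hc0
  set E := f₀ + g + K + 1 with hEdef
  refine ⟨dominanceQuery g f₀ K, 100 + 10 * E, 8000 * E + 2 * familyTime g f₀ K + 20, ?_⟩
  intro n w hw P hP hPn
  rcases Nat.eq_zero_or_pos n with rfl | hn
  · exact ⟨0, fun i => i.elim0, Nat.zero_le _, fun q hq => by simp [grid] at hq⟩
  set L := Nat.log 2 n with hL
  have hnL : n < 2 ^ (L + 1) := Nat.lt_pow_succ_log_self (by norm_num) n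
  have hLn : L < n := Nat.log_lt_self _ (by omega)
  have hwL : 100 * L + 100 + 10 * E ≤ w := by
    have h1 : (100 + 10 * E) * (L + 1) = 100 * L + 100 + 10 * E + 10 * E * L := by ring
    omega
  -- A family with the single class `0`.
  set Q : Finset (ℕ × ℕ × ℕ) := P.image fun p => (0, p) with hQdef
  have hQP : #Q ≤ #P := card_image_le
  have hmem : ∀ p ∈ P, p.1 < 2 ^ (L + 1) ∧ p.2 < 2 ^ (L + 1) := by
    intro p hp
    have := hP hp
    simp only [grid, mem_product, mem_Icc] at this
    omega
  have hQ : Bounded Q (2 ^ (L + 1)) := by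
    intro p hp
    obtain ⟨q, hq, rfl⟩ := mem_image.1 hp
    exact ⟨by positivity, hmem q hq⟩
  obtain ⟨l, hl1, hl2, hl3⟩ := exists_familyBlock (g := g) (K := K) hf hQ
  have hlen : l.length ≤ 8000 * E * n := by
    refine hl1.trans ((Nat.mul_le_mul_left _ (show #Q + (L + 1) + 1 ≤ 4 * n by omega)).trans ?_)
    rw [hEdef]; exact le_of_eq (by ring)
  have hlenw : l.length ≤ 2 ^ w := by
    refine hlen.trans ?_
    have h1 : E ≤ 2 ^ E := Nat.lt_two_pow_self.le
    have h2 : 8000 * E * n ≤ 2 ^ 13 * 2 ^ E * 2 ^ (L + 1) :=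
      Nat.mul_le_mul (Nat.mul_le_mul (by norm_num) h1) hnL.le
    rw [← pow_add, ← pow_add] at h2
    exact h2.trans (Nat.pow_le_pow_right (by norm_num) (by omega))
  have hent : ∀ x ∈ l, x < 2 ^ w := fun x hx =>
    (hl2 x hx).trans_le (Nat.pow_le_pow_right (by norm_num) (by omega))
  refine ⟨l.length, memOf w l, hlen.trans (Nat.mul_le_mul_right _ (by omega)), ?_⟩
  intro q hq
  obtain ⟨H⟩ := hl3 w _ (memOf w l) 0 hlenw (by omega) (stored_memOf hent)
  have hq' : q.1 ≤ 2 ^ (L + 1) ∧ q.2 ≤ 2 ^ (L + 1) := by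
    simp only [grid, mem_product, mem_Icc] at hq
    omega
  have hcount : classCount Q 0 q.1 q.2 = dominanceCount P q := by
    unfold classCount dominanceCount
    rw [hQdef, filter_image, card_image_of_injective _ fun a b h => (Prod.mk.inj h).2]
    simp
  have hWP : WP (memOf w l) (dominanceQuery g f₀ K) (fun r => [q.1, q.2].getD r 0) fun t ρ' =>
      t ≤ (8000 * E + 2 * familyTime g f₀ K + 20) * (Nat.log 2 L + 1) ∧
      ApproxOutcome g f₀ K (dominanceCount P q) (ρ' 0) := by
    unfold dominanceQuery
    refine WP.seq (WP.asgs_of (fun ρ' => ρ' 150 = 0 ∧ ρ' 151 = 0 ∧ ρ' 152 = q.1 ∧ ρ' 153 = q.2)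
      ?_ ⟨?_, ?_, ?_, ?_⟩ ?_)
    · simp
    · simp
    · simp
    · simp
    · simp
    rintro ρ1 ⟨h150, h151, h152, h153⟩
    refine WP.seq ((wp_familyQuery H (Nat.succ_pos L) hg hf (by positivity) hq'.1 hq'.2 h150 h151
      h152 h153).mono ?_)
    rintro t ρ2 ⟨ht, h154, -⟩
    refine WP.asg (by norm_num) (by simp) ⟨?_, by simpa [hcount] using h154⟩
    have h1 : Nat.log 2 (L + 1) ≤ Nat.log 2 L + 1 := log_log_le n 0
    have h2 : familyTime g f₀ K * (Nat.log 2 (L + 1) + 1) ≤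
        familyTime g f₀ K * (2 * (Nat.log 2 L + 1)) := Nat.mul_le_mul_left _ (by omega)
    have h3 : (8000 * E + 2 * familyTime g f₀ K + 20) * (Nat.log 2 L + 1) =
      familyTime g f₀ K * (2 * (Nat.log 2 L + 1)) + 20 * (Nat.log 2 L + 1) +
        8000 * E * (Nat.log 2 L + 1) := by ring
    simp at ht ⊢
    omega
  have hlt : ∀ k, ApproxOutcome g f₀ K (dominanceCount P q) k → k < 2 ^ w := by
    intro k hk
    have h1 : dominanceCount P q ≤ #P := card_filter_le _ _
    have h2 : 2 ^ (L + 1) ≤ 2 ^ w := Nat.pow_le_pow_right (by norm_num) (by omega)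
    have := hk.le
    omega
  obtain ⟨k, hk1, hk2⟩ := exists_answers hlt hWP
  refine ⟨k, hk1, ?_⟩
  have := hE _ _ hk2
  have := abs_nonneg ((k : ℝ) - dominanceCount P q)
  linarith

end WordRAM

/-! ### Dyadic rectangles: a range as four dominance queries -/

namespace WordRAM

open Finset WordRAM.Expr

/-- The coordinate `x`, reflected if it lies in an odd block of length `2 ^ ℓ`. -/
def reflect (V ℓ x : ℕ) : ℕ := if x / 2 ^ ℓ % 2 = 0 then x else V - 1 - x

theorem reflect_lt {V : ℕ} (ℓ : ℕ) {x : ℕ} (hx : x < V) : reflect V ℓ x < V := by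
  unfold reflect; split <;> omega

theorem reflect_inj {V ℓ x y : ℕ} (hx : x < V) (hy : y < V) (h : x / 2 ^ ℓ = y / 2 ^ ℓ)
    (h' : reflect V ℓ x = reflect V ℓ y) : x = y := by
  unfold reflect at h'
  rw [h] at h'
  split at h' <;> omega

/-- The level at which the paths to `a` and `b` in the binary trie part. -/
def splitLevel (a b : ℕ) : ℕ := Nat.log 2 (a ^^^ b)

/-- The split level is the top bit of `a ^^^ b`, so the shifted numbers differ in their last bit
only, and `a < b` decides which of them is even. -/
theorem div_splitLevel {a b : ℕ} (h : a < b) :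
    b / 2 ^ splitLevel a b = a / 2 ^ splitLevel a b + 1 ∧ a / 2 ^ splitLevel a b % 2 = 0 := by
  have hz : a ^^^ b ≠ 0 := fun h0 => h.ne (Nat.xor_eq_zero_iff.1 h0)
  have h1 : (a ^^^ b) / 2 ^ splitLevel a b = 1 := by
    have h2 := Nat.pow_log_le_self 2 hz
    have h3 := Nat.lt_pow_succ_log_self (b := 2) (by norm_num) (a ^^^ b)
    rw [Nat.pow_succ] at h3
    exact Nat.div_eq_of_lt_le (by rw [Nat.one_mul]; exact h2) (by rw [splitLevel]; omega)
  rw [← Nat.shiftRight_eq_div_pow, Nat.shiftRight_xor_distrib, Nat.shiftRight_eq_div_pow,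
    Nat.shiftRight_eq_div_pow] at h1
  have h4 := Nat.div_le_div_right (c := 2 ^ splitLevel a b) h.le
  set i := a / 2 ^ splitLevel a b
  set j := b / 2 ^ splitLevel a b
  have h5 : j = i ^^^ 1 := by rw [← h1, ← Nat.xor_assoc, Nat.xor_self, Nat.zero_xor]
  have h6 : j / 2 = i / 2 := by
    rw [h5, Nat.xor_div_two]; simp
  have h7 : j % 2 = (i + 1) % 2 := by
    rw [h5, Nat.xor_mod_two_eq]
  omega

/-- In the even block, which contains `a`, the condition `x < b` is automatic. In the odd block,
which contains `b`, the condition `a ≤ x` is automatic and reflection turns `x < b` into a lower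
bound. -/
theorem reflect_block {V a b x : ℕ} (hab : a < b) (hb : b < V) (hx : x < V) :
    (x / 2 ^ splitLevel a b = a / 2 ^ splitLevel a b ∧ a ≤ reflect V (splitLevel a b) x ↔
      x / 2 ^ splitLevel a b = a / 2 ^ splitLevel a b ∧ a ≤ x ∧ x < b) ∧
    (x / 2 ^ splitLevel a b = a / 2 ^ splitLevel a b + 1 ∧
        V - b ≤ reflect V (splitLevel a b) x ↔
      x / 2 ^ splitLevel a b = a / 2 ^ splitLevel a b + 1 ∧ a ≤ x ∧ x < b) ∧
    (a ≤ x → x < b → x / 2 ^ splitLevel a b = a / 2 ^ splitLevel a b ∨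
      x / 2 ^ splitLevel a b = a / 2 ^ splitLevel a b + 1) := by
  obtain ⟨h1, h2⟩ := div_splitLevel hab
  have hle : ∀ {y z : ℕ}, y ≤ z → y / 2 ^ splitLevel a b ≤ z / 2 ^ splitLevel a b :=
    fun h => Nat.div_le_div_right h
  refine ⟨and_congr_right fun h => ?_, and_congr_right fun h => ?_, fun h h' => ?_⟩
  · have h3 : x < b := by
      by_contra hc
      have := hle (not_lt.1 hc)
      omega
    simp only [reflect, h, h2, if_true]
    tauto
  · have h3 : a ≤ x := by
      by_contra hc
      have := hle (not_le.1 hc).le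
      omega
    have h4 : ¬ (x / 2 ^ splitLevel a b % 2 = 0) := by omega
    simp only [reflect, h4, if_false]
    omega
  · have h3 := hle h
    have h4 := hle h'.le
    omega

/-- The class of the points in a dyadic rectangle. -/
def rectCode (V ℓ i m j : ℕ) : ℕ := ((ℓ * V + i) * V + m) * V + j

theorem rectCode_lt {V ℓ i m j : ℕ} (hℓ : ℓ < V) (hi : i < V) (hm : m < V) (hj : j < V) :
    rectCode V ℓ i m j < V ^ 4 := by
  have h : ∀ {x y Z : ℕ}, x < Z → y < V → x * V + y < Z * V := by
    intro x y Z hx hy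
    have := Nat.mul_le_mul_right V hx
    rw [Nat.succ_mul] at this
    omega
  have := h (h (h hℓ hi) hm) hj
  rw [rectCode]
  convert this using 1
  ring

theorem rectCode_inj {V ℓ i m j ℓ' i' m' j' : ℕ} (hi : i < V) (hm : m < V) (hj : j < V)
    (hi' : i' < V) (hm' : m' < V) (hj' : j' < V)
    (h : rectCode V ℓ i m j = rectCode V ℓ' i' m' j') : ℓ = ℓ' ∧ i = i' ∧ m = m' ∧ j = j' := by
  obtain ⟨h1, h2⟩ := mul_add_inj hj hj' h
  obtain ⟨h3, h4⟩ := mul_add_inj hm hm' h1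
  obtain ⟨h5, h6⟩ := mul_add_inj hi hi' h3
  exact ⟨h5, h6, h4, h2⟩

/-- The point `p` in its dyadic rectangle of size `2 ^ ℓ × 2 ^ m`, with the orientation that makes
the part of a query in this rectangle a dominance query. -/
def rectPoint (V ℓ m : ℕ) (p : ℕ × ℕ) : ℕ × ℕ × ℕ :=
  (rectCode V ℓ (p.1 / 2 ^ ℓ) m (p.2 / 2 ^ m), reflect V ℓ p.1, reflect V m p.2)

/-- The points of `P` in all their dyadic rectangles. -/
def rectFamily (Λ : ℕ) (P : Finset (ℕ × ℕ)) : Finset (ℕ × ℕ × ℕ) :=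
  (P ×ˢ range (Λ + 1) ×ˢ range (Λ + 1)).image fun z => rectPoint (2 ^ Λ) z.2.1 z.2.2 z.1

theorem card_rectFamily_le (Λ : ℕ) (P : Finset (ℕ × ℕ)) :
    #(rectFamily Λ P) ≤ #P * ((Λ + 1) * (Λ + 1)) := by
  refine card_image_le.trans ?_
  simp

theorem bounded_rectFamily {Λ : ℕ} {P : Finset (ℕ × ℕ)}
    (hP : ∀ p ∈ P, p.1 < 2 ^ Λ ∧ p.2 < 2 ^ Λ) :
    Bounded (rectFamily Λ P) (2 ^ (4 * Λ)) := by
  intro z hz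
  obtain ⟨⟨p, ℓ, m⟩, h, rfl⟩ := mem_image.1 hz
  simp only [mem_product, mem_range] at h
  have h1 := hP p h.1
  have h2 : Λ < 2 ^ Λ := Nat.lt_two_pow_self
  have h3 : 2 ^ Λ ≤ 2 ^ (4 * Λ) := Nat.pow_le_pow_right (by norm_num) (by omega)
  refine ⟨?_, (reflect_lt _ h1.1).trans_le h3, (reflect_lt _ h1.2).trans_le h3⟩
  rw [Nat.mul_comm 4, Nat.pow_mul]
  exact rectCode_lt (show ℓ < _ by omega) ((Nat.div_le_self _ _).trans_lt h1.1)
    (show m < _ by omega) ((Nat.div_le_self _ _).trans_lt h1.2)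

/-- The code determines the rectangle, and within one rectangle the orientation is constant, so no
two points are identified. -/
theorem classCount_rectFamily {Λ : ℕ} {P : Finset (ℕ × ℕ)}
    (hP : ∀ p ∈ P, p.1 < 2 ^ Λ ∧ p.2 < 2 ^ Λ) {ℓ m i j : ℕ} (hℓ : ℓ ≤ Λ) (hm : m ≤ Λ)
    (hi : i < 2 ^ Λ) (hj : j < 2 ^ Λ) (x y : ℕ) :
    classCount (rectFamily Λ P) (rectCode (2 ^ Λ) ℓ i m j) x y =
      #{p ∈ P | (p.1 / 2 ^ ℓ = i ∧ x ≤ reflect (2 ^ Λ) ℓ p.1) ∧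
        (p.2 / 2 ^ m = j ∧ y ≤ reflect (2 ^ Λ) m p.2)} := by
  have h2 : Λ < 2 ^ Λ := Nat.lt_two_pow_self
  rw [classCount, ← card_image_of_injOn (f := rectPoint (2 ^ Λ) ℓ m)]
  · congr 1
    ext z
    simp only [rectFamily, mem_filter, mem_image, mem_product, mem_range]
    constructor
    · rintro ⟨⟨⟨p, ℓ', m'⟩, ⟨hp, hℓ', hm'⟩, rfl⟩, h3, h4, h5⟩
      simp only at hp hℓ' hm'
      have h1 := hP p hp
      obtain ⟨rfl, h6, rfl, h7⟩ := rectCode_inj ((Nat.div_le_self _ _).trans_lt h1.1)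
        (show m' < _ by omega) ((Nat.div_le_self _ _).trans_lt h1.2) hi (by omega) hj h3
      exact ⟨p, ⟨hp, ⟨h6, h4⟩, h7, h5⟩, rfl⟩
    · rintro ⟨p, ⟨hp, ⟨rfl, h4⟩, rfl, h5⟩, rfl⟩
      exact ⟨⟨(p, ℓ, m), ⟨hp, by simp; omega⟩, rfl⟩, rfl, h4, h5⟩
  · intro p hp q hq h
    simp only [coe_filter, Set.mem_ofPred_eq] at hp hq
    have h3 := Prod.mk.inj h
    have h4 := Prod.mk.inj h3.2
    exact Prod.ext (reflect_inj (hP p hp.1).1 (hP q hq.1).1 (hp.2.1.1.trans hq.2.1.1.symm) h4.1)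
      (reflect_inj (hP p hp.1).2 (hP q hq.1).2 (hp.2.2.1.trans hq.2.2.1.symm) h4.2)

theorem card_filter_split {α : Type*} (P : Finset α) (A B C : α → Prop) [DecidablePred A]
    [DecidablePred B] [DecidablePred C] (h : ∀ p ∈ P, C p ↔ A p ∨ B p)
    (h' : ∀ p ∈ P, ¬ (A p ∧ B p)) : #{p ∈ P | C p} = #{p ∈ P | A p} + #{p ∈ P | B p} := by
  classical
  rw [filter_congr h, filter_or, card_union_of_disjoint]
  rw [disjoint_left]
  intro p h1 h2
  rw [mem_filter] at h1 h2
  exact h' p h1.1 ⟨h1.2, h2.2⟩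

theorem sum_classCount_rectFamily {Λ : ℕ} {P : Finset (ℕ × ℕ)}
    (hP : ∀ p ∈ P, p.1 < 2 ^ Λ ∧ p.2 < 2 ^ Λ) {a b a' b' : ℕ} (hab : a < b) (hb : b < 2 ^ Λ)
    (hab' : a' < b') (hb' : b' < 2 ^ Λ) :
    #{p ∈ P | (a ≤ p.1 ∧ p.1 < b) ∧ (a' ≤ p.2 ∧ p.2 < b')} =
      classCount (rectFamily Λ P) (rectCode (2 ^ Λ) (splitLevel a b) (a / 2 ^ splitLevel a b)
        (splitLevel a' b') (a' / 2 ^ splitLevel a' b')) a a' +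
      classCount (rectFamily Λ P) (rectCode (2 ^ Λ) (splitLevel a b) (a / 2 ^ splitLevel a b)
        (splitLevel a' b') (a' / 2 ^ splitLevel a' b' + 1)) a (2 ^ Λ - b') +
      classCount (rectFamily Λ P) (rectCode (2 ^ Λ) (splitLevel a b) (a / 2 ^ splitLevel a b + 1)
        (splitLevel a' b') (a' / 2 ^ splitLevel a' b')) (2 ^ Λ - b) a' +
      classCount (rectFamily Λ P) (rectCode (2 ^ Λ) (splitLevel a b) (a / 2 ^ splitLevel a b + 1)
        (splitLevel a' b') (a' / 2 ^ splitLevel a' b' + 1)) (2 ^ Λ - b) (2 ^ Λ - b') := by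
  have hlog : ∀ {a b : ℕ}, a < b → b < 2 ^ Λ → splitLevel a b ≤ Λ := by
    intro a b h h'
    have h1 : a ^^^ b < 2 ^ Λ := Nat.xor_lt_two_pow (h.trans h') h'
    exact (Nat.log_mono_right h1.le).trans_eq (Nat.log_pow (by norm_num) _)
  have h1 : a / 2 ^ splitLevel a b + 1 < 2 ^ Λ := by
    rw [← (div_splitLevel hab).1]; exact (Nat.div_le_self _ _).trans_lt hb
  have h2 : a' / 2 ^ splitLevel a' b' + 1 < 2 ^ Λ := by
    rw [← (div_splitLevel hab').1]; exact (Nat.div_le_self _ _).trans_lt hb'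
  have h3 := hlog hab hb
  have h4 := hlog hab' hb'
  rw [classCount_rectFamily hP h3 h4 (by omega) (by omega),
    classCount_rectFamily hP h3 h4 (by omega) h2, classCount_rectFamily hP h3 h4 h1 (by omega),
    classCount_rectFamily hP h3 h4 h1 h2]
  have hx := fun p (hp : p ∈ P) => reflect_block hab hb (hP p hp).1
  have hy := fun p (hp : p ∈ P) => reflect_block hab' hb' (hP p hp).2
  have e0 : #{p ∈ P | (a ≤ p.1 ∧ p.1 < b) ∧ (a' ≤ p.2 ∧ p.2 < b')} =
      #{p ∈ P | (p.1 / 2 ^ splitLevel a b = a / 2 ^ splitLevel a b ∧ a ≤ p.1 ∧ p.1 < b) ∧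
        (a' ≤ p.2 ∧ p.2 < b')} +
      #{p ∈ P | (p.1 / 2 ^ splitLevel a b = a / 2 ^ splitLevel a b + 1 ∧ a ≤ p.1 ∧ p.1 < b) ∧
        (a' ≤ p.2 ∧ p.2 < b')} := by
    refine card_filter_split P _ _ _ (fun p hp => ?_) ?_
    · have := (hx p hp).2.2
      constructor
      · rintro ⟨⟨h5, h6⟩, h7⟩
        rcases this h5 h6 with h | h
        · exact Or.inl ⟨⟨h, h5, h6⟩, h7⟩
        · exact Or.inr ⟨⟨h, h5, h6⟩, h7⟩
      · rintro (h | h) <;> exact ⟨h.1.2, h.2⟩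
    · rintro p - ⟨h, h'⟩
      have := h.1.1
      have := h'.1.1
      omega
  -- The vertical split is stated for any condition `X` because it is applied in both horizontal
  -- halves.
  have e1 : ∀ X : ℕ × ℕ → Prop, [DecidablePred X] →
      #{p ∈ P | X p ∧ (a' ≤ p.2 ∧ p.2 < b')} =
      #{p ∈ P | X p ∧ (p.2 / 2 ^ splitLevel a' b' = a' / 2 ^ splitLevel a' b' ∧
        a' ≤ reflect (2 ^ Λ) (splitLevel a' b') p.2)} +
      #{p ∈ P | X p ∧ (p.2 / 2 ^ splitLevel a' b' = a' / 2 ^ splitLevel a' b' + 1 ∧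
        2 ^ Λ - b' ≤ reflect (2 ^ Λ) (splitLevel a' b') p.2)} := by
    intro X _
    refine card_filter_split P _ _ _ (fun p hp => ?_) ?_
    · rw [(hy p hp).1, (hy p hp).2.1]
      have := (hy p hp).2.2
      tauto
    · rintro p - ⟨h, h'⟩
      have := h.2.1
      have := h'.2.1
      omega
  rw [e0, ← filter_congr fun p hp => and_congr_left' (hx p hp).1,
    ← filter_congr fun p hp => and_congr_left' (hx p hp).2.1, e1, e1]
  omega

end WordRAM

/-! ### The range query program -/

namespace WordRAM

open Finset WordRAM.Expr

/-- The bitwise exclusive or of two expressions. -/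
def Expr.xor (a b : Expr) : Expr := bin .xor a b

section

variable {w S : ℕ} (D : Fin S → BitVec w) (ρ : ℕ → ℕ) (a b : Expr)

@[simp] theorem Expr.eval_xor : (a.xor b).eval D ρ = a.eval D ρ ^^^ b.eval D ρ := rfl
@[simp] theorem Expr.ok_xor : (a.xor b).Ok D ρ ↔
    a.Ok D ρ ∧ b.Ok D ρ ∧ a.eval D ρ < 2 ^ w ∧ b.eval D ρ < 2 ^ w := Iff.rfl
@[simp] theorem Expr.cost_xor : (a.xor b).cost = a.cost + (b.cost + 1) := rfl

end

/-- The result of the query of the family at the address in register `259` with the class and the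
point in the registers `u`, `x`, `y` is added to register `264`. -/
def addFamilyQuery (g f₀ K u x y : ℕ) : Prog :=
  .seq (asgs [(150, var 259), (151, var u), (152, var x), (153, var y)]) <|
  .seq (familyQuery g f₀ K) (asg 264 (var 264 + var 154))

theorem wp_addFamilyQuery {w S : ℕ} {D : Fin S → BitVec w} {b g f₀ K : ℕ}
    {Q : Finset (ℕ × ℕ × ℕ)} {Λ : ℕ} (H : FamilyBlock D b g f₀ K Q Λ) (hΛ : 0 < Λ) (hg : 2 ≤ g)
    (hf : 0 < f₀) {u x y : ℕ} {ρ : ℕ → ℕ} (hu : ρ u < 2 ^ Λ) (hx : ρ x ≤ 2 ^ Λ)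
    (hy : ρ y ≤ 2 ^ Λ) (h259 : ρ 259 = b) (hur : 250 ≤ u ∧ u < 1000) (hxr : 250 ≤ x ∧ x < 1000)
    (hyr : 250 ≤ y ∧ y < 1000) :
    WP D (addFamilyQuery g f₀ K u x y) ρ fun t ρ' =>
      t ≤ familyTime g f₀ K * (Nat.log 2 Λ + 1) + 20 ∧
      (∃ k, ApproxOutcome g f₀ K (classCount Q (ρ u) (ρ x) (ρ y)) k ∧ ρ' 264 = ρ 264 + k) ∧
      ∀ r, 250 ≤ r → r ≠ 264 → ρ' r = ρ r := by
  unfold addFamilyQuery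
  have hne : ∀ {r s : ℕ}, 250 ≤ r → s < 250 → r ≠ s := fun h h' => by omega
  refine WP.seq (WP.asgs_of (fun ρ' => ρ' 150 = b ∧ ρ' 151 = ρ u ∧ ρ' 152 = ρ x ∧ ρ' 153 = ρ y ∧
    ∀ r, 250 ≤ r → ρ' r = ρ r) ?_ ⟨?_, ?_, ?_, ?_, fun r hr => runAsgs_of_le 250 rfl hr⟩ ?_)
  · simp [hur.2, hxr.2, hyr.2]
  · simp [h259]
  · simp [hne hur.1]
  · simp [hne hxr.1]
  · simp [hne hyr.1]
  rintro ρ1 ⟨h150, h151, h152, h153, hr1⟩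
  refine WP.seq ((wp_familyQuery H hΛ hg hf hu hx hy h150 h151 h152 h153).mono ?_)
  rintro t ρ2 ⟨ht, h154, hr2⟩
  refine WP.asg (by norm_num) (by simp) ⟨?_, ⟨_, h154, ?_⟩, fun r hr hr' => ?_⟩
  · simp; omega
  · simp [hr2, hr1]
  · rw [Function.update_of_ne hr', hr2 r (by omega), hr1 r hr]

/-- The program of a range query. Cell `0` holds the size `V` of a table of logarithms at address
`1`, which is followed by the structure for the family of points in dyadic rectangles. -/
def rangeQuery (g f₀ K : ℕ) : Prog :=
  .seq (asgs [(250, var 0), (251, var 1 + lit 1), (252, var 2), (253, var 3 + lit 1)]) <|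
  .branch .le (.reg 251) (.reg 250) (asg 0 (lit 0)) <|
  .branch .le (.reg 253) (.reg 252) (asg 0 (lit 0)) <|
  .seq (asgs [(254, ld (lit 0)), (255, ld (lit 1 + (var 250).xor (var 251))),
    (256, ld (lit 1 + (var 252).xor (var 253))), (257, (var 250).shr (var 255)),
    (258, (var 252).shr (var 256)), (259, lit 1 + var 254), (260, var 254 - var 251),
    (261, var 254 - var 253), (264, lit 0),
    (265, ((var 255 * var 254 + var 257) * var 254 + var 256) * var 254 + var 258),
    (266, ((var 255 * var 254 + var 257) * var 254 + var 256) * var 254 + (var 258 + lit 1)),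
    (267, ((var 255 * var 254 + (var 257 + lit 1)) * var 254 + var 256) * var 254 + var 258),
    (268, ((var 255 * var 254 + (var 257 + lit 1)) * var 254 + var 256) * var 254 +
      (var 258 + lit 1))]) <|
  .seq (addFamilyQuery g f₀ K 265 250 252) <|
  .seq (addFamilyQuery g f₀ K 266 250 261) <|
  .seq (addFamilyQuery g f₀ K 267 260 252) <|
  .seq (addFamilyQuery g f₀ K 268 260 261) (asg 0 (var 264))

/-- The memory holds a structure for range queries. -/
structure RangeBlock {w S : ℕ} (D : Fin S → BitVec w) (g f₀ K Λ : ℕ) (P : Finset (ℕ × ℕ)) where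
  hdr : 0 < S
  cell_V : cell D 0 = 2 ^ Λ
  log : ∀ z < 2 ^ Λ, 1 + z < S ∧ cell D (1 + z) = Nat.log 2 z
  family : FamilyBlock D (1 + 2 ^ Λ) g f₀ K (rectFamily Λ P) (4 * Λ)
  lt : ∀ p ∈ P, p.1 < 2 ^ Λ ∧ p.2 < 2 ^ Λ
  pos : 0 < Λ

/-- The possible answers of a range query for `k` points. -/
def RangeOutcome (g f₀ K k k' : ℕ) : Prop :=
  k = 0 ∧ k' = 0 ∨ ∃ k₁ k₂ k₃ k₄ k₁' k₂' k₃' k₄', k = k₁ + k₂ + k₃ + k₄ ∧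
    k' = k₁' + k₂' + k₃' + k₄' ∧ ApproxOutcome g f₀ K k₁ k₁' ∧ ApproxOutcome g f₀ K k₂ k₂' ∧
    ApproxOutcome g f₀ K k₃ k₃' ∧ ApproxOutcome g f₀ K k₄ k₄'

theorem RangeOutcome.le {g f₀ K k k' : ℕ} (h : RangeOutcome g f₀ K k k') : k' ≤ k := by
  rcases h with h | ⟨k₁, k₂, k₃, k₄, k₁', k₂', k₃', k₄', rfl, rfl, h1, h2, h3, h4⟩
  · omega
  · have := h1.le
    have := h2.le
    have := h3.le
    have := h4.le
    omega

set_option maxHeartbeats 1000000 in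
theorem wp_rangeQuery {w S : ℕ} {D : Fin S → BitVec w} {g f₀ K Λ : ℕ} {P : Finset (ℕ × ℕ)}
    (H : RangeBlock D g f₀ K Λ P) (hg : 2 ≤ g) (hf : 0 < f₀) {a b a' b' : ℕ} (ha : a < 2 ^ Λ)
    (ha' : a' < 2 ^ Λ) (hb : b + 1 < 2 ^ Λ) (hb' : b' + 1 < 2 ^ Λ)
    {ρ : ℕ → ℕ} (h0 : ρ 0 = a) (h1 : ρ 1 = b) (h2 : ρ 2 = a') (h3 : ρ 3 = b') :
    WP D (rangeQuery g f₀ K) ρ fun t ρ' =>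
      t ≤ 4 * (familyTime g f₀ K * (Nat.log 2 (4 * Λ) + 1)) + 300 ∧
      RangeOutcome g f₀ K #{p ∈ P | (a ≤ p.1 ∧ p.1 ≤ b) ∧ (a' ≤ p.2 ∧ p.2 ≤ b')} (ρ' 0) := by
  have hΛ := H.pos
  have hS := H.family.rankX.table.le_pow
  have hwΛ : 12 * Λ < w := by have := H.family.rankX.lt_w; omega
  have hVw : 2 ^ Λ < 2 ^ w := Nat.pow_lt_pow_right (by norm_num) (by omega)
  have hV4 : (2 ^ Λ) ^ 4 = 2 ^ (4 * Λ) := by rw [← Nat.pow_mul, Nat.mul_comm]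
  have hVV : 2 ^ Λ ≤ 2 ^ (4 * Λ) := Nat.pow_le_pow_right (by norm_num) (by omega)
  have hΛV : Λ < 2 ^ Λ := Nat.lt_two_pow_self
  have hcV := H.cell_V
  have hlog := H.log
  have hsum : ∀ (hab : a < b + 1) (hab' : a' < b' + 1), _ :=
    fun hab hab' => sum_classCount_rectFamily H.lt hab hb hab' hb'
  simp only [Nat.lt_succ_iff] at hsum
  have hfam := H.family
  have hsplit : ∀ {a b : ℕ}, a < b + 1 → b + 1 < 2 ^ Λ → splitLevel a (b + 1) < 2 ^ Λ ∧
      a / 2 ^ splitLevel a (b + 1) + 1 < 2 ^ Λ ∧ a ^^^ (b + 1) < 2 ^ Λ := by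
    intro a b h h'
    have h1 : a ^^^ (b + 1) < 2 ^ Λ := Nat.xor_lt_two_pow (h.trans h') h'
    refine ⟨?_, ?_, h1⟩
    · exact ((Nat.log_mono_right h1.le).trans_eq (Nat.log_pow (by norm_num) _)).trans_lt hΛV
    · rw [← (div_splitLevel h).1]; exact (Nat.div_le_self _ _).trans_lt h'
  generalize hV : 2 ^ Λ = V at *
  unfold rangeQuery
  refine WP.seq (WP.asgs_of (fun ρ' => ρ' 250 = a ∧ ρ' 251 = b + 1 ∧ ρ' 252 = a' ∧ ρ' 253 = b' + 1)
    ?_ ⟨?_, ?_, ?_, ?_⟩ ?_)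
  · simp
  · simp [h0]
  · simp [h1]
  · simp [h2]
  · simp [h3]
  rintro ρ1 ⟨h250, h251, h252, h253⟩
  -- The corners may be in the wrong order; such a range is empty and has no split level of the
  -- required kind.
  refine WP.branch ⟨by norm_num, ?_⟩ ⟨by norm_num, ?_⟩ (fun hc => ?_) (fun hc => ?_)
  · simp only [Operand.nat]; omega
  · simp only [Operand.nat]; omega
  · simp only [Cmp.nat, Operand.nat, h250, h251] at hc
    refine WP.asg (by norm_num) trivial ⟨by simp, Or.inl ⟨?_, by simp⟩⟩
    rw [card_eq_zero, filter_eq_empty_iff]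
    intro p _; omega
  refine WP.branch ⟨by norm_num, ?_⟩ ⟨by norm_num, ?_⟩ (fun hc' => ?_) (fun hc' => ?_)
  · simp only [Operand.nat]; omega
  · simp only [Operand.nat]; omega
  · simp only [Cmp.nat, Operand.nat, h252, h253] at hc'
    refine WP.asg (by norm_num) trivial ⟨by simp, Or.inl ⟨?_, by simp⟩⟩
    rw [card_eq_zero, filter_eq_empty_iff]
    intro p _; omega
  simp only [Cmp.nat, Operand.nat, h250, h251, not_le] at hc
  simp only [Cmp.nat, Operand.nat, h252, h253, not_le] at hc'
  obtain ⟨hl, hi, hz⟩ := hsplit hc hb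
  obtain ⟨hm, hj, hz'⟩ := hsplit hc' hb'
  rw [hsum (by omega) (by omega)]
  have el : cell D (1 + (a ^^^ (b + 1))) = splitLevel a (b + 1) := (hlog _ hz).2
  have em : cell D (1 + (a' ^^^ (b' + 1))) = splitLevel a' (b' + 1) := (hlog _ hz').2
  have bl := (hlog _ hz).1
  have bm := (hlog _ hz').1
  generalize splitLevel a (b + 1) = ℓ at *
  generalize splitLevel a' (b' + 1) = m at *
  have hcode : ∀ {i j : ℕ}, i < V → j < V → rectCode V ℓ i m j < 2 ^ (4 * Λ) := fun h h' => by
    rw [← hV4]; exact rectCode_lt hl h hm h'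
  refine WP.seq (WP.asgs_of (fun ρ' => ρ' 250 = a ∧ ρ' 252 = a' ∧ ρ' 259 = 1 + V ∧
    ρ' 260 = V - (b + 1) ∧ ρ' 261 = V - (b' + 1) ∧ ρ' 264 = 0 ∧
    ρ' 265 = rectCode V ℓ (a / 2 ^ ℓ) m (a' / 2 ^ m) ∧
    ρ' 266 = rectCode V ℓ (a / 2 ^ ℓ) m (a' / 2 ^ m + 1) ∧
    ρ' 267 = rectCode V ℓ (a / 2 ^ ℓ + 1) m (a' / 2 ^ m) ∧
    ρ' 268 = rectCode V ℓ (a / 2 ^ ℓ + 1) m (a' / 2 ^ m + 1))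
    ?_ ⟨?_, ?_, ?_, ?_, ?_, ?_, ?_, ?_, ?_, ?_⟩ ?_)
  · simp [h250, h251, h252, h253, hcV, el, em, H.hdr, hS]
    omega
  · simp [h250]
  · simp [h252]
  · simp [hcV]
  · simp [hcV, h251]
  · simp [hcV, h253]
  · simp
  · simp [h250, h251, h252, h253, hcV, el, em, rectCode]
  · simp [h250, h251, h252, h253, hcV, el, em, rectCode]
  · simp [h250, h251, h252, h253, hcV, el, em, rectCode]
  · simp [h250, h251, h252, h253, hcV, el, em, rectCode]
  rintro ρ2 ⟨a250, a252, a259, a260, a261, a264, a265, a266, a267, a268⟩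
  refine WP.seq ((wp_addFamilyQuery hfam (by omega) hg hf (u := 265) (x := 250) (y := 252)
    (by rw [a265]; exact hcode (by omega) (by omega)) (by omega) (by omega) a259 (by norm_num)
    (by norm_num) (by norm_num)).mono ?_)
  rintro t1 ρ3 ⟨ht1, ⟨k1, hk1, e1⟩, hr1⟩
  refine WP.seq ((wp_addFamilyQuery hfam (by omega) hg hf (u := 266) (x := 250) (y := 261)
    (by rw [hr1 _ (by norm_num) (by norm_num), a266]; exact hcode (by omega) (by omega))
    (by rw [hr1 _ (by norm_num) (by norm_num)]; omega)
    (by rw [hr1 _ (by norm_num) (by norm_num)]; omega)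
    (by rw [hr1 _ (by norm_num) (by norm_num), a259]) (by norm_num)
    (by norm_num) (by norm_num)).mono ?_)
  rintro t2 ρ4 ⟨ht2, ⟨k2, hk2, e2⟩, hr2⟩
  have hr2' : ∀ r, 250 ≤ r → r ≠ 264 → ρ4 r = ρ2 r := fun r h h' =>
    (hr2 r h h').trans (hr1 r h h')
  refine WP.seq ((wp_addFamilyQuery hfam (by omega) hg hf (u := 267) (x := 260) (y := 252)
    (by rw [hr2' _ (by norm_num) (by norm_num), a267]; exact hcode (by omega) (by omega))
    (by rw [hr2' _ (by norm_num) (by norm_num)]; omega)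
    (by rw [hr2' _ (by norm_num) (by norm_num)]; omega)
    (by rw [hr2' _ (by norm_num) (by norm_num), a259]) (by norm_num)
    (by norm_num) (by norm_num)).mono ?_)
  rintro t3 ρ5 ⟨ht3, ⟨k3, hk3, e3⟩, hr3⟩
  have hr3' : ∀ r, 250 ≤ r → r ≠ 264 → ρ5 r = ρ2 r := fun r h h' =>
    (hr3 r h h').trans (hr2' r h h')
  refine WP.seq ((wp_addFamilyQuery hfam (by omega) hg hf (u := 268) (x := 260) (y := 261)
    (by rw [hr3' _ (by norm_num) (by norm_num), a268]; exact hcode (by omega) (by omega))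
    (by rw [hr3' _ (by norm_num) (by norm_num)]; omega)
    (by rw [hr3' _ (by norm_num) (by norm_num)]; omega)
    (by rw [hr3' _ (by norm_num) (by norm_num), a259]) (by norm_num)
    (by norm_num) (by norm_num)).mono ?_)
  rintro t4 ρ6 ⟨ht4, ⟨k4, hk4, e4⟩, -⟩
  rw [a265, a250, a252] at hk1
  rw [hr1 _ (by norm_num) (by norm_num), hr1 _ (by norm_num) (by norm_num),
    hr1 _ (by norm_num) (by norm_num), a266, a250, a261] at hk2
  rw [hr2' _ (by norm_num) (by norm_num), hr2' _ (by norm_num) (by norm_num),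
    hr2' _ (by norm_num) (by norm_num), a267, a260, a252] at hk3
  rw [hr3' _ (by norm_num) (by norm_num), hr3' _ (by norm_num) (by norm_num),
    hr3' _ (by norm_num) (by norm_num), a268, a260, a261] at hk4
  refine WP.asg (by norm_num) (by simp)
    ⟨?_, Or.inr ⟨_, _, _, _, k1, k2, k3, k4, rfl, ?_, hk1, hk2, hk3, hk4⟩⟩
  · simp
    omega
  · simp [e4, e3, e2, e1, a264]

end WordRAM

/-! ### Range counting in space `n log² n` -/

namespace WordRAM

open Finset WordRAM.Expr

/-- The table of logarithms gives the split level in constant time from an exclusive or. -/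
theorem exists_rangeBlock {g f₀ K : ℕ} (hf : 0 < f₀) {P : Finset (ℕ × ℕ)} {Λ : ℕ} (hΛ : 0 < Λ)
    (hP : ∀ p ∈ P, p.1 < 2 ^ Λ ∧ p.2 < 2 ^ Λ) :
    ∃ l : List ℕ,
      l.length ≤ 1 + 2 ^ Λ + 2000 * (f₀ + g + K + 1) * (#P * ((Λ + 1) * (Λ + 1)) + 4 * Λ + 1) ∧
      (∀ x ∈ l, x < 2 ^ (8 * (12 * Λ + f₀ + g + K + 3) + 12)) ∧
      ∀ (w S : ℕ) (D : Fin S → BitVec w), S ≤ 2 ^ w →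
        8 * (12 * Λ + f₀ + g + K + 3) + 12 ≤ w → Stored D 0 l →
        Nonempty (RangeBlock D g f₀ K Λ P) := by
  obtain ⟨l, h1, h2, h3⟩ := exists_familyBlock (g := g) (K := K) hf (bounded_rectFamily hP)
  rw [← Nat.mul_assoc 3 4] at h2 h3
  refine ⟨[2 ^ Λ] ++ (tab (2 ^ Λ) (Nat.log 2) ++ l), ?_, ?_, fun w S D hS hw hD => ?_⟩
  · simp only [List.length_append, length_tab, List.length_cons, List.length_nil]
    have h4 : 2000 * (f₀ + g + K + 1) * (#(rectFamily Λ P) + 4 * Λ + 1) ≤ _ :=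
      Nat.mul_le_mul_left _ (Nat.add_le_add_right (Nat.add_le_add_right
        (card_rectFamily_le Λ P) (4 * Λ)) 1)
    omega
  · intro x hx
    have hV : 2 ^ Λ < 2 ^ (8 * (12 * Λ + f₀ + g + K + 3) + 12) :=
      Nat.pow_lt_pow_right (by norm_num) (by omega)
    simp only [List.mem_append, List.mem_singleton, mem_tab] at hx
    rcases hx with rfl | ⟨i, hi, rfl⟩ | hx
    · exact hV
    · exact ((Nat.log_le_self 2 i).trans_lt hi).trans hV
    · exact h2 x hx
  · rw [stored_append, stored_append] at hD
    obtain ⟨hV, hlog, hfam⟩ := hD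
    have hV0 := hV.1
    simp only [List.length_cons, List.length_nil, length_tab, Nat.zero_add] at hV0 hlog hfam
    obtain ⟨H⟩ := h3 w S D (1 + 2 ^ Λ) hS hw hfam
    exact ⟨⟨hV0, by simpa using hV.2 0 (by simp), fun z hz => hlog.tab hz, H, hP, hΛ⟩⟩

/-- Each of the four errors is at most a quarter of `k ^ c`, since each partial count is at most
`k`. -/
theorem RangeOutcome.error_le {g f₀ K : ℕ} {c : ℝ} (hc0 : 0 < c)
    (hE : ∀ k k' : ℕ, ApproxOutcome g f₀ K k k' → 4 * |(k' : ℝ) - k| ≤ (k : ℝ) ^ c) {k k' : ℕ}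
    (h : RangeOutcome g f₀ K k k') : |(k' : ℝ) - k| ≤ (k : ℝ) ^ c := by
  rcases h with ⟨rfl, rfl⟩ | ⟨k₁, k₂, k₃, k₄, k₁', k₂', k₃', k₄', rfl, rfl, h1, h2, h3, h4⟩
  · simp [Real.zero_rpow hc0.ne']
  · have key : ∀ {i i' : ℕ}, i ≤ k₁ + k₂ + k₃ + k₄ → ApproxOutcome g f₀ K i i' →
        4 * |(i' : ℝ) - i| ≤ ((k₁ + k₂ + k₃ + k₄ : ℕ) : ℝ) ^ c := fun hi hh =>
      (hE _ _ hh).trans (Real.rpow_le_rpow (Nat.cast_nonneg _) (Nat.cast_le.2 hi) hc0.le)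
    have e1 := key (by omega) h1
    have e2 := key (by omega) h2
    have e3 := key (by omega) h3
    have e4 := key (by omega) h4
    have e5 : ((k₁' + k₂' + k₃' + k₄' : ℕ) : ℝ) - ((k₁ + k₂ + k₃ + k₄ : ℕ) : ℝ) =
        ((k₁' : ℝ) - k₁) + ((k₂' : ℝ) - k₂) + ((k₃' : ℝ) - k₃) + ((k₄' : ℝ) - k₄) := by
      push_cast; ring
    rw [e5]
    have e6 := abs_add_le (((k₁' : ℝ) - k₁) + ((k₂' : ℝ) - k₂) + ((k₃' : ℝ) - k₃)) ((k₄' : ℝ) - k₄)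
    have e7 := abs_add_three ((k₁' : ℝ) - k₁) ((k₂' : ℝ) - k₂) ((k₃' : ℝ) - k₃)
    linarith

theorem exists_range_structure {c : ℝ} (hc0 : 0 < c) :
    ∃ (p : Prog) (κ C : ℕ), ∀ n w : ℕ, κ * (Nat.log 2 n + 1) ≤ w →
      ∀ P : Finset (ℕ × ℕ), P ⊆ grid n → P.card ≤ n →
        ∃ (S : ℕ) (D : Fin S → BitVec w), S ≤ C * (n * (Nat.log 2 n + 1) ^ 2) ∧
          ∀ a ∈ grid n, ∀ b ∈ grid n, ∃ k' : ℕ,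
            Answers p D [a.1, b.1, a.2, b.2] (C * (Nat.log 2 (Nat.log 2 n) + 1)) k' ∧
            |(k' : ℝ) - (rangeCount P a b : ℝ)| ≤ (rangeCount P a b : ℝ) ^ c := by
  obtain ⟨g, f₀, K, hg, hf, hE⟩ := exists_approx_params hc0
  set E := f₀ + g + K + 1 with hEdef
  refine ⟨rangeQuery g f₀ K, 400 + 10 * E, 2 ^ 16 * E + 20 * familyTime g f₀ K + 300, ?_⟩
  intro n w hw P hP hPn
  rcases Nat.eq_zero_or_pos n with rfl | hn
  · exact ⟨0, fun i => i.elim0, Nat.zero_le _, fun q hq => by simp [grid] at hq⟩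
  set L := Nat.log 2 n with hL
  have hnL : n < 2 ^ (L + 1) := Nat.lt_pow_succ_log_self (by norm_num) n
  have hLn : 2 ^ L ≤ n := Nat.pow_log_le_self 2 hn.ne'
  have h2L : 2 ^ (L + 2) = 2 ^ L * 4 := by ring
  have h1L : 2 ^ (L + 1) = 2 ^ L * 2 := by ring
  have hwL : 400 * L + 400 + 10 * E ≤ w := by
    have h1 : (400 + 10 * E) * (L + 1) = 400 * L + 400 + 10 * E + 10 * E * L := by ring
    omega
  -- The exponent `L + 2` leaves room for the exclusive ends `b + 1` of a query, which can reach `n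
  -- + 1`.
  have hmem : ∀ p ∈ P, p.1 < 2 ^ (L + 2) ∧ p.2 < 2 ^ (L + 2) := by
    intro p hp
    have := hP hp
    simp only [grid, mem_product, mem_Icc] at this
    omega
  obtain ⟨l, hl1, hl2, hl3⟩ := exists_rangeBlock (g := g) (K := K) hf (show 0 < L + 2 by omega) hmem
  have hlen : l.length ≤ 2 ^ 16 * E * (n * (L + 1) ^ 2) := by
    have hLL : L < 2 ^ L := Nat.lt_two_pow_self
    have h0 : n ≤ n * (L + 1) ^ 2 := Nat.le_mul_of_pos_right _ (by positivity)
    have h1 : #P * ((L + 2 + 1) * (L + 2 + 1)) ≤ 9 * (n * (L + 1) ^ 2) := by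
      refine (Nat.mul_le_mul hPn (Nat.mul_le_mul (show L + 2 + 1 ≤ 3 * (L + 1) by omega)
        (show L + 2 + 1 ≤ 3 * (L + 1) by omega))).trans_eq ?_
      ring
    set T := n * (L + 1) ^ 2
    have h2 : 2000 * E * (#P * ((L + 2 + 1) * (L + 2 + 1)) + 4 * (L + 2) + 1) ≤
        2000 * E * (18 * T) := Nat.mul_le_mul_left _ (by omega)
    have h3 : 2 ^ 16 * E * T = 2000 * E * (18 * T) + 29536 * (E * T) := by ring
    have h4 : T ≤ E * T := Nat.le_mul_of_pos_left _ (by omega)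
    rw [← hEdef] at hl1
    omega
  have hlenw : l.length ≤ 2 ^ w := by
    refine hlen.trans ?_
    have h1 : E ≤ 2 ^ E := Nat.lt_two_pow_self.le
    have h3 : (L + 1) ^ 2 ≤ (2 ^ (L + 1)) ^ 2 := Nat.pow_le_pow_left Nat.lt_two_pow_self.le 2
    rw [← pow_mul] at h3
    have h2 : 2 ^ 16 * E * (n * (L + 1) ^ 2) ≤
        2 ^ 16 * 2 ^ E * (2 ^ (L + 1) * 2 ^ ((L + 1) * 2)) :=
      Nat.mul_le_mul (Nat.mul_le_mul_left _ h1) (Nat.mul_le_mul hnL.le h3)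
    rw [← pow_add, ← pow_add, ← pow_add] at h2
    exact h2.trans (Nat.pow_le_pow_right (by norm_num) (by omega))
  have hent : ∀ x ∈ l, x < 2 ^ w := fun x hx =>
    (hl2 x hx).trans_le (Nat.pow_le_pow_right (by norm_num) (by omega))
  refine ⟨l.length, memOf w l, hlen.trans (Nat.mul_le_mul_right _ (by omega)), ?_⟩
  intro a ha b hb
  obtain ⟨H⟩ := hl3 w _ (memOf w l) hlenw (by omega) (stored_memOf hent)
  simp only [grid, mem_product, mem_Icc] at ha hb
  have hWP := wp_rangeQuery (ρ := fun r => [a.1, b.1, a.2, b.2].getD r 0) H hg hf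
    (show a.1 < 2 ^ (L + 2) by omega) (show a.2 < 2 ^ (L + 2) by omega)
    (show b.1 + 1 < 2 ^ (L + 2) by omega) (show b.2 + 1 < 2 ^ (L + 2) by omega) rfl rfl rfl rfl
  change WP _ _ _ fun t ρ' => _ ∧ RangeOutcome g f₀ K (rangeCount P a b) (ρ' 0) at hWP
  have hlt : ∀ k, RangeOutcome g f₀ K (rangeCount P a b) k → k < 2 ^ w := by
    intro k hk
    have h1 : rangeCount P a b ≤ #P := card_filter_le _ _
    have h2 : 2 ^ (L + 1) ≤ 2 ^ w := Nat.pow_le_pow_right (by norm_num) (by omega)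
    have := hk.le
    omega
  obtain ⟨k, hk1, hk2⟩ := exists_answers
    (T := (2 ^ 16 * E + 20 * familyTime g f₀ K + 300) * (Nat.log 2 L + 1)) hlt <| hWP.mono <| by
    rintro t ρ' ⟨ht, hr⟩
    refine ⟨ht.trans ?_, hr⟩
    have h1 : Nat.log 2 (L + 2) ≤ Nat.log 2 L + 2 := log_log_le n 1
    have h4 : Nat.log 2 (4 * (L + 2)) = Nat.log 2 (L + 2) + 2 := by
      rw [← log_mul_two_pow (show 0 < L + 2 by omega) 2, Nat.mul_comm]; norm_num
    have h2 : familyTime g f₀ K * (Nat.log 2 (4 * (L + 2)) + 1) ≤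
        familyTime g f₀ K * (5 * (Nat.log 2 L + 1)) := Nat.mul_le_mul_left _ (by omega)
    have h3 : (2 ^ 16 * E + 20 * familyTime g f₀ K + 300) * (Nat.log 2 L + 1) =
      4 * (familyTime g f₀ K * (5 * (Nat.log 2 L + 1))) + 300 * (Nat.log 2 L + 1) +
        2 ^ 16 * E * (Nat.log 2 L + 1) := by ring
    rw [h3]
    refine Nat.le_add_right_of_le (Nat.add_le_add (Nat.mul_le_mul_left _ h2) ?_)
    omega
  exact ⟨k, hk1, hk2.error_le hc0 hE⟩

end WordRAM

theorem theorem7 (c : ℝ) (hc0 : 0 < c) (hc1 : c < 1) :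
    (∃ (p : WordRAM.Prog) (κ C : ℕ), ∀ n w : ℕ, κ * (Nat.log 2 n + 1) ≤ w →
      ∀ P : Finset (ℕ × ℕ), P ⊆ grid n → P.card ≤ n →
        ∃ (S : ℕ) (D : Fin S → BitVec w), S ≤ C * n ∧
          ∀ q ∈ grid n, ∃ k' : ℕ,
            WordRAM.Answers p D [q.1, q.2] (C * (Nat.log 2 (Nat.log 2 n) + 1)) k' ∧
            |(k' : ℝ) - (dominanceCount P q : ℝ)| ≤ (dominanceCount P q : ℝ) ^ c) ∧
    (∃ (p : WordRAM.Prog) (κ C : ℕ), ∀ n w : ℕ, κ * (Nat.log 2 n + 1) ≤ w →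
      ∀ P : Finset (ℕ × ℕ), P ⊆ grid n → P.card ≤ n →
        ∃ (S : ℕ) (D : Fin S → BitVec w), S ≤ C * (n * (Nat.log 2 n + 1) ^ 2) ∧
          ∀ a ∈ grid n, ∀ b ∈ grid n, ∃ k' : ℕ,
            WordRAM.Answers p D [a.1, b.1, a.2, b.2]
              (C * (Nat.log 2 (Nat.log 2 n) + 1)) k' ∧
            |(k' : ℝ) - (rangeCount P a b : ℝ)| ≤ (rangeCount P a b : ℝ) ^ c) :=
  ⟨WordRAM.exists_dominance_structure hc0, WordRAM.exists_range_structure hc0⟩
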